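/- A polygonal curve with vertices $p_1,\dots,p_n\in\mathbb{R}^d$ is the map $P\colon[1,n]\to\mathbb{R}^d$ with $P(t)=p_i+(t-i)(p_{i+1}-p_i)$ for $t\in[i,i+1]$. It is $c$-packed if for every $r>0$ and every ball $B$ of radius $r$ the total length of $P$ inside $B$ is at most $cr$. The Fréchet distance of curves $P$ and $Q$ with $n$ and $m$ vertices is $d_F(P,Q)=\inf_{(f,g)}\max_{t\in[0,1]}\|P(f(t))-Q(g(t))\|$ (Euclidean norm), where $f$ and $g$ range over the non-decreasing surjections from $[0,1]$ onto $[1,n]$ and $[1,m]$, respectively. Consider the real RAM: a machine with exact real arithmetic ($+,-,\cdot,/,\sqrt{\ }$ and comparisons), addition, subtraction and comparison of natural numbers, the conversion of natural numbers to real numbers, and indirect addressing, at unit cost per operation, and without rounding. **Theorem.** There are a single real-RAM program and an absolute constant $C>0$ such that the following holds. For all integers $d,n,m\ge 1$, all polygonal curves $P$ and $Q$ in $\mathbb{R}^d$ with $n$ and $m$ vertices, respectively, and all $\varepsilon\in(0,1]$, the program, given only $d$, $n$, $m$, the coordinates of the vertices of $P$ and $Q$, and $\varepsilon$, halts and outputs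 a number $\Delta$ with $$d_F(P,Q)\le\Delta\le(1+\varepsilon)\,d_F(P,Q),$$ and for every $c\ge 1$ such that at least one of $P$ and $Q$ is $c$-packed, it does so within at most $$C\cdot d\cdot c\cdot\frac{n+m}{\varepsilon}\,\log\frac{n+m}{\varepsilon}$$ steps. In particular, the program is given neither $c$ nor the information which of the curves is $c$-packed. -/

import Mathlib

/-! ### Polygonal curves, packedness and the Fréchet distance -/

namespace PolygonalCurve

/-- The `i`-th vertex (counting from `0`) of the curve with vertices `p 0, …, p (n - 1)`.
The value for `i ≥ n` is irrelevant. -/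
noncomputable def vertex {d n : ℕ} (p : Fin n → EuclideanSpace ℝ (Fin d)) (i : ℕ) :
    EuclideanSpace ℝ (Fin d) :=
  if h : i < n then p ⟨i, h⟩ else 0

/-- The piecewise linear curve with vertices `p 0, …, p (n - 1)`, parametrised over `[0, n - 1]`:
on `[i, i + 1]` it is `p i + (t - i) • (p (i + 1) - p i)`. -/
noncomputable def point {d n : ℕ} (p : Fin n → EuclideanSpace ℝ (Fin d)) (t : ℝ) :
    EuclideanSpace ℝ (Fin d) :=
  vertex p ⌊t⌋₊ + (t - (⌊t⌋₊ : ℝ)) • (vertex p (⌊t⌋₊ + 1) - vertex p ⌊t⌋₊)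

/-- The length of the part of the segment from `a` to `b` inside the closed ball `B(x, r)`. -/
noncomputable def segmentLengthInBall {d : ℕ} (a b x : EuclideanSpace ℝ (Fin d)) (r : ℝ) : ℝ :=
  ‖b - a‖ * (MeasureTheory.volume
    {s : ℝ | s ∈ Set.Icc (0 : ℝ) 1 ∧ a + s • (b - a) ∈ Metric.closedBall x r}).toReal

/-- The total length of the curve inside the closed ball `B(x, r)`, edge by edge. -/
noncomputable def lengthInBall {d n : ℕ} (p : Fin n → EuclideanSpace ℝ (Fin d))
    (x : EuclideanSpace ℝ (Fin d)) (r : ℝ) : ℝ :=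
  ∑ i ∈ Finset.range (n - 1), segmentLengthInBall (vertex p i) (vertex p (i + 1)) x r

/-- A curve is `c`-packed if its length inside every ball of radius `r > 0` is at most `c * r`. -/
def IsPacked {d n : ℕ} (c : ℝ) (p : Fin n → EuclideanSpace ℝ (Fin d)) : Prop :=
  ∀ (x : EuclideanSpace ℝ (Fin d)) (r : ℝ), 0 < r → lengthInBall p x r ≤ c * r

/-- `f` restricts to a non-decreasing surjection from `[0, 1]` onto the parameter interval
`[0, n - 1]` of a curve with `n` vertices. -/
def IsReparam (n : ℕ) (f : ℝ → ℝ) : Prop :=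
  MonotoneOn f (Set.Icc 0 1) ∧ f '' Set.Icc 0 1 = Set.Icc 0 ((n : ℝ) - 1)

/-- The continuous Fréchet distance: the infimum, over all matchings `(f, g)`, of the largest
distance between matched points. -/
noncomputable def frechetDist {d n m : ℕ} (p : Fin n → EuclideanSpace ℝ (Fin d))
    (q : Fin m → EuclideanSpace ℝ (Fin d)) : ℝ :=
  sInf {D : ℝ | ∃ f g : ℝ → ℝ, IsReparam n f ∧ IsReparam m g ∧
    IsLUB ((fun t => ‖point p (f t) - point q (g t)‖) '' Set.Icc (0 : ℝ) 1) D}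

end PolygonalCurve

/-! ### A real RAM with a step count

Programs are finite pieces of syntax. They work on a memory of natural numbers (used for counting
and addressing) and a memory of exact real numbers. Each memory is divided into unbounded arrays,
named by natural numbers; a program mentions finitely many of them, and indices into arrays are
computed at run time. Natural numbers can be added, subtracted and compared; real numbers
can be added, subtracted, multiplied, divided, compared, and square roots can be taken. There is no
rounding, and the only constants are natural numbers. Every memory access, constant, operation,
test and assignment costs one step. -/

namespace RealRAM

/-- The contents of the memory: entry `i` of array `a`. -/
structure Store where
  nat : ℕ → ℕ → ℕ
  real : ℕ → ℕ → ℝ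

/-- Overwrite entry `i` of the array `a` of natural numbers. -/
def Store.setNat (σ : Store) (a i v : ℕ) : Store :=
  { σ with nat := Function.update σ.nat a (Function.update (σ.nat a) i v) }

/-- Overwrite entry `i` of the array `a` of real numbers. -/
noncomputable def Store.setReal (σ : Store) (a i : ℕ) (v : ℝ) : Store :=
  { σ with real := Function.update σ.real a (Function.update (σ.real a) i v) }

/-- Expressions for natural numbers. -/
inductive NatExpr where
  | const (k : ℕ)
  | load (a : ℕ) (i : NatExpr)
  | add (e₁ e₂ : NatExpr)
  | sub (e₁ e₂ : NatExpr)

/-- The value of an expression; subtraction is truncated at `0`. -/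
def NatExpr.eval (σ : Store) : NatExpr → ℕ
  | const k => k
  | load a i => σ.nat a (i.eval σ)
  | add e₁ e₂ => e₁.eval σ + e₂.eval σ
  | sub e₁ e₂ => e₁.eval σ - e₂.eval σ

/-- The number of steps needed to evaluate an expression. -/
def NatExpr.cost : NatExpr → ℕ
  | const _ => 1
  | load _ i => i.cost + 1
  | add e₁ e₂ => e₁.cost + e₂.cost + 1
  | sub e₁ e₂ => e₁.cost + e₂.cost + 1

/-- Expressions for real numbers. -/
inductive RealExpr where
  | ofNat (e : NatExpr)
  | load (a : ℕ) (i : NatExpr)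
  | add (e₁ e₂ : RealExpr)
  | sub (e₁ e₂ : RealExpr)
  | mul (e₁ e₂ : RealExpr)
  | div (e₁ e₂ : RealExpr)
  | sqrt (e : RealExpr)

/-- The value of an expression; a division by `0` and the square root of a negative number
return `0`. -/
noncomputable def RealExpr.eval (σ : Store) : RealExpr → ℝ
  | ofNat e => (e.eval σ : ℝ)
  | load a i => σ.real a (i.eval σ)
  | add e₁ e₂ => e₁.eval σ + e₂.eval σ
  | sub e₁ e₂ => e₁.eval σ - e₂.eval σ
  | mul e₁ e₂ => e₁.eval σ * e₂.eval σ
  | div e₁ e₂ => e₁.eval σ / e₂.eval σ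
  | sqrt e => Real.sqrt (e.eval σ)

/-- The number of steps needed to evaluate an expression. -/
def RealExpr.cost : RealExpr → ℕ
  | ofNat e => e.cost + 1
  | load _ i => i.cost + 1
  | add e₁ e₂ => e₁.cost + e₂.cost + 1
  | sub e₁ e₂ => e₁.cost + e₂.cost + 1
  | mul e₁ e₂ => e₁.cost + e₂.cost + 1
  | div e₁ e₂ => e₁.cost + e₂.cost + 1
  | sqrt e => e.cost + 1

/-- Tests. -/
inductive Test where
  | natLe (e₁ e₂ : NatExpr)
  | realLe (e₁ e₂ : RealExpr)
  | not (b : Test)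
  | and (b₁ b₂ : Test)
  | or (b₁ b₂ : Test)

/-- Whether a test succeeds. -/
def Test.Holds (σ : Store) : Test → Prop
  | natLe e₁ e₂ => e₁.eval σ ≤ e₂.eval σ
  | realLe e₁ e₂ => e₁.eval σ ≤ e₂.eval σ
  | not b => ¬ b.Holds σ
  | and b₁ b₂ => b₁.Holds σ ∧ b₂.Holds σ
  | or b₁ b₂ => b₁.Holds σ ∨ b₂.Holds σ

/-- The number of steps needed to evaluate a test (all parts of which are evaluated). -/
def Test.cost : Test → ℕ
  | natLe e₁ e₂ => e₁.cost + e₂.cost + 1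
  | realLe e₁ e₂ => e₁.cost + e₂.cost + 1
  | not b => b.cost + 1
  | and b₁ b₂ => b₁.cost + b₂.cost + 1
  | or b₁ b₂ => b₁.cost + b₂.cost + 1

/-- Programs: no operation, assignments to the entry `i` of an array `a`, composition, branching,
and while-loops. -/
inductive Program where
  | skip
  | storeNat (a : ℕ) (i e : NatExpr)
  | storeReal (a : ℕ) (i : NatExpr) (e : RealExpr)
  | seq (A B : Program)
  | branch (b : Test) (A B : Program)
  | loop (b : Test) (A : Program)

/-- `Runs A σ t σ'`: started with memory `σ`, the program `A` halts after exactly `t` steps, with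
memory `σ'`. -/
inductive Runs : Program → Store → ℕ → Store → Prop where
  | skip (σ : Store) : Runs Program.skip σ 1 σ
  | storeNat (σ : Store) (a : ℕ) (i e : NatExpr) :
      Runs (Program.storeNat a i e) σ (i.cost + e.cost + 1) (σ.setNat a (i.eval σ) (e.eval σ))
  | storeReal (σ : Store) (a : ℕ) (i : NatExpr) (e : RealExpr) :
      Runs (Program.storeReal a i e) σ (i.cost + e.cost + 1)
        (σ.setReal a (i.eval σ) (e.eval σ))
  | seq {A B : Program} {σ σ' σ'' : Store} {t t' : ℕ} :
      Runs A σ t σ' → Runs B σ' t' σ'' → Runs (Program.seq A B) σ (t + t') σ''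
  | branchTrue {b : Test} {A B : Program} {σ σ' : Store} {t : ℕ} :
      b.Holds σ → Runs A σ t σ' → Runs (Program.branch b A B) σ (b.cost + t + 1) σ'
  | branchFalse {b : Test} {A B : Program} {σ σ' : Store} {t : ℕ} :
      ¬ b.Holds σ → Runs B σ t σ' → Runs (Program.branch b A B) σ (b.cost + t + 1) σ'
  | loopDone {b : Test} {A : Program} {σ : Store} :
      ¬ b.Holds σ → Runs (Program.loop b A) σ (b.cost + 1) σ
  | loopStep {b : Test} {A : Program} {σ σ' σ'' : Store} {t t' : ℕ} :
      b.Holds σ → Runs A σ t σ' → Runs (Program.loop b A) σ' t' σ'' →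
        Runs (Program.loop b A) σ (b.cost + t + t' + 1) σ''

/-- The array that lists the coordinates of the vertices of a curve, vertex by vertex:
coordinate `k` of vertex `i` is entry `i * d + k`. All other entries are `0`. -/
noncomputable def curveArray {d n : ℕ} (p : Fin n → EuclideanSpace ℝ (Fin d)) (j : ℕ) : ℝ :=
  if h : 0 < d then PolygonalCurve.vertex p (j / d) ⟨j % d, Nat.mod_lt j h⟩ else 0

/-- The initial memory. Natural numbers: entry `0` of the arrays `0`, `1`, `2` holds `d`, `n`, `m`.
Real numbers: the arrays `0` and `1` hold the two curves, and entry `0` of array `2` holds `ε`.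
All other entries are `0`. -/
noncomputable def inputStore {d n m : ℕ} (p : Fin n → EuclideanSpace ℝ (Fin d))
    (q : Fin m → EuclideanSpace ℝ (Fin d)) (ε : ℝ) : Store where
  nat a i := if i = 0 then (if a = 0 then d else if a = 1 then n else if a = 2 then m else 0) else 0
  real a i :=
    if a = 0 then curveArray p i else if a = 1 then curveArray q i
    else if a = 2 ∧ i = 0 then ε else 0

/-- The output of a program: entry `0` of the array `3` of real numbers. -/
def output (σ : Store) : ℝ := σ.real 3 0

end RealRAM

/-! ### Total correctness with a time bound for the real RAM -/

namespace RealRAM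

/-! The algorithm brackets the Fréchet distance and then bisects, testing each candidate δ on
simplified curves. Packedness enters only through the number of free-space cells that a test visits.

Chains. On a pair of edges the distance is convex in the pair of parameters, so free points of one
cell in monotone position can be joined inside the free space. A matching of width r is thus as good
as a monotone chain of free points, each step inside one cell (`Reach.exists_matching`,
`exists_reach_of_isReparam`), and n + m steps suffice. Curves are prolonged by repeating the last
vertex (`ext`), so that a curve with n vertices has n ≥ 1 edges and single points need no special
treatment.

Bracket. Along a chain of k steps of width r the arc lengths differ by at most 2rk. Traversing both
curves simultaneously by arc length therefore meets only distances up to (2k + 1)r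
(`Balanced.dist_le`), and the largest one, D, satisfies d_F ≤ D ≤ (2(n + m) + 1) d_F. Bisection from
this bracket down to the ratio 1 + ε/3 takes O(log((n + m)/ε)) rounds.

Test. Let μ = εδ/12. Skipping vertices within μ of the last kept one costs at most μ per curve, in
both directions (`reachable_simplification`, `reachable_of_simplification`). Deciding the radius δ +
2μ for the simplified curves certifies either d_F ≤ δ + 4μ = (1 + ε/3)δ or δ ≤ d_F. Only reachable
cells are visited, row by row, with a queue for the cells above, at cost O(d) each.

Count (`card_reachableCells_le`). Let the first curve be c-packed, and set aside cells on the last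
edges, which may be short. If the second curve's edge is not long compared with the first one's, the
cell is charged to the second curve's edge: the other edges in question stem from disjoint pieces of
the packed curve that come near this edge and have large extent, so O(c/ε) of them exist
(`card_long_edges_le`). Otherwise it is charged to the packed curve's edge: a chain to the last of
these cells matches the earlier long edges to disjoint pieces of the packed curve of large extent
close to that edge, so O(c) of them exist (`card_short_edges_le`). The second case needs
reachability of the cells, not only free points in them.

Unknown c. The program uses no bound on the cells. Its time is estimated by the least number B that
bounds the reachable cells at all scales, and B is at most 278c(n + m)/ε for every admissible c,
whichever curve is packed.

Programs are verified by symbolic execution: `Ends` combines halting, a time budget and a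
postcondition, and `Frame` records which arrays may have changed. -/

instance : Add NatExpr := ⟨NatExpr.add⟩
instance : Add RealExpr := ⟨RealExpr.add⟩
instance : Sub RealExpr := ⟨RealExpr.sub⟩
instance : Mul RealExpr := ⟨RealExpr.mul⟩
instance : Div RealExpr := ⟨RealExpr.div⟩

/-- The natural number in entry `0` of array `a`, used as a variable. -/
def natVar (a : ℕ) : NatExpr := NatExpr.load a (NatExpr.const 0)

/-- The real number in entry `0` of array `a`, used as a variable. -/
def realVar (a : ℕ) : RealExpr := RealExpr.load a (NatExpr.const 0)

/-- A natural number as a constant real number. -/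
def realConst (k : ℕ) : RealExpr := RealExpr.ofNat (NatExpr.const k)

/-- Assignment to a natural number variable. -/
def setNatVar (a : ℕ) (e : NatExpr) : Program := Program.storeNat a (NatExpr.const 0) e

/-- Assignment to a real number variable. -/
def setRealVar (a : ℕ) (e : RealExpr) : Program := Program.storeReal a (NatExpr.const 0) e

infixr:60 ";;" => Program.seq

section Eval

variable (σ : Store)

@[simp] theorem NatExpr.eval_const (k : ℕ) : (NatExpr.const k).eval σ = k := rfl
@[simp] theorem NatExpr.eval_load (a : ℕ) (i : NatExpr) :
    (NatExpr.load a i).eval σ = σ.nat a (i.eval σ) := rfl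
@[simp] theorem NatExpr.eval_add (e f : NatExpr) : (e + f).eval σ = e.eval σ + f.eval σ := rfl
@[simp] theorem eval_natVar (a : ℕ) : (natVar a).eval σ = σ.nat a 0 := rfl
@[simp] theorem RealExpr.eval_ofNat (e : NatExpr) :
    (RealExpr.ofNat e).eval σ = (e.eval σ : ℝ) := rfl
@[simp] theorem RealExpr.eval_load (a : ℕ) (i : NatExpr) :
    (RealExpr.load a i).eval σ = σ.real a (i.eval σ) := rfl
@[simp] theorem RealExpr.eval_add (e f : RealExpr) : (e + f).eval σ = e.eval σ + f.eval σ := rfl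
@[simp] theorem RealExpr.eval_sub (e f : RealExpr) : (e - f).eval σ = e.eval σ - f.eval σ := rfl
@[simp] theorem RealExpr.eval_mul (e f : RealExpr) : (e * f).eval σ = e.eval σ * f.eval σ := rfl
@[simp] theorem RealExpr.eval_div (e f : RealExpr) : (e / f).eval σ = e.eval σ / f.eval σ := rfl
@[simp] theorem RealExpr.eval_sqrt (e : RealExpr) :
    (RealExpr.sqrt e).eval σ = Real.sqrt (e.eval σ) := rfl
@[simp] theorem eval_realVar (a : ℕ) : (realVar a).eval σ = σ.real a 0 := rfl
@[simp] theorem eval_realConst (k : ℕ) : (realConst k).eval σ = (k : ℝ) := rfl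

@[simp] theorem Test.holds_natLe (e f : NatExpr) :
    (Test.natLe e f).Holds σ ↔ e.eval σ ≤ f.eval σ := Iff.rfl
@[simp] theorem Test.holds_realLe (e f : RealExpr) :
    (Test.realLe e f).Holds σ ↔ e.eval σ ≤ f.eval σ := Iff.rfl
@[simp] theorem Test.holds_not (b : Test) : (Test.not b).Holds σ ↔ ¬ b.Holds σ := Iff.rfl
@[simp] theorem Test.holds_and (b c : Test) :
    (Test.and b c).Holds σ ↔ b.Holds σ ∧ c.Holds σ := Iff.rfl
@[simp] theorem Test.holds_or (b c : Test) :
    (Test.or b c).Holds σ ↔ b.Holds σ ∨ c.Holds σ := Iff.rfl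

@[simp] theorem Store.nat_setNat_self (a i v : ℕ) :
    (σ.setNat a i v).nat a = Function.update (σ.nat a) i v := by simp [Store.setNat]
@[simp] theorem Store.nat_setNat_of_ne {a b : ℕ} (h : b ≠ a) (i v : ℕ) :
    (σ.setNat a i v).nat b = σ.nat b := by simp [Store.setNat, h]
@[simp] theorem Store.real_setNat (a i v : ℕ) : (σ.setNat a i v).real = σ.real := rfl
@[simp] theorem Store.nat_setReal (a i : ℕ) (v : ℝ) : (σ.setReal a i v).nat = σ.nat := rfl
@[simp] theorem Store.real_setReal_self (a i : ℕ) (v : ℝ) :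
    (σ.setReal a i v).real a = Function.update (σ.real a) i v := by simp [Store.setReal]
@[simp] theorem Store.real_setReal_of_ne {a b : ℕ} (h : b ≠ a) (i : ℕ) (v : ℝ) :
    (σ.setReal a i v).real b = σ.real b := by simp [Store.setReal, h]

end Eval

/-- Started with memory `σ`, the program halts within `T` steps with a memory satisfying `Φ`. -/
def Ends (A : Program) (σ : Store) (T : ℕ) (Φ : Store → Prop) : Prop :=
  ∃ t σ', Runs A σ t σ' ∧ t ≤ T ∧ Φ σ'

namespace Ends

variable {A B : Program} {b : Test} {σ : Store} {T T' : ℕ} {Φ Ψ : Store → Prop}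

theorem mono (h : Ends A σ T Φ) (hT : T ≤ T') (hΦ : ∀ σ', Φ σ' → Ψ σ') : Ends A σ T' Ψ := by
  obtain ⟨t, σ', h₁, h₂, h₃⟩ := h
  exact ⟨t, σ', h₁, h₂.trans hT, hΦ _ h₃⟩

theorem mono_time (h : Ends A σ T Φ) (hT : T ≤ T') : Ends A σ T' Φ := h.mono hT fun _ => id

theorem skip (h : Φ σ) : Ends Program.skip σ 1 Φ := ⟨1, σ, Runs.skip σ, le_rfl, h⟩

theorem storeNat {a : ℕ} {i e : NatExpr} (h : Φ (σ.setNat a (i.eval σ) (e.eval σ))) :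
    Ends (Program.storeNat a i e) σ (i.cost + e.cost + 1) Φ :=
  ⟨_, _, Runs.storeNat σ a i e, le_rfl, h⟩

theorem storeReal {a : ℕ} {i : NatExpr} {e : RealExpr}
    (h : Φ (σ.setReal a (i.eval σ) (e.eval σ))) :
    Ends (Program.storeReal a i e) σ (i.cost + e.cost + 1) Φ :=
  ⟨_, _, Runs.storeReal σ a i e, le_rfl, h⟩

theorem setNatVar {a : ℕ} {e : NatExpr} (h : Φ (σ.setNat a 0 (e.eval σ))) :
    Ends (setNatVar a e) σ (e.cost + 2) Φ :=
  ⟨_, _, Runs.storeNat σ a (NatExpr.const 0) e, by simp only [NatExpr.cost]; omega, h⟩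

theorem setRealVar {a : ℕ} {e : RealExpr} (h : Φ (σ.setReal a 0 (e.eval σ))) :
    Ends (setRealVar a e) σ (e.cost + 2) Φ :=
  ⟨_, _, Runs.storeReal σ a (NatExpr.const 0) e, by simp only [NatExpr.cost]; omega, h⟩

theorem seq (h : Ends A σ T fun σ' => Ends B σ' T' Φ) : Ends (A ;; B) σ (T + T') Φ := by
  obtain ⟨t, σ', h₁, h₂, t', σ'', h₃, h₄, h₅⟩ := h
  exact ⟨_, _, Runs.seq h₁ h₃, by omega, h₅⟩

theorem branch (hA : b.Holds σ → Ends A σ T Φ) (hB : ¬ b.Holds σ → Ends B σ T' Φ) :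
    Ends (Program.branch b A B) σ (b.cost + max T T' + 1) Φ := by
  by_cases hb : b.Holds σ
  · obtain ⟨t, σ', h₁, h₂, h₃⟩ := hA hb
    exact ⟨_, _, Runs.branchTrue hb h₁, by have := le_max_left T T'; omega, h₃⟩
  · obtain ⟨t, σ', h₁, h₂, h₃⟩ := hB hb
    exact ⟨_, _, Runs.branchFalse hb h₁, by have := le_max_right T T'; omega, h₃⟩

/-- The rule for loops: an invariant `I` indexed by a bound for the number of iterations left. -/
theorem loop (I : ℕ → Store → Prop)
    (h : ∀ v σ, I v σ → b.Holds σ → Ends A σ T fun σ' => ∃ v' < v, I v' σ') :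
    ∀ (v : ℕ) (σ : Store), I v σ → Ends (Program.loop b A) σ ((v + 1) * (b.cost + T + 1))
      fun σ' => ¬ b.Holds σ' ∧ ∃ v', I v' σ' := by
  intro v
  induction v using Nat.strong_induction_on with
  | _ v ih =>
    intro σ hI
    by_cases hb : b.Holds σ
    · obtain ⟨t, σ', h₁, h₂, v', hv', hI'⟩ := h v σ hI hb
      obtain ⟨t', σ'', h₃, h₄, h₅⟩ := ih v' hv' σ' hI'
      refine ⟨_, _, Runs.loopStep hb h₁ h₃, ?_, h₅⟩
      have h₆ : (v' + 1) * (b.cost + T + 1) ≤ v * (b.cost + T + 1) := Nat.mul_le_mul_right _ hv'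
      have h₇ : (v + 1) * (b.cost + T + 1) = v * (b.cost + T + 1) + (b.cost + T + 1) := by ring
      omega
    · refine ⟨_, _, Runs.loopDone hb, ?_, hb, v, hI⟩
      have : (v + 1) * (b.cost + T + 1) = v * (b.cost + T + 1) + (b.cost + T + 1) := by ring
      omega

section Budget

/-! Rules for symbolic execution: each elementary step takes at most `40` of the time budget. -/

theorem setNatVar_le {a : ℕ} {e : NatExpr} (h : Φ (σ.setNat a 0 (e.eval σ)))
    (he : e.cost + 2 ≤ 40 := by exact Nat.le_of_ble_eq_true rfl) (hT : 40 ≤ T := by omega) :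
    Ends (RealRAM.setNatVar a e) σ T Φ := (Ends.setNatVar h).mono_time (he.trans hT)

theorem setRealVar_le {a : ℕ} {e : RealExpr} (h : Φ (σ.setReal a 0 (e.eval σ)))
    (he : e.cost + 2 ≤ 40 := by exact Nat.le_of_ble_eq_true rfl) (hT : 40 ≤ T := by omega) :
    Ends (RealRAM.setRealVar a e) σ T Φ := (Ends.setRealVar h).mono_time (he.trans hT)

theorem skip_le (h : Φ σ) (hT : 1 ≤ T := by omega) : Ends Program.skip σ T Φ :=
  (Ends.skip h).mono_time hT

theorem then_le (T₁ : ℕ) (h : Ends A σ T₁ fun σ' => Ends B σ' (T - T₁) Φ)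
    (hT : T₁ ≤ T := by omega) : Ends (A ;; B) σ T Φ := (Ends.seq h).mono_time (by omega)

theorem setNatVar_then {a : ℕ} {e : NatExpr}
    (h : Ends B (σ.setNat a 0 (e.eval σ)) (T - 40) Φ)
    (he : e.cost + 2 ≤ 40 := by exact Nat.le_of_ble_eq_true rfl) (hT : 40 ≤ T := by omega) :
    Ends (RealRAM.setNatVar a e ;; B) σ T Φ := then_le 40 (setNatVar_le h he le_rfl) hT

theorem setRealVar_then {a : ℕ} {e : RealExpr}
    (h : Ends B (σ.setReal a 0 (e.eval σ)) (T - 40) Φ)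
    (he : e.cost + 2 ≤ 40 := by exact Nat.le_of_ble_eq_true rfl) (hT : 40 ≤ T := by omega) :
    Ends (RealRAM.setRealVar a e ;; B) σ T Φ := then_le 40 (setRealVar_le h he le_rfl) hT

theorem storeNat_then {a : ℕ} {i e : NatExpr}
    (h : Ends B (σ.setNat a (i.eval σ) (e.eval σ)) (T - 40) Φ)
    (he : i.cost + e.cost + 1 ≤ 40 := by exact Nat.le_of_ble_eq_true rfl)
    (hT : 40 ≤ T := by omega) : Ends (Program.storeNat a i e ;; B) σ T Φ :=
  then_le 40 ((Ends.storeNat h).mono_time he) hT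

theorem storeReal_then {a : ℕ} {i : NatExpr} {e : RealExpr}
    (h : Ends B (σ.setReal a (i.eval σ) (e.eval σ)) (T - 40) Φ)
    (he : i.cost + e.cost + 1 ≤ 40 := by exact Nat.le_of_ble_eq_true rfl)
    (hT : 40 ≤ T := by omega) : Ends (Program.storeReal a i e ;; B) σ T Φ :=
  then_le 40 ((Ends.storeReal h).mono_time he) hT

theorem skip_then (h : Ends B σ (T - 1) Φ) (hT : 1 ≤ T := by omega) :
    Ends (Program.skip ;; B) σ T Φ := then_le 1 (Ends.skip h) hT

theorem branch_le (hA : b.Holds σ → Ends A σ (T - 40) Φ) (hB : ¬ b.Holds σ → Ends B σ (T - 40) Φ)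
    (he : b.cost + 1 ≤ 40 := by exact Nat.le_of_ble_eq_true rfl) (hT : 40 ≤ T := by omega) :
    Ends (Program.branch b A B) σ T Φ :=
  (Ends.branch hA hB).mono_time (by rw [max_self]; omega)

theorem assoc {C : Program} (h : Ends (A ;; B ;; C) σ T Φ) : Ends ((A ;; B) ;; C) σ T Φ := by
  obtain ⟨t, σ', h₁, h₂, h₃⟩ := h
  cases h₁ with
  | seq hA hBC =>
    cases hBC with
    | seq hB hC => exact ⟨_, σ', .seq (.seq hA hB) hC, by omega, h₃⟩

/-- The continuation is executed separately after each alternative, so no common postcondition of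
the two branches has to be formulated. -/
theorem branch_then {C : Program} (hA : b.Holds σ → Ends (A ;; C) σ (T - 40) Φ)
    (hB : ¬ b.Holds σ → Ends (B ;; C) σ (T - 40) Φ)
    (he : b.cost + 1 ≤ 40 := by exact Nat.le_of_ble_eq_true rfl) (hT : 40 ≤ T := by omega) :
    Ends (Program.branch b A B ;; C) σ T Φ := by
  by_cases hb : b.Holds σ
  · obtain ⟨t, σ', h₁, h₂, h₃⟩ := hA hb
    cases h₁ with
    | seq hA hC => exact ⟨_, σ', .seq (.branchTrue hb hA) hC, by omega, h₃⟩
  · obtain ⟨t, σ', h₁, h₂, h₃⟩ := hB hb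
    cases h₁ with
    | seq hB hC => exact ⟨_, σ', .seq (.branchFalse hb hB) hC, by omega, h₃⟩

/-- The factor `v + 1` pays for up to `v` iterations and for the final failing test. -/
theorem loop_le {v : ℕ} (T : ℕ) (I : ℕ → Store → Prop) (hI : I v σ)
    (h : ∀ v σ, I v σ → b.Holds σ → Ends A σ T fun σ' => ∃ v' < v, I v' σ')
    (hΦ : ∀ v' σ', I v' σ' → ¬ b.Holds σ' → Φ σ') (hT : (v + 1) * (T + 40) ≤ T')
    (he : b.cost + 1 ≤ 40 := by exact Nat.le_of_ble_eq_true rfl) :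
    Ends (Program.loop b A) σ T' Φ :=
  (Ends.loop I h v σ hI).mono ((Nat.mul_le_mul_left _ (by omega)).trans hT)
    fun σ' h' => let ⟨v', hv'⟩ := h'.2; hΦ v' σ' hv' h'.1

end Budget

end Ends

/-- `σ'` agrees with `σ` outside the listed arrays of natural and of real numbers. -/
structure Frame (Ns Rs : List ℕ) (σ σ' : Store) : Prop where
  nat : ∀ a, a ∉ Ns → σ'.nat a = σ.nat a
  real : ∀ a, a ∉ Rs → σ'.real a = σ.real a

namespace Frame

variable {Ns Ns' Rs Rs' : List ℕ} {σ σ' σ'' : Store}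

theorem refl (Ns Rs : List ℕ) (σ : Store) : Frame Ns Rs σ σ := ⟨fun _ _ => rfl, fun _ _ => rfl⟩

theorem trans (h : Frame Ns Rs σ σ') (h' : Frame Ns Rs σ' σ'') : Frame Ns Rs σ σ'' :=
  ⟨fun a ha => (h'.nat a ha).trans (h.nat a ha), fun a ha => (h'.real a ha).trans (h.real a ha)⟩

theorem mono (h : Frame Ns Rs σ σ') (hN : Ns ⊆ Ns') (hR : Rs ⊆ Rs') : Frame Ns' Rs' σ σ' :=
  ⟨fun a ha => h.nat a fun h' => ha (hN h'), fun a ha => h.real a fun h' => ha (hR h')⟩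

theorem setNat {a : ℕ} (h : Frame Ns Rs σ σ') (ha : a ∈ Ns) (i v : ℕ) :
    Frame Ns Rs σ (σ'.setNat a i v) :=
  ⟨fun b hb => by
    rw [Store.nat_setNat_of_ne _ (by rintro rfl; exact hb ha), h.nat b hb], h.real⟩

theorem setReal {a : ℕ} (h : Frame Ns Rs σ σ') (ha : a ∈ Rs) (i : ℕ) (v : ℝ) :
    Frame Ns Rs σ (σ'.setReal a i v) :=
  ⟨h.nat, fun b hb => by
    rw [Store.real_setReal_of_ne _ (by rintro rfl; exact hb ha), h.real b hb]⟩

end Frame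

/-! ### Squared distances of vertices -/

/-- The squared distance of the two points whose coordinates start at the entries `o` of `x` and
`o'` of `y`. -/
def sqDistAt (d : ℕ) (x y : ℕ → ℝ) (o o' : ℕ) : ℝ :=
  ∑ k ∈ Finset.range d, (x (o + k) - y (o' + k)) * (x (o + k) - y (o' + k))

/-- Puts the squared distance of the points at the entries `e` of the real array `X` and `f` of the
real array `Y` into the real variable `4`. Uses the natural variables `3`, `4`, `5`. -/
def sqDist (X Y : ℕ) (e f : NatExpr) : Program :=
  setNatVar 4 e ;;
  setNatVar 5 f ;;
  setNatVar 3 (NatExpr.const 0) ;;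
  setRealVar 4 (realConst 0) ;;
  Program.loop (Test.natLe (natVar 3 + NatExpr.const 1) (natVar 0))
    (setRealVar 4 (realVar 4 +
        (RealExpr.load X (natVar 4 + natVar 3) - RealExpr.load Y (natVar 5 + natVar 3)) *
        (RealExpr.load X (natVar 4 + natVar 3) - RealExpr.load Y (natVar 5 + natVar 3))) ;;
      setNatVar 3 (natVar 3 + NatExpr.const 1))

/-- The expression `f` is evaluated after the value of `e` has been stored in variable `4`, hence
the modified memory in its hypothesis. Both offsets are fixed before the loop, so each coordinate
costs a constant. -/
theorem sqDist_ends {X Y : ℕ} {e f : NatExpr} {σ : Store} {d o o' : ℕ} {Φ : Store → Prop}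
    (hX : X ≠ 4) (hY : Y ≠ 4) (hd : σ.nat 0 0 = d) (ho : e.eval σ = o)
    (ho' : f.eval (σ.setNat 4 0 o) = o') (he : e.cost ≤ 10) (hf : f.cost ≤ 10)
    (hΦ : ∀ σ', Frame [3, 4, 5] [4] σ σ' →
      σ'.real 4 0 = sqDistAt d (σ.real X) (σ.real Y) o o' → Φ σ') :
    Ends (sqDist X Y e f) σ (90 * (d + 1)) Φ := by
  let I : ℕ → Store → Prop := fun v σ' => Frame [3, 4, 5] [4] σ σ' ∧ σ'.nat 4 0 = o ∧
    σ'.nat 5 0 = o' ∧ ∃ k, k ≤ d ∧ v = d - k ∧ σ'.nat 3 0 = k ∧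
    σ'.real 4 0 = sqDistAt k (σ.real X) (σ.real Y) o o'
  have hloop : Ends (sqDist X Y e f) σ
      ((e.cost + 2) + ((f.cost + 2) + (3 + (4 + (d + 1) * (7 + 46 + 1))))) Φ := by
    refine Ends.seq (Ends.setNatVar ?_)
    refine Ends.seq (Ends.setNatVar ?_)
    refine Ends.seq (Ends.setNatVar ?_)
    refine Ends.seq (Ends.setRealVar ?_)
    refine (Ends.loop (T := 46) I ?_ d _ ?_).mono le_rfl ?_
    · rintro v σ' ⟨hF, h4, h5, k, hk, rfl, h3, hr⟩ hb
      have h0 : σ'.nat 0 0 = d := by rw [hF.nat 0 (by decide), hd]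
      simp only [Test.holds_natLe, NatExpr.eval_add, eval_natVar, NatExpr.eval_const, h3, h0] at hb
      refine (Ends.seq (Ends.setRealVar (Ends.setNatVar ?_))).mono_time 
        (Nat.le_of_ble_eq_true rfl : _ ≤ 46)
      refine ⟨d - (k + 1), by omega, (hF.setReal (by decide) _ _).setNat (by decide) _ _, ?_, ?_,
        k + 1, hb, rfl, ?_, ?_⟩
      · simpa using h4
      · simpa using h5
      · simp [h3]
      · simp [h3, h4, h5, hr, hF.real X (by simpa using hX), hF.real Y (by simpa using hY),
          sqDistAt, Finset.sum_range_succ]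
    · refine ⟨((((Frame.refl _ _ σ).setNat (by decide) _ _).setNat (by decide) _ _).setNat
        (by decide) _ _).setReal (by decide) _ _, by simp [ho], by simp [ho, ho'], 0, by omega,
        by simp, by simp, by simp [sqDistAt]⟩
    · rintro σ' ⟨hb, v, hF, -, -, k, hk, -, h3, hr⟩
      have h0 : σ'.nat 0 0 = d := by rw [hF.nat 0 (by decide), hd]
      simp only [Test.holds_natLe, NatExpr.eval_add, eval_natVar, NatExpr.eval_const, h3, h0] at hb
      obtain rfl : k = d := by omega
      exact hΦ σ' hF hr
  exact hloop.mono_time (by omega)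

theorem sqDist_then {X Y : ℕ} {e f : NatExpr} {σ : Store} {d o o' T : ℕ} {Φ : Store → Prop}
    {B : Program} (hX : X ≠ 4) (hY : Y ≠ 4) (hd : σ.nat 0 0 = d) (ho : e.eval σ = o)
    (ho' : f.eval (σ.setNat 4 0 o) = o') (he : e.cost ≤ 10) (hf : f.cost ≤ 10)
    (hΦ : ∀ σ', Frame [3, 4, 5] [4] σ σ' →
      σ'.real 4 0 = sqDistAt d (σ.real X) (σ.real Y) o o' → Ends B σ' (T - 90 * (d + 1)) Φ)
    (hT : 90 * (d + 1) ≤ T := by omega) : Ends (sqDist X Y e f ;; B) σ T Φ :=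
  Ends.then_le (90 * (d + 1)) (sqDist_ends hX hY hd ho ho' he hf hΦ) hT

end RealRAM

/-! ### Monotone chains in the free space -/

namespace PolygonalCurve

section Chains

variable {E : Type*} [NormedAddCommGroup E] [NormedSpace ℝ E]

/-- The piecewise linear curve through the points `v 0, v 1, …`. -/
noncomputable def pt (v : ℕ → E) (x : ℝ) : E :=
  v ⌊x⌋₊ + (x - (⌊x⌋₊ : ℝ)) • (v (⌊x⌋₊ + 1) - v ⌊x⌋₊)

/-- The formula of an edge is valid on the closed parameter interval: at the right end, where the
floor jumps, both formulas give the common vertex. Cells can therefore be treated as closed. -/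
theorem pt_eq (v : ℕ → E) {i : ℕ} {x : ℝ} (h₁ : (i : ℝ) ≤ x) (h₂ : x ≤ i + 1) :
    pt v x = v i + (x - i) • (v (i + 1) - v i) := by
  rcases h₂.lt_or_eq with h | h
  · have : ⌊x⌋₊ = i := (Nat.floor_eq_iff ((Nat.cast_nonneg i).trans h₁)).2 ⟨h₁, h⟩
    simp only [pt, this]
  · have : ⌊x⌋₊ = i + 1 := by rw [h]; exact_mod_cast Nat.floor_natCast (i + 1)
    simp only [pt, this]
    simp [h]

@[simp] theorem pt_natCast (v : ℕ → E) (i : ℕ) : pt v i = v i := by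
  rw [pt_eq v le_rfl (by linarith)]; simp

@[simp] theorem pt_zero (v : ℕ → E) : pt v 0 = v 0 := by simpa using pt_natCast v 0

theorem pt_add (v : ℕ → E) {i : ℕ} {s : ℝ} (h₁ : 0 ≤ s) (h₂ : s ≤ 1) :
    pt v (i + s) = v i + s • (v (i + 1) - v i) := by
  rw [pt_eq v (by linarith) (by linarith)]; simp

theorem pt_lineMap (v : ℕ → E) {i : ℕ} {x x' θ : ℝ} (h₁ : (i : ℝ) ≤ x) (h₂ : x ≤ x')
    (h₃ : x' ≤ i + 1) (hθ : 0 ≤ θ) (hθ' : θ ≤ 1) :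
    pt v (x + θ * (x' - x)) = (1 - θ) • pt v x + θ • pt v x' := by
  have h₄ : 0 ≤ θ * (x' - x) := mul_nonneg hθ (by linarith)
  have h₅ : θ * (x' - x) ≤ 1 * (x' - x) := by gcongr
  rw [pt_eq v (i := i) (by linarith) (by linarith), pt_eq v (x := x) h₁ (by linarith),
    pt_eq v (x := x') (by linarith) h₃]
  module

/-- Inside a cell, the distance of the curves is a convex function. -/
theorem dist_pt_le {v w : ℕ → E} {r x y x' y' θ : ℝ} {i j : ℕ} (h₁ : (i : ℝ) ≤ x) (h₂ : x ≤ x')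
    (h₃ : x' ≤ i + 1) (h₄ : (j : ℝ) ≤ y) (h₅ : y ≤ y') (h₆ : y' ≤ j + 1) (hθ : 0 ≤ θ) (hθ' : θ ≤ 1)
    (h : dist (pt v x) (pt w y) ≤ r) (h' : dist (pt v x') (pt w y') ≤ r) :
    dist (pt v (x + θ * (x' - x))) (pt w (y + θ * (y' - y))) ≤ r := by
  rw [pt_lineMap v h₁ h₂ h₃ hθ hθ', pt_lineMap w h₄ h₅ h₆ hθ hθ', dist_eq_norm]
  rw [dist_eq_norm] at h h'
  calc ‖(1 - θ) • pt v x + θ • pt v x' - ((1 - θ) • pt w y + θ • pt w y')‖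
      = ‖(1 - θ) • (pt v x - pt w y) + θ • (pt v x' - pt w y')‖ := by congr 1; module
    _ ≤ (1 - θ) * ‖pt v x - pt w y‖ + θ * ‖pt v x' - pt w y'‖ := by
        refine (norm_add_le _ _).trans ?_
        rw [norm_smul, norm_smul, Real.norm_of_nonneg hθ,
          Real.norm_of_nonneg (by linarith : (0 : ℝ) ≤ 1 - θ)]
    _ ≤ (1 - θ) * r + θ * r := by
        have : 0 ≤ 1 - θ := by linarith
        gcongr
    _ = r := by ring

/-- `Reach v w r k x y`: the point `(x, y)` of the parameter space is reached from `(0, 0)` by a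
monotone chain of `k` steps, each inside a cell, through pairs of points at distance at most `r`. -/
inductive Reach (v w : ℕ → E) (r : ℝ) : ℕ → ℝ → ℝ → Prop
  | start : dist (v 0) (w 0) ≤ r → Reach v w r 0 0 0
  | step {k : ℕ} {x y x₁ y₁ : ℝ} (i j : ℕ) : Reach v w r k x y → (i : ℝ) ≤ x → x ≤ x₁ →
      x₁ ≤ i + 1 → (j : ℝ) ≤ y → y ≤ y₁ → y₁ ≤ j + 1 → dist (pt v x₁) (pt w y₁) ≤ r →
      Reach v w r (k + 1) x₁ y₁

/-- The point `(x, y)` is reached by a monotone chain in the free space. -/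
def Reachable (v w : ℕ → E) (r x y : ℝ) : Prop := ∃ k, Reach v w r k x y

variable {v w : ℕ → E} {r r' x y x' y' : ℝ} {k : ℕ}

namespace Reach

theorem nonneg (h : Reach v w r k x y) : 0 ≤ x ∧ 0 ≤ y := by
  induction h with
  | start h => simp
  | step i j h h₁ h₂ h₃ h₄ h₅ h₆ h₇ ih => exact ⟨by linarith, by linarith⟩

theorem dist_le (h : Reach v w r k x y) : dist (pt v x) (pt w y) ≤ r := by
  cases h with
  | start h => simpa using h
  | step i j h h₁ h₂ h₃ h₄ h₅ h₆ h₇ => exact h₇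

theorem symm (h : Reach v w r k x y) : Reach w v r k y x := by
  induction h with
  | start h => exact .start (by rwa [dist_comm])
  | step i j h h₁ h₂ h₃ h₄ h₅ h₆ h₇ ih =>
    exact .step j i ih h₄ h₅ h₆ h₁ h₂ h₃ (by rwa [dist_comm])

theorem mono (h : Reach v w r k x y) (hr : r ≤ r') : Reach v w r' k x y := by
  induction h with
  | start h => exact .start (h.trans hr)
  | step i j h h₁ h₂ h₃ h₄ h₅ h₆ h₇ ih => exact .step i j ih h₁ h₂ h₃ h₄ h₅ h₆ (h₇.trans hr)

/-- A chain can be traversed continuously, by a matching with all distances at most `r`. -/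
theorem exists_matching (h : Reach v w r k x y) :
    ∃ f g : ℝ → ℝ, Monotone f ∧ Continuous f ∧ Monotone g ∧ Continuous g ∧ f 0 = 0 ∧ f 1 = x ∧
      g 0 = 0 ∧ g 1 = y ∧ ∀ t ∈ Set.Icc (0 : ℝ) 1, dist (pt v (f t)) (pt w (g t)) ≤ r := by
  induction h with
  | start h =>
    exact ⟨fun _ => 0, fun _ => 0, monotone_const, continuous_const, monotone_const,
      continuous_const, rfl, rfl, rfl, rfl, fun t _ => by simpa using h⟩
  | @step k x y x' y' i j h h₁ h₂ h₃ h₄ h₅ h₆ h₇ ih =>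
    obtain ⟨f, g, hf, hf', hg, hg', hf0, hf1, hg0, hg1, hfg⟩ := ih
    -- The new parametrisation runs through the old one at double speed on `[0, 1/2]` and linearly
    -- through the new step on `[1/2, 1]`.
    have key : ∀ (f : ℝ → ℝ) (a b : ℝ), Monotone f → Continuous f → f 0 = 0 → f 1 = a → a ≤ b →
        ∃ F : ℝ → ℝ, Monotone F ∧ Continuous F ∧ F 0 = 0 ∧ F 1 = b ∧
          F = fun t => f (min (2 * t) 1) + max (2 * t - 1) 0 * (b - a) := by
      intro f a b hf hf' hf0 hf1 hab
      refine ⟨_, ?_, by fun_prop, ?_, ?_, rfl⟩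
      · intro s t hst
        have h1 : f (min (2 * s) 1) ≤ f (min (2 * t) 1) := hf (by gcongr)
        have h2 : max (2 * s - 1) 0 * (b - a) ≤ max (2 * t - 1) 0 * (b - a) :=
          mul_le_mul_of_nonneg_right (by gcongr) (by linarith)
        exact add_le_add h1 h2
      · simp [hf0]
      · norm_num [hf1]
    obtain ⟨F, hF, hF', hF0, hF1, hFe⟩ := key f x x' hf hf' hf0 hf1 h₂
    obtain ⟨G, hG, hG', hG0, hG1, hGe⟩ := key g y y' hg hg' hg0 hg1 h₅
    refine ⟨F, G, hF, hF', hG, hG', hF0, hF1, hG0, hG1, fun t ht => ?_⟩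
    rcases le_total t (1 / 2) with h2 | h2
    · have e1 : min (2 * t) 1 = 2 * t := min_eq_left (by linarith)
      have e2 : max (2 * t - 1) 0 = 0 := max_eq_right (by linarith)
      simpa [hFe, hGe, e1, e2] using hfg (2 * t) ⟨by linarith [ht.1], by linarith⟩
    · have e1 : min (2 * t) 1 = 1 := min_eq_right (by linarith)
      have e2 : max (2 * t - 1) 0 = 2 * t - 1 := max_eq_left (by linarith)
      have hθ : 0 ≤ 2 * t - 1 := by linarith
      have hθ' : 2 * t - 1 ≤ 1 := by linarith [ht.2]
      simp only [hFe, hGe, e1, e2, hf1, hg1]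
      exact dist_pt_le h₁ h₂ h₃ h₄ h₅ h₆ hθ hθ' h.dist_le h₇

/-- A chain matches all parameters up to `y` monotonically. -/
theorem exists_monotone_selection (h : Reach v w r k x y) :
    ∃ ξ : ℝ → ℝ, MonotoneOn ξ (Set.Icc 0 y) ∧ ∀ u ∈ Set.Icc 0 y,
      ξ u ∈ Set.Icc 0 x ∧ dist (pt v (ξ u)) (pt w u) ≤ r := by
  obtain ⟨f, g, hf, hf', hg, hg', hf0, hf1, hg0, hg1, hfg⟩ := h.exists_matching
  have hs : ∀ u ∈ Set.Icc 0 y, ∃ t ∈ Set.Icc (0 : ℝ) 1, g t = u := by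
    intro u hu
    have := intermediate_value_Icc (zero_le_one (α := ℝ)) hg'.continuousOn
    rw [hg0, hg1] at this
    exact this hu
  choose! τ hτ hτ' using hs
  refine ⟨fun u => f (τ u), fun a ha b hb hab => ?_, fun u hu => ⟨⟨?_, ?_⟩, ?_⟩⟩
  · rcases hab.lt_or_eq with hab | rfl
    -- Preimages of distinct values under the monotone `g` are ordered like the values, so any
    -- choice of preimages is monotone.
    · refine hf (le_of_not_gt fun hlt => ?_)
      have := hg hlt.le
      rw [hτ' a ha, hτ' b hb] at this
      linarith
    · exact le_rfl
  · rw [← hf0]; exact hf (hτ u hu).1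
  · rw [← hf1]; exact hf (hτ u hu).2
  · have := hfg _ (hτ u hu)
    rwa [hτ' u hu] at this

/-- The point at which a chain enters a cell lies on its lower or on its left side. -/
theorem entry (h : Reach v w r k x' y') (i j : ℕ) (hx : (i : ℝ) ≤ x') (hx' : x' ≤ i + 1)
    (hy : (j : ℝ) ≤ y') (hy' : y' ≤ j + 1) :
    (∃ x, (i : ℝ) ≤ x ∧ x ≤ x' ∧ Reachable v w r x j) ∨
      ∃ y, (j : ℝ) ≤ y ∧ y ≤ y' ∧ Reachable v w r i y := by
  induction h with
  | start h =>
    obtain rfl : i = 0 := by exact_mod_cast hx.antisymm (Nat.cast_nonneg i)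
    obtain rfl : j = 0 := by exact_mod_cast hy.antisymm (Nat.cast_nonneg j)
    exact .inl ⟨0, by simp, le_rfl, 0, by simpa using .start h⟩
  | @step k x y x' y' i₀ j₀ h h₁ h₂ h₃ h₄ h₅ h₆ h₇ ih =>
    have hr := Reach.step i₀ j₀ h h₁ h₂ h₃ h₄ h₅ h₆ h₇
    by_cases hxi : (i : ℝ) ≤ x
    · by_cases hyj : (j : ℝ) ≤ y
      · rcases ih hxi (by linarith) hyj (by linarith) with ⟨a, h8, h9, h10⟩ | ⟨a, h8, h9, h10⟩
        · exact .inl ⟨a, h8, by linarith, h10⟩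
        · exact .inr ⟨a, h8, by linarith, h10⟩
      -- The chain was still below the cell. The step stays in row `j₀ < j`, so it can only end on
      -- the lower side, `y' = j`.
      · have : (j₀ : ℝ) < j := by linarith
        have : ((j₀ + 1 : ℕ) : ℝ) ≤ j := Nat.cast_le.2 (Nat.cast_lt.1 this)
        push_cast at this
        obtain rfl : y' = j := by linarith
        exact .inl ⟨x', hx, le_rfl, _, hr⟩
    · have : (i₀ : ℝ) < i := by linarith
      have : ((i₀ + 1 : ℕ) : ℝ) ≤ i := Nat.cast_le.2 (Nat.cast_lt.1 this)
      push_cast at this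
      obtain rfl : x' = i := by linarith
      exact .inr ⟨y', hy, le_rfl, _, hr⟩

/-- A chain on the lower border of the free space has to pass all vertices on its way. Hence a
reachable point of a border side makes the left corner of that side reachable, and border sides need
not be stored during the exploration. -/
theorem natCast_zero (h : Reach v w r k x y) (hy : y = 0) (i : ℕ) (hi : (i : ℝ) ≤ x) :
    Reachable v w r i 0 := by
  induction h with
  | start h =>
    obtain rfl : i = 0 := by exact_mod_cast hi.antisymm (Nat.cast_nonneg i)
    exact ⟨0, by simpa using .start h⟩
  | @step k x y x' y' i₀ j₀ h h₁ h₂ h₃ h₄ h₅ h₆ h₇ ih =>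
    have hr := Reach.step i₀ j₀ h h₁ h₂ h₃ h₄ h₅ h₆ h₇
    by_cases hxi : (i : ℝ) ≤ x
    · exact ih (by linarith [h.nonneg.2]) hxi
    · have : (i₀ : ℝ) < i := by linarith
      have : ((i₀ + 1 : ℕ) : ℝ) ≤ i := Nat.cast_le.2 (Nat.cast_lt.1 this)
      push_cast at this
      obtain rfl : x' = i := by linarith
      exact ⟨_, hy ▸ hr⟩

end Reach

namespace Reachable

theorem symm (h : Reachable v w r x y) : Reachable w v r y x := h.imp fun _ => Reach.symm

theorem mono (h : Reachable v w r x y) (hr : r ≤ r') : Reachable v w r' x y :=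
  h.imp fun _ h => h.mono hr

theorem dist_le (h : Reachable v w r x y) : dist (pt v x) (pt w y) ≤ r :=
  let ⟨_, h⟩ := h; h.dist_le

theorem nonneg (h : Reachable v w r x y) : 0 ≤ x ∧ 0 ≤ y := let ⟨_, h⟩ := h; h.nonneg

theorem step (i j : ℕ) (h : Reachable v w r x y) (h₁ : (i : ℝ) ≤ x) (h₂ : x ≤ x')
    (h₃ : x' ≤ i + 1) (h₄ : (j : ℝ) ≤ y) (h₅ : y ≤ y') (h₆ : y' ≤ j + 1)
    (h₇ : dist (pt v x') (pt w y') ≤ r) : Reachable v w r x' y' :=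
  let ⟨_, h⟩ := h; ⟨_, .step i j h h₁ h₂ h₃ h₄ h₅ h₆ h₇⟩

/-- Moving along the first curve only. -/
theorem walk (h : Reachable v w r x y) (hx : x ≤ x')
    (hd : ∀ u ∈ Set.Icc x x', dist (pt v u) (pt w y) ≤ r) : Reachable v w r x' y := by
  have hj := Nat.floor_le h.nonneg.2
  have hj' := (Nat.lt_floor_add_one y).le
  obtain ⟨c, hc⟩ : ∃ c : ℕ, x' ≤ ⌊x⌋₊ + 1 + c := by
    obtain ⟨c, hc⟩ := exists_nat_ge (x' - (⌊x⌋₊ + 1))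
    exact ⟨c, by linarith⟩
  induction c generalizing x with
  | zero =>
    exact h.step ⌊x⌋₊ ⌊y⌋₊ (Nat.floor_le h.nonneg.1) hx (by simpa using hc) hj le_rfl hj'
      (hd _ ⟨hx, le_rfl⟩)
  | succ c ih =>
    by_cases h1 : x' ≤ ⌊x⌋₊ + 1
    · exact h.step ⌊x⌋₊ ⌊y⌋₊ (Nat.floor_le h.nonneg.1) hx h1 hj le_rfl hj' (hd _ ⟨hx, le_rfl⟩)
    · push Not at h1
      have h2 : Reachable v w r ((⌊x⌋₊ : ℝ) + 1) y :=
        h.step ⌊x⌋₊ ⌊y⌋₊ (Nat.floor_le h.nonneg.1) (Nat.lt_floor_add_one x).le le_rfl hj le_rfl hj'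
          (hd _ ⟨(Nat.lt_floor_add_one x).le, h1.le⟩)
      refine ih h2 h1.le (fun u hu => hd u ⟨(Nat.lt_floor_add_one x).le.trans hu.1, hu.2⟩) ?_
      have h3 : ⌊(⌊x⌋₊ : ℝ) + 1⌋₊ = ⌊x⌋₊ + 1 := by exact_mod_cast Nat.floor_natCast (⌊x⌋₊ + 1)
      rw [h3]
      push_cast at hc ⊢
      linarith

end Reachable

end Chains

/-! ### Chains and the Fréchet distance -/

section Frechet

variable {d n m : ℕ} (p : Fin n → EuclideanSpace ℝ (Fin d)) (q : Fin m → EuclideanSpace ℝ (Fin d))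

/-- The vertices of a curve, the last one repeated forever. -/
noncomputable def ext (i : ℕ) : EuclideanSpace ℝ (Fin d) := vertex p (min i (n - 1))

theorem pt_ext (hn : 1 ≤ n) {x : ℝ} (hx : 0 ≤ x) : pt (ext p) x = point p (min x ((n : ℝ) - 1)) := by
  have hn' : ((n - 1 : ℕ) : ℝ) = (n : ℝ) - 1 := by rw [Nat.cast_sub hn]; simp
  rcases lt_or_ge x ((n : ℝ) - 1) with h | h
  · rw [min_eq_left h.le]
    have h1 : ⌊x⌋₊ < n - 1 := (Nat.floor_lt hx).2 (by rwa [hn'])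
    simp only [pt, point, ext]
    rw [min_eq_left h1.le, min_eq_left (by omega : ⌊x⌋₊ + 1 ≤ n - 1)]
  · rw [min_eq_right h, ← hn']
    have h1 : n - 1 ≤ ⌊x⌋₊ := Nat.le_floor (by rwa [hn'])
    simp only [pt, point, ext]
    rw [min_eq_right h1, min_eq_right (by omega : n - 1 ≤ ⌊x⌋₊ + 1), Nat.floor_natCast]
    simp

theorem pt_ext_of_le (hn : 1 ≤ n) {x : ℝ} (hx : 0 ≤ x) (hx' : x ≤ (n : ℝ) - 1) :
    pt (ext p) x = point p x := by rw [pt_ext p hn hx, min_eq_left hx']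

/-- The distances realised by matchings. -/
def matchingDists : Set ℝ :=
  {D : ℝ | ∃ f g : ℝ → ℝ, IsReparam n f ∧ IsReparam m g ∧
    IsLUB ((fun t => ‖point p (f t) - point q (g t)‖) '' Set.Icc (0 : ℝ) 1) D}

variable {p q}

theorem nonneg_of_mem_matchingDists {D : ℝ} (h : D ∈ matchingDists p q) : 0 ≤ D := by
  obtain ⟨f, g, -, -, h⟩ := h
  exact (norm_nonneg _).trans (h.1 ⟨0, by simp, rfl⟩)

theorem frechetDist_nonneg : 0 ≤ frechetDist p q :=
  Real.sInf_nonneg fun _ h => nonneg_of_mem_matchingDists h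

/-- Truncating the parameters at `n - 1` and `m - 1` removes the degenerate last edges and leaves
continuous monotone surjections. The lemma also shows that the set of matching distances is
nonempty, without which its infimum would be the default value 0. -/
theorem Reachable.exists_mem_matchingDists {r : ℝ} (hn : 1 ≤ n) (hm : 1 ≤ m)
    (h : Reachable (ext p) (ext q) r n m) : ∃ D ∈ matchingDists p q, D ≤ r := by
  obtain ⟨k, h⟩ := h
  obtain ⟨f, g, hf, hf', hg, hg', hf0, hf1, hg0, hg1, hfg⟩ := h.exists_matching
  have key : ∀ (n : ℕ) (f : ℝ → ℝ), 1 ≤ n → Monotone f → Continuous f → f 0 = 0 → f 1 = n →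
      IsReparam n fun t => min (f t) ((n : ℝ) - 1) := by
    intro n f hn hf hf' hf0 hf1
    have hn1 : (1 : ℝ) ≤ n := by exact_mod_cast hn
    refine ⟨fun s _ t _ hst => min_le_min_right _ (hf hst), Set.Subset.antisymm ?_ ?_⟩
    · rintro _ ⟨t, ht, rfl⟩
      exact ⟨le_min (hf0 ▸ hf ht.1) (by linarith), min_le_right _ _⟩
    · have := intermediate_value_Icc (zero_le_one (α := ℝ))
        ((by fun_prop : Continuous fun t => min (f t) ((n : ℝ) - 1))).continuousOn
      simp only [hf0, hf1] at this
      rwa [min_eq_left (by linarith), min_eq_right (by linarith)] at this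
  have hb : ∀ z ∈ (fun t => ‖point p (min (f t) ((n : ℝ) - 1)) - point q (min (g t) ((m : ℝ) - 1))‖)
      '' Set.Icc (0 : ℝ) 1, z ≤ r := by
    rintro _ ⟨t, ht, rfl⟩
    have h1 : 0 ≤ f t := hf0 ▸ hf ht.1
    have h2 : 0 ≤ g t := hg0 ▸ hg ht.1
    have := hfg t ht
    rwa [pt_ext p hn h1, pt_ext q hm h2, dist_eq_norm] at this
  refine ⟨_, ⟨_, _, key n f hn hf hf' hf0 hf1, key m g hm hg hg' hg0 hg1,
    isLUB_csSup ⟨_, 0, by simp, rfl⟩ ⟨r, hb⟩⟩, csSup_le ⟨_, 0, by simp, rfl⟩ hb⟩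

theorem Reachable.frechetDist_le {r : ℝ} (hn : 1 ≤ n) (hm : 1 ≤ m)
    (h : Reachable (ext p) (ext q) r n m) : frechetDist p q ≤ r := by
  obtain ⟨D, hD, hDr⟩ := h.exists_mem_matchingDists hn hm
  exact (csInf_le ⟨0, fun _ h => nonneg_of_mem_matchingDists h⟩ hD).trans hDr

theorem IsReparam.apply_zero {f : ℝ → ℝ} (hf : IsReparam n f) (hn : 1 ≤ n) : f 0 = 0 := by
  have hn1 : (1 : ℝ) ≤ n := by exact_mod_cast hn
  obtain ⟨t, ht, ht'⟩ : (0 : ℝ) ∈ f '' Set.Icc 0 1 := by rw [hf.2]; exact ⟨le_rfl, by linarith⟩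
  have h1 := hf.1 (by simp) ht ht.1
  have h2 : f 0 ∈ f '' Set.Icc 0 1 := ⟨0, by simp, rfl⟩
  rw [hf.2] at h2
  linarith [h2.1]

theorem IsReparam.apply_one {f : ℝ → ℝ} (hf : IsReparam n f) (hn : 1 ≤ n) :
    f 1 = (n : ℝ) - 1 := by
  have hn1 : (1 : ℝ) ≤ n := by exact_mod_cast hn
  obtain ⟨t, ht, ht'⟩ : ((n : ℝ) - 1) ∈ f '' Set.Icc 0 1 := by
    rw [hf.2]; exact ⟨by linarith, le_rfl⟩
  have h1 := hf.1 ht (by simp) ht.2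
  have h2 : f 1 ∈ f '' Set.Icc 0 1 := ⟨1, by simp, rfl⟩
  rw [hf.2] at h2
  linarith [h2.2]

/-- The first time at which a parametrisation has passed the next vertex. -/
theorem IsReparam.exists_next {f : ℝ → ℝ} (hf : IsReparam n f) (hn : 1 ≤ n) {s : ℝ}
    (hs : s ∈ Set.Icc (0 : ℝ) 1) :
    ∃ u ∈ Set.Icc s 1, f u ≤ ⌊f s⌋₊ + 1 ∧ (u = 1 ∨ f u = ⌊f s⌋₊ + 1) := by
  have hs' : f s ∈ Set.Icc 0 ((n : ℝ) - 1) := hf.2 ▸ ⟨s, hs, rfl⟩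
  by_cases h : (⌊f s⌋₊ : ℝ) + 1 ≤ (n : ℝ) - 1
  · obtain ⟨u, hu, hu'⟩ : (⌊f s⌋₊ : ℝ) + 1 ∈ f '' Set.Icc 0 1 := by
      rw [hf.2]; exact ⟨by positivity, h⟩
    refine ⟨u, ⟨le_of_not_gt fun hlt => ?_, hu.2⟩, hu'.le, .inr hu'⟩
    have := hf.1 hu hs hlt.le
    linarith [Nat.lt_floor_add_one (f s)]
  · exact ⟨1, ⟨hs.2, le_rfl⟩, by rw [hf.apply_one hn]; linarith, .inl rfl⟩

/-- The matching is sampled whenever one of the curves arrives at its next vertex. In between both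
parameters stay in one cell, and each sample uses up a vertex, which bounds the number of steps.
Only monotonicity and surjectivity of the parametrisations are used. -/
theorem exists_reach_of_isReparam {f g : ℝ → ℝ} {r : ℝ} (hn : 1 ≤ n) (hm : 1 ≤ m)
    (hf : IsReparam n f) (hg : IsReparam m g)
    (hfg : ∀ t ∈ Set.Icc (0 : ℝ) 1, ‖point p (f t) - point q (g t)‖ ≤ r) :
    ∃ k ≤ n + m, Reach (ext p) (ext q) r k n m := by
  have hfI : ∀ t ∈ Set.Icc (0 : ℝ) 1, f t ∈ Set.Icc 0 ((n : ℝ) - 1) := fun t ht => hf.2 ▸ ⟨t, ht, rfl⟩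
  have hgI : ∀ t ∈ Set.Icc (0 : ℝ) 1, g t ∈ Set.Icc 0 ((m : ℝ) - 1) := fun t ht => hg.2 ▸ ⟨t, ht, rfl⟩
  have hd : ∀ t ∈ Set.Icc (0 : ℝ) 1, dist (pt (ext p) (f t)) (pt (ext q) (g t)) ≤ r := by
    intro t ht
    rw [pt_ext_of_le p hn (hfI t ht).1 (hfI t ht).2, pt_ext_of_le q hm (hgI t ht).1 (hgI t ht).2,
      dist_eq_norm]
    exact hfg t ht
  -- Here `c` bounds the number of vertices still to be passed; the additional step leads to time 1.
  have key : ∀ (c k : ℕ) (s : ℝ), s ∈ Set.Icc (0 : ℝ) 1 →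
      Reach (ext p) (ext q) r k (f s) (g s) → n + m ≤ ⌊f s⌋₊ + ⌊g s⌋₊ + c + 2 →
      ∃ k' ≤ k + c + 1, Reach (ext p) (ext q) r k' (f 1) (g 1) := by
    intro c
    induction c with
    | zero =>
      intro k s hs hr hc
      refine ⟨k + 1, by omega, ?_⟩
      have h1 : ⌊f s⌋₊ ≤ n - 1 := Nat.floor_le_of_le (by
        rw [Nat.cast_sub hn]; simpa using (hfI s hs).2)
      have h2 : ⌊g s⌋₊ ≤ m - 1 := Nat.floor_le_of_le (by
        rw [Nat.cast_sub hm]; simpa using (hgI s hs).2)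
      have h3 : (n : ℝ) ≤ ⌊f s⌋₊ + 1 := by exact_mod_cast (by omega : n ≤ ⌊f s⌋₊ + 1)
      have h4 : (m : ℝ) ≤ ⌊g s⌋₊ + 1 := by exact_mod_cast (by omega : m ≤ ⌊g s⌋₊ + 1)
      refine .step ⌊f s⌋₊ ⌊g s⌋₊ hr (Nat.floor_le (hfI s hs).1) (hf.1 hs (by simp) hs.2) ?_
        (Nat.floor_le (hgI s hs).1) (hg.1 hs (by simp) hs.2) ?_ (hd 1 (by simp))
      · rw [hf.apply_one hn]; linarith
      · rw [hg.apply_one hm]; linarith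
    | succ c ih =>
      intro k s hs hr hc
      obtain ⟨u₁, hu₁, h₁, h₁'⟩ := hf.exists_next hn hs
      obtain ⟨u₂, hu₂, h₂, h₂'⟩ := hg.exists_next hm hs
      have hu : min u₁ u₂ ∈ Set.Icc (0 : ℝ) 1 :=
        ⟨hs.1.trans (le_min hu₁.1 hu₂.1), (min_le_left _ _).trans hu₁.2⟩
      have hu₁' : u₁ ∈ Set.Icc (0 : ℝ) 1 := ⟨hs.1.trans hu₁.1, hu₁.2⟩
      have hu₂' : u₂ ∈ Set.Icc (0 : ℝ) 1 := ⟨hs.1.trans hu₂.1, hu₂.2⟩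
      have hsu : s ≤ min u₁ u₂ := le_min hu₁.1 hu₂.1
      have hstep : Reach (ext p) (ext q) r (k + 1) (f (min u₁ u₂)) (g (min u₁ u₂)) :=
        .step ⌊f s⌋₊ ⌊g s⌋₊ hr (Nat.floor_le (hfI s hs).1) (hf.1 hs hu hsu)
          ((hf.1 hu hu₁' (min_le_left _ _)).trans h₁) (Nat.floor_le (hgI s hs).1)
          (hg.1 hs hu hsu) ((hg.1 hu hu₂' (min_le_right _ _)).trans h₂) (hd _ hu)
      by_cases hone : min u₁ u₂ = 1
      · rw [hone] at hstep
        exact ⟨k + 1, by omega, hstep⟩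
      obtain ⟨k', hk', h'⟩ := ih (k + 1) _ hu hstep (by
        have e1 : ⌊f s⌋₊ ≤ ⌊f (min u₁ u₂)⌋₊ := Nat.floor_le_floor (hf.1 hs hu hsu)
        have e2 : ⌊g s⌋₊ ≤ ⌊g (min u₁ u₂)⌋₊ := Nat.floor_le_floor (hg.1 hs hu hsu)
        rcases le_total u₁ u₂ with h | h
        · rw [min_eq_left h] at hone e1 e2 ⊢
          have := h₁'.resolve_left hone
          have e3 : ⌊f u₁⌋₊ = ⌊f s⌋₊ + 1 := by
            rw [this]; exact_mod_cast Nat.floor_natCast (⌊f s⌋₊ + 1)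
          omega
        · rw [min_eq_right h] at hone e1 e2 ⊢
          have := h₂'.resolve_left hone
          have e3 : ⌊g u₂⌋₊ = ⌊g s⌋₊ + 1 := by
            rw [this]; exact_mod_cast Nat.floor_natCast (⌊g s⌋₊ + 1)
          omega)
      exact ⟨k', by omega, h'⟩
  have h0 : Reach (ext p) (ext q) r 0 (f 0) (g 0) := by
    have := hd 0 (by simp)
    rw [hf.apply_zero hn, hg.apply_zero hm] at this ⊢
    exact .start (by simpa using this)
  obtain ⟨k, hk, h⟩ := key (n + m - 2) 0 0 (by simp) h0 (by omega)
  rw [hf.apply_one hn, hg.apply_one hm] at h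
  have hn1 : (1 : ℝ) ≤ n := by exact_mod_cast hn
  have hm1 : (1 : ℝ) ≤ m := by exact_mod_cast hm
  have h1 : ((n - 1 : ℕ) : ℝ) = (n : ℝ) - 1 := by rw [Nat.cast_sub hn]; simp
  have h2 : ((m - 1 : ℕ) : ℝ) = (m : ℝ) - 1 := by rw [Nat.cast_sub hm]; simp
  -- One more step crosses the degenerate cell from `(n - 1, m - 1)` to `(n, m)`.
  refine ⟨k + 1, by omega, .step (n - 1) (m - 1) h h1.le (by linarith) (by linarith) h2.le
    (by linarith) (by linarith) ?_⟩
  have := h.dist_le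
  rw [pt_ext p hn (by linarith), pt_ext q hm (by linarith)] at this ⊢
  rw [min_eq_right (by linarith), min_eq_right (by linarith)]
  rwa [min_eq_right (by linarith), min_eq_right (by linarith)] at this

/-- The hypothesis `h₀`, for an arbitrary radius, only provides some matching, so that the infimum
is one over a nonempty set. -/
theorem exists_reach_of_frechetDist_lt {r r₀ : ℝ} (hn : 1 ≤ n) (hm : 1 ≤ m)
    (h₀ : Reachable (ext p) (ext q) r₀ n m) (h : frechetDist p q < r) :
    ∃ k ≤ n + m, Reach (ext p) (ext q) r k n m := by
  obtain ⟨D₀, hD₀, -⟩ := h₀.exists_mem_matchingDists hn hm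
  obtain ⟨D, ⟨f, g, hf, hg, hD⟩, hDr⟩ := exists_lt_of_csInf_lt ⟨D₀, hD₀⟩ h
  exact exists_reach_of_isReparam hn hm hf hg fun t ht => (hD.1 ⟨t, ht, rfl⟩).trans hDr.le

end Frechet

end PolygonalCurve

/-! ### Matching by arc length -/

namespace PolygonalCurve

section ArcLength

variable {E : Type*} [NormedAddCommGroup E] [NormedSpace ℝ E]

/-- The length of the curve through `v 0, v 1, …` up to the vertex `v i`. -/
noncomputable def vertexArc (v : ℕ → E) (i : ℕ) : ℝ := ∑ k ∈ Finset.range i, dist (v k) (v (k + 1))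

/-- The length of the curve through `v 0, v 1, …` up to the parameter `x`. -/
noncomputable def arc (v : ℕ → E) (x : ℝ) : ℝ := pt (vertexArc v) x

variable {v w : ℕ → E} {r x y x' y' : ℝ} {k n m : ℕ}

theorem arc_add (v : ℕ → E) {i : ℕ} {s : ℝ} (h₁ : 0 ≤ s) (h₂ : s ≤ 1) :
    arc v (i + s) = vertexArc v i + s * dist (v i) (v (i + 1)) := by
  rw [arc, pt_add _ h₁ h₂, vertexArc, vertexArc, Finset.sum_range_succ]
  simp

theorem arc_natCast (v : ℕ → E) (i : ℕ) : arc v i = vertexArc v i := pt_natCast _ _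

theorem vertexArc_succ (v : ℕ → E) (i : ℕ) :
    vertexArc v (i + 1) = vertexArc v i + dist (v i) (v (i + 1)) := by
  rw [vertexArc, vertexArc, Finset.sum_range_succ]

theorem dist_pt_eq_arc_sub {i : ℕ} (h₁ : (i : ℝ) ≤ x) (h₂ : x ≤ x') (h₃ : x' ≤ i + 1) :
    dist (pt v x) (pt v x') = arc v x' - arc v x := by
  rw [arc, arc, pt_eq v h₁ (by linarith), pt_eq v (by linarith) h₃,
    pt_eq _ h₁ (by linarith), pt_eq _ (by linarith) h₃, vertexArc_succ, dist_eq_norm', dist_eq_norm']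
  have : v i + (x' - i) • (v (i + 1) - v i) - (v i + (x - i) • (v (i + 1) - v i)) =
      (x' - x) • (v (i + 1) - v i) := by module
  rw [this, norm_smul, Real.norm_of_nonneg (by linarith)]
  simp only [smul_eq_mul]
  ring

theorem dist_pt_le_arc_sub (h₁ : 0 ≤ x) (h₂ : x ≤ x') :
    dist (pt v x) (pt v x') ≤ arc v x' - arc v x := by
  obtain ⟨c, hc⟩ : ∃ c : ℕ, x' ≤ ⌊x⌋₊ + 1 + c := by
    obtain ⟨c, hc⟩ := exists_nat_ge (x' - (⌊x⌋₊ + 1))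
    exact ⟨c, by linarith⟩
  induction c generalizing x with
  | zero => exact (dist_pt_eq_arc_sub (Nat.floor_le h₁) h₂ (by simpa using hc)).le
  | succ c ih =>
    by_cases h3 : x' ≤ ⌊x⌋₊ + 1
    · exact (dist_pt_eq_arc_sub (Nat.floor_le h₁) h₂ h3).le
    · push Not at h3
      have e := dist_pt_eq_arc_sub (v := v) (Nat.floor_le h₁) (Nat.lt_floor_add_one x).le le_rfl
      have h4 : ⌊(⌊x⌋₊ : ℝ) + 1⌋₊ = ⌊x⌋₊ + 1 := by exact_mod_cast Nat.floor_natCast (⌊x⌋₊ + 1)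
      have h5 := ih (x := (⌊x⌋₊ : ℝ) + 1) (by positivity) h3.le (by
        rw [h4]; push_cast at hc ⊢; linarith)
      linarith [dist_triangle (pt v x) (pt v ((⌊x⌋₊ : ℝ) + 1)) (pt v x')]

theorem Reach.radius_nonneg (h : Reach v w r k x y) : 0 ≤ r := dist_nonneg.trans h.dist_le

/-- Along a chain, the arc lengths differ by at most twice the radius per step. -/
theorem Reach.abs_arc_sub_le (h : Reach v w r k x y) : |arc v x - arc w y| ≤ 2 * r * k := by
  induction h with
  | start h => simp [arc, vertexArc]
  | @step k x y x' y' i j h h₁ h₂ h₃ h₄ h₅ h₆ h₇ ih =>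
    have e1 := dist_pt_eq_arc_sub (v := v) h₁ h₂ h₃
    have e2 := dist_pt_eq_arc_sub (v := w) h₄ h₅ h₆
    have h8 := h.dist_le
    -- On a single edge arc length is distance. By the triangle inequality the two increments of arc
    -- length differ by at most the two matching distances at the ends of the step.
    have h9 := dist_triangle4 (pt v x) (pt w y) (pt w y') (pt v x')
    have h10 := dist_triangle4 (pt w y) (pt v x) (pt v x') (pt w y')
    rw [dist_comm (pt w y') (pt v x')] at h9
    rw [dist_comm (pt w y) (pt v x)] at h10
    rw [abs_le] at ih ⊢
    push_cast
    constructor <;> linarith [ih.1, ih.2]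

/-- A chain can be cut at each parameter of the first curve. -/
theorem Reach.cut (h : Reach v w r k x y) {x₀ : ℝ} (h₀ : 0 ≤ x₀) (hx : x₀ ≤ x) :
    ∃ k' ≤ k, ∃ y₀ ≤ y, Reach v w r k' x₀ y₀ := by
  induction h with
  | start h => exact ⟨0, le_rfl, 0, le_rfl, hx.antisymm h₀ ▸ .start h⟩
  | @step k x y x' y' i j h h₁ h₂ h₃ h₄ h₅ h₆ h₇ ih =>
    rcases le_or_gt x₀ x with hle | hlt
    · obtain ⟨k', hk', y₀, hy₀, hr⟩ := ih hle
      exact ⟨k', by omega, y₀, by linarith, hr⟩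
    · have hpos : 0 < x' - x := by linarith
      have hθ : 0 ≤ (x₀ - x) / (x' - x) := div_nonneg (by linarith) hpos.le
      have hθ' : (x₀ - x) / (x' - x) ≤ 1 := (div_le_one hpos).2 (by linarith)
      have e : x₀ = x + (x₀ - x) / (x' - x) * (x' - x) := by field_simp; ring
      have h8 : (x₀ - x) / (x' - x) * (y' - y) ≤ 1 * (y' - y) := by
        gcongr
      have h9 : 0 ≤ (x₀ - x) / (x' - x) * (y' - y) := mul_nonneg hθ (by linarith)
      refine ⟨k + 1, le_rfl, y + (x₀ - x) / (x' - x) * (y' - y), by linarith, ?_⟩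
      refine .step i j h h₁ hlt.le (by linarith) h₄ (by linarith) (by linarith) ?_
      have := dist_pt_le h₁ h₂ h₃ h₄ h₅ h₆ hθ hθ' h.dist_le h₇
      rwa [← e] at this

/-- The points with parameters `i + s` and `j + t` are balanced if they have the same arc length,
except that one of the curves may already have come to its end. -/
def Balanced (v w : ℕ → E) (n m i j : ℕ) (s t : ℝ) : Prop :=
  arc v (i + s) = arc w (j + t) ∨ i = n ∧ arc v (i + s) ≤ arc w (j + t) ∨
    j = m ∧ arc w (j + t) ≤ arc v (i + s)

/-- The distance of balanced points is bounded in terms of any complete chain. -/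
theorem Balanced.dist_le {i j : ℕ} {s t : ℝ} (hb : Balanced v w n m i j s t) (hs : 0 ≤ s)
    (hs' : i = n → s = 0) (hxn : i + s ≤ n) (ht : 0 ≤ t) (ht' : j = m → t = 0)
    (hym : j + t ≤ m) (h : Reach v w r k n m) :
    dist (pt v (i + s)) (pt w (j + t)) ≤ (2 * k + 1) * r := by
  have hr := h.radius_nonneg
  have hA := abs_le.1 h.abs_arc_sub_le
  have hx : 0 ≤ (i : ℝ) + s := by positivity
  have hy : 0 ≤ (j : ℝ) + t := by positivity
  rcases hb with hb | ⟨hi, hb⟩ | ⟨hj, hb⟩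
  -- The chain matches `i + s` to some `y₀` at distance at most `r`. The arc length at `y₀` is
  -- within `2rk` of that at `i + s`, which equals the one at `j + t`.
  · obtain ⟨k', hk', y₀, hy₀, h'⟩ := h.cut hx hxn
    have h1 := h'.dist_le
    have h2 := abs_le.1 h'.abs_arc_sub_le
    have h3 : 2 * r * k' ≤ 2 * r * k := by gcongr
    have h4 : dist (pt w y₀) (pt w (j + t)) ≤ 2 * r * k := by
      rcases le_total y₀ (j + t) with h5 | h5
      · exact (dist_pt_le_arc_sub h'.nonneg.2 h5).trans (by linarith)
      · rw [dist_comm]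
        exact (dist_pt_le_arc_sub hy h5).trans (by linarith)
    linarith [dist_triangle (pt v (i + s)) (pt w y₀) (pt w (j + t))]
  -- The first curve has ended. What is left of the second one has length at most `2rk`, since its
  -- arc length at `j + t` has already caught up, and the two end points are within `r`.
  · have h1 := dist_pt_le_arc_sub (v := w) hy hym
    rw [hs' hi, hi, add_zero] at hb ⊢
    rw [dist_comm] at h1
    linarith [dist_triangle (pt v n) (pt w m) (pt w (j + t)), h.dist_le]
  · have h1 := dist_pt_le_arc_sub (v := v) hx hxn
    rw [ht' hj, hj, add_zero] at hb ⊢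
    linarith [dist_triangle (pt v (i + s)) (pt v n) (pt w m), h.dist_le]

theorem Balanced.symm {i j : ℕ} {s t : ℝ} (h : Balanced v w n m i j s t) :
    Balanced w v m n j i t s := by
  rcases h with h | h | h
  · exact .inl h.symm
  · exact .inr (.inr h)
  · exact .inr (.inl h)

/-- The invariant of the simultaneous traversal of the curves by arc length: the parameters
`i + s` and `j + t` are balanced, and `D` is the largest distance met so far. -/
structure WalkInv (v w : ℕ → E) (n m i j : ℕ) (s t D : ℝ) : Prop where
  i_le : i ≤ n
  j_le : j ≤ m
  s_nonneg : 0 ≤ s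
  t_nonneg : 0 ≤ t
  s_le : s ≤ 1
  t_le : t ≤ 1
  s_eq : i = n → s = 0
  t_eq : j = m → t = 0
  reachable : Reachable v w D (i + s) (j + t)
  balanced : Balanced v w n m i j s t
  le : ∀ r k, Reach v w r k n m → D ≤ (2 * k + 1) * r

namespace WalkInv

variable {i j : ℕ} {s t D : ℝ}

theorem symm (h : WalkInv v w n m i j s t D) : WalkInv w v m n j i t s D :=
  ⟨h.j_le, h.i_le, h.t_nonneg, h.s_nonneg, h.t_le, h.s_le, h.t_eq, h.s_eq, h.reachable.symm,
    h.balanced.symm, fun r k hr => h.le r k hr.symm⟩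

theorem init (v w : ℕ → E) (n m : ℕ) : WalkInv v w n m 0 0 0 0 (dist (v 0) (w 0)) := by
  have hb : Balanced v w n m 0 0 0 0 := .inl (by simp [arc, vertexArc])
  refine ⟨by omega, by omega, le_rfl, le_rfl, zero_le_one, zero_le_one, fun _ => rfl, fun _ => rfl,
    ⟨0, by simpa using Reach.start le_rfl⟩, hb, fun r k hr => ?_⟩
  simpa using hb.dist_le le_rfl (fun _ => rfl) (by simp) le_rfl (fun _ => rfl) (by simp) hr

theorem add_le_of_lt {n i : ℕ} {s : ℝ} (h : i < n) (hs : s ≤ 1) : (i : ℝ) + s ≤ n := by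
  have : ((i + 1 : ℕ) : ℝ) ≤ n := Nat.cast_le.2 h
  push_cast at this
  linarith

/-- Going on to the next vertex of the first curve. -/
theorem advance (h : WalkInv v w n m i j s t D) (hi : i < n) {t' D' : ℝ}
    (hle : j < m → (1 - s) * dist (v i) (v (i + 1)) ≤ (1 - t) * dist (w j) (w (j + 1)))
    (ht : j < m → t' = t + (1 - t) *
      (((1 - s) * dist (v i) (v (i + 1))) / ((1 - t) * dist (w j) (w (j + 1)))))
    (ht' : j = m → t' = t)
    (hD : D' = max D (dist (v (i + 1)) (w j + t' • (w (j + 1) - w j)))) :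
    WalkInv v w n m (i + 1) j 0 t' D' := by
  have hv : 0 ≤ (1 - s) * dist (v i) (v (i + 1)) :=
    mul_nonneg (by linarith [h.s_le]) dist_nonneg
  have hw : 0 ≤ (1 - t) * dist (w j) (w (j + 1)) :=
    mul_nonneg (by linarith [h.t_le]) dist_nonneg
  set a := (1 - s) * dist (v i) (v (i + 1)) with ha
  set b := (1 - t) * dist (w j) (w (j + 1)) with hbdef
  have htt : t ≤ t' ∧ t' ≤ 1 := by
    rcases h.j_le.lt_or_eq with hj | hj
    · have h1 : 0 ≤ a / b := div_nonneg hv hw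
      have h2 : a / b ≤ 1 := div_le_one_of_le₀ (hle hj) hw
      rw [ht hj]
      constructor <;> nlinarith [h.t_le]
    · rw [ht' hj]; exact ⟨le_rfl, h.t_le⟩
  have ht0 : 0 ≤ t' := h.t_nonneg.trans htt.1
  have hjm : (j : ℝ) + t' ≤ m := by
    rcases h.j_le.lt_or_eq with hj | hj
    · exact add_le_of_lt hj htt.2
    · rw [ht' hj, h.t_eq hj, hj]; simp
  have harc : arc v ((i + 1 : ℕ) + 0) = arc v (i + s) + a := by
    rw [add_zero, arc_natCast, vertexArc_succ, arc_add v h.s_nonneg h.s_le, ha]; ring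
  have hbal : Balanced v w n m (i + 1) j 0 t' := by
    rcases h.j_le.lt_or_eq with hj | hj
    · have h1 : arc w (j + t') = arc w (j + t) + a := by
        rw [arc_add w ht0 htt.2, arc_add w h.t_nonneg h.t_le, ht hj]
        have : (1 - t) * (a / b) * dist (w j) (w (j + 1)) = a := by
          -- If nothing is left of the edge of `w`, then `a ≤ b` forces `a = 0`, and the division by
          -- zero, with value 0, does no harm.
          rcases eq_or_ne b 0 with hb0 | hb0
          · have : a = 0 := le_antisymm (hb0 ▸ hle hj) hv
            simp [this]
          · have : (1 - t) * (a / b) * dist (w j) (w (j + 1)) = a / b * b := by rw [hbdef]; ring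
            rw [this, div_mul_cancel₀ _ hb0]
        linarith
      rcases h.balanced with h2 | ⟨h2, -⟩ | ⟨h2, -⟩
      · exact .inl (by rw [harc, h1, h2])
      · omega
      · omega
    · refine .inr (.inr ⟨hj, ?_⟩)
      rw [harc, ht' hj]
      rcases h.balanced with h2 | ⟨h2, -⟩ | ⟨-, h3⟩
      · linarith
      · omega
      · linarith
  have hdist : dist (pt v ((i + 1 : ℕ) + 0)) (pt w (j + t')) =
      dist (v (i + 1)) (w j + t' • (w (j + 1) - w j)) := by
    rw [add_zero, pt_natCast, pt_add w ht0 htt.2]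
  refine ⟨hi, h.j_le, le_rfl, ht0, zero_le_one, htt.2, fun _ => rfl,
    fun hj => by rw [ht' hj, h.t_eq hj], ?_, hbal, fun r k hr => ?_⟩
  · refine (h.reachable.mono (hD ▸ le_max_left _ _)).step i j (by linarith [h.s_nonneg])
      (by push_cast; linarith [h.s_le]) (by push_cast; linarith) (by linarith [h.t_nonneg])
      (by linarith [htt.1]) (by linarith [htt.2]) ?_
    rw [hdist, hD]
    exact le_max_right _ _
  · rw [hD]
    refine max_le (h.le r k hr) ?_
    rw [← hdist]
    exact hbal.dist_le le_rfl (fun _ => rfl) (by simpa using Nat.cast_le.2 hi) ht0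
      (fun hj => by rw [ht' hj, h.t_eq hj]) hjm hr

end WalkInv

end ArcLength

end PolygonalCurve

/-! ### Simplification -/

namespace PolygonalCurve

section Simplification

variable {E : Type*} [NormedAddCommGroup E] [NormedSpace ℝ E]

/-- The indices `a 0 < … < a K` select a `μ`-simplification of the curve with vertices
`v 0, …, v n`: a vertex is skipped if it is within distance `μ` of the last one that is kept. -/
structure IsSimplification (v : ℕ → E) (n K : ℕ) (a : ℕ → ℕ) (μ : ℝ) : Prop where
  zero : a 0 = 0
  last : a K = n
  lt : ∀ k < K, a k < a (k + 1)
  near : ∀ k < K, ∀ b, a k ≤ b → b < a (k + 1) → dist (v (a k)) (v b) ≤ μ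
  far : ∀ k, k + 1 < K → μ < dist (v (a k)) (v (a (k + 1)))

/-- The parameter of the simplified curve that corresponds to the parameter `x`. -/
noncomputable def proj (a : ℕ → ℕ) (K : ℕ) (x : ℝ) : ℝ :=
  ∑ k ∈ Finset.range K, max 0 (min 1 (x - ((a (k + 1) : ℝ) - 1)))

theorem proj_mono (a : ℕ → ℕ) (K : ℕ) : Monotone (proj a K) := fun x y hxy =>
  Finset.sum_le_sum fun k _ => by gcongr

theorem pt_const (c : E) (x : ℝ) : pt (fun _ => c) x = c := by simp [pt]

namespace IsSimplification

variable {v w : ℕ → E} {n K : ℕ} {a : ℕ → ℕ} {μ r x y z : ℝ} {k : ℕ}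

theorem le_of_le (h : IsSimplification v n K a μ) {k l : ℕ} (hkl : k ≤ l) (hl : l ≤ K) :
    a k ≤ a l := by
  induction l, hkl using Nat.le_induction with
  | base => exact le_rfl
  | succ l hkl ih => exact (ih (by omega)).trans (h.lt l (by omega)).le

theorem pos (h : IsSimplification v n K a μ) (hn : 1 ≤ n) : 1 ≤ K := by
  rcases Nat.eq_zero_or_pos K with rfl | hK
  · have := h.zero.symm.trans h.last
    omega
  · exact hK

theorem le_length (h : IsSimplification v n K a μ) : K ≤ n := by
  have : ∀ k ≤ K, k ≤ a k := by
    intro k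
    induction k with
    | zero => simp
    | succ k ih => intro hk; have := h.lt k hk; have := ih (by omega); omega
  have := this K le_rfl
  rwa [h.last] at this

theorem exists_cell (h : IsSimplification v n K a μ) {i : ℕ} (hi : i < n) :
    ∃ k < K, a k ≤ i ∧ i < a (k + 1) := by
  have hex : ∃ k, i < a k := ⟨K, by rwa [h.last]⟩
  obtain ⟨l, hl⟩ : ∃ l, Nat.find hex = l + 1 :=
    Nat.exists_eq_succ_of_ne_zero fun h0 => by
      have := Nat.find_spec hex
      rw [h0, h.zero] at this
      omega
  refine ⟨l, ?_, ?_, ?_⟩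
  · have := Nat.find_min' hex (m := K) (by rwa [h.last])
    omega
  · exact not_lt.1 (Nat.find_min hex (by omega))
  · rw [← hl]; exact Nat.find_spec hex

theorem exists_cell_real (h : IsSimplification v n K a μ) (hn : 1 ≤ n) (hx : 0 ≤ x) (hxn : x ≤ n) :
    ∃ k < K, (a k : ℝ) ≤ x ∧ x ≤ a (k + 1) := by
  rcases hxn.lt_or_eq with hlt | rfl
  · obtain ⟨k, hk, h1, h2⟩ := h.exists_cell (i := ⌊x⌋₊) ((Nat.floor_lt hx).2 hlt)
    refine ⟨k, hk, (Nat.cast_le.2 h1).trans (Nat.floor_le hx), ?_⟩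
    have : ((⌊x⌋₊ + 1 : ℕ) : ℝ) ≤ a (k + 1) := Nat.cast_le.2 h2
    push_cast at this
    linarith [Nat.lt_floor_add_one x]
  · have hK := h.pos hn
    have e : K - 1 + 1 = K := by omega
    refine ⟨K - 1, by omega, ?_, ?_⟩
    · have := (h.lt (K - 1) (by omega)).le
      rw [e, h.last] at this
      exact_mod_cast this
    · rw [e, h.last]

/-- On the piece from `a k` to `a (k + 1)` the simplified curve waits at its vertex `k` until the
last original edge begins and crosses its own edge during that one. As a sum of clamped functions
the map is visibly monotone. -/
theorem proj_eq (h : IsSimplification v n K a μ) (hk : k < K) (h₁ : (a k : ℝ) ≤ x)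
    (h₂ : x ≤ a (k + 1)) : proj a K x = k + max 0 (x - ((a (k + 1) : ℝ) - 1)) := by
  have h3 : ∑ l ∈ Finset.range (k + 1), max 0 (min 1 (x - ((a (l + 1) : ℝ) - 1))) = proj a K x := by
    refine Finset.sum_subset (Finset.range_subset_range.2 hk) fun l hl hl' => ?_
    rw [Finset.mem_range] at hl hl'
    have e1 : a (k + 1) ≤ a l := h.le_of_le (by omega) (by omega)
    have e2 := h.lt l hl
    have e3 : (a (k + 1) : ℝ) + 1 ≤ a (l + 1) := by exact_mod_cast (by omega : _ + 1 ≤ _)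
    exact max_eq_left ((min_le_right _ _).trans (by linarith))
  rw [← h3, Finset.sum_range_succ, min_eq_right (by linarith)]
  congr 1
  rw [Finset.sum_congr rfl (g := fun _ => (1 : ℝ))]
  · simp
  · intro l hl
    rw [Finset.mem_range] at hl
    have e1 : (a (l + 1) : ℝ) ≤ a k := by exact_mod_cast h.le_of_le (by omega) (by omega)
    rw [min_eq_left (by linarith), max_eq_right zero_le_one]

theorem proj_nonneg (a : ℕ → ℕ) (K : ℕ) (x : ℝ) : 0 ≤ proj a K x :=
  Finset.sum_nonneg fun _ _ => le_max_left _ _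

theorem proj_zero (h : IsSimplification v n K a μ) (hn : 1 ≤ n) : proj a K 0 = 0 := by
  have hK := h.pos hn
  have h1 := h.lt 0 hK
  have h2 : (1 : ℝ) ≤ a (0 + 1) := by exact_mod_cast (by omega : 1 ≤ a (0 + 1))
  rw [h.proj_eq hK (by simp [h.zero]) (by linarith), max_eq_left (by linarith)]
  simp

theorem proj_last (h : IsSimplification v n K a μ) (hn : 1 ≤ n) : proj a K n = K := by
  have hK := h.pos hn
  have e : K - 1 + 1 = K := by omega
  have h1 := h.lt (K - 1) (by omega)
  rw [e, h.last] at h1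
  rw [h.proj_eq (k := K - 1) (by omega) (by exact_mod_cast h1.le) (by rw [e, h.last]), e, h.last,
    max_eq_right (by linarith)]
  have : ((K - 1 : ℕ) : ℝ) = (K : ℝ) - 1 := by rw [Nat.cast_sub hK]; simp
  rw [this]
  ring

theorem nonneg (h : IsSimplification v n K a μ) (hn : 1 ≤ n) : 0 ≤ μ :=
  dist_nonneg.trans (h.near 0 (h.pos hn) (a 0) le_rfl (h.lt 0 (h.pos hn)))

/-- While the simplified curve waits, all vertices passed are within `μ` of `v (a k)`. On the last
edge the corresponding points are within `μ` at the beginning and coincide at the end. Convexity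
covers the points in between. -/
theorem dist_proj (h : IsSimplification v n K a μ) (hn : 1 ≤ n) (hx : 0 ≤ x) (hxn : x ≤ n) :
    dist (pt v x) (pt (fun k => v (a k)) (proj a K x)) ≤ μ := by
  obtain ⟨k, hk, h1, h2⟩ := h.exists_cell_real hn hx hxn
  have hlt := h.lt k hk
  have hb : ((a (k + 1) - 1 : ℕ) : ℝ) = (a (k + 1) : ℝ) - 1 := by
    rw [Nat.cast_sub (by omega)]; simp
  rw [h.proj_eq hk h1 h2]
  rcases le_or_gt x ((a (k + 1) : ℝ) - 1) with h3 | h3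
  · rw [max_eq_left (by linarith), add_zero, pt_natCast]
    have hi : a k ≤ ⌊x⌋₊ := Nat.le_floor h1
    have hi' : ⌊x⌋₊ ≤ a (k + 1) - 1 := Nat.floor_le_of_le (by rwa [hb])
    rcases hi'.lt_or_eq with h4 | h4
    · have h5 := h.near k hk _ hi (by omega)
      have h6 := h.near k hk (⌊x⌋₊ + 1) (by omega) (by omega)
      rw [dist_comm] at h5 h6
      have := dist_pt_le (v := v) (w := fun _ => v (a k)) (i := ⌊x⌋₊) (j := 0) (x := ⌊x⌋₊)
        (x' := ((⌊x⌋₊ + 1 : ℕ) : ℝ)) (y := 0) (y' := 0) (θ := x - ⌊x⌋₊) (r := μ) le_rfl (by simp)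
        (by simp) (by simp) le_rfl (by simp) (by linarith [Nat.floor_le hx])
        (by linarith [Nat.lt_floor_add_one x]) (by rw [pt_natCast, pt_const]; exact h5)
        (by rw [pt_natCast, pt_const]; exact h6)
      rw [pt_const] at this
      convert this using 3
      push_cast
      ring
    · have h5 : x = ⌊x⌋₊ := le_antisymm (by rw [h4, hb]; exact h3) (Nat.floor_le hx)
      rw [h5, pt_natCast, dist_comm]
      exact h.near k hk _ hi (by omega)
  · rw [max_eq_right (by linarith)]
    have h5 := h.near k hk (a (k + 1) - 1) (by omega) (by omega)
    rw [dist_comm] at h5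
    have := dist_pt_le (v := v) (w := fun k => v (a k)) (i := a (k + 1) - 1) (j := k)
      (x := ((a (k + 1) - 1 : ℕ) : ℝ)) (x' := a (k + 1)) (y := k) (y' := ((k + 1 : ℕ) : ℝ))
      (θ := x - ((a (k + 1) : ℝ) - 1)) (r := μ) le_rfl (by linarith)
      (by linarith) le_rfl (by simp) (by simp) (by linarith) (by linarith)
      (by rw [pt_natCast, pt_natCast]; exact h5)
      (by rw [pt_natCast, pt_natCast, dist_self]; exact h.nonneg hn)
    convert this using 3
    · rw [hb]; ring
    · push_cast; ring

theorem proj_mem_cell (h : IsSimplification v n K a μ) (hk : k < K) (h₁ : (a k : ℝ) ≤ x)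
    (h₂ : x ≤ a (k + 1)) : (k : ℝ) ≤ proj a K x ∧ proj a K x ≤ k + 1 := by
  rw [h.proj_eq hk h₁ h₂]
  exact ⟨by linarith [le_max_left 0 (x - ((a (k + 1) : ℝ) - 1))],
    by gcongr; exact max_le zero_le_one (by linarith)⟩

/-- Chains of the curve give chains of the simplified curve. -/
theorem reachable_proj (h : IsSimplification v n K a μ) (hn : 1 ≤ n)
    (hr : Reachable v w r x y) (hx : x ≤ n) :
    Reachable (fun k => v (a k)) w (r + μ) (proj a K x) y := by
  have hμ := h.nonneg hn
  obtain ⟨k, hr⟩ := hr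
  induction hr with
  | start h' =>
    rw [h.proj_zero hn]
    exact ⟨0, .start (by simp only [h.zero]; linarith)⟩
  | @step k x y x' y' i₀ j hr h₁ h₂ h₃ h₄ h₅ h₆ h₇ ih =>
    have hx0 := hr.nonneg.1
    -- A step in a column with index at least `n` has `x = x' = n` and belongs to column `n - 1` as
    -- well.
    obtain ⟨i, hi, h₁, h₃⟩ : ∃ i < n, (i : ℝ) ≤ x ∧ x' ≤ i + 1 := by
      rcases lt_or_ge i₀ n with hlt | hge
      · exact ⟨i₀, hlt, h₁, h₃⟩
      · have : (n : ℝ) ≤ i₀ := Nat.cast_le.2 hge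
        have e : ((n - 1 : ℕ) : ℝ) = (n : ℝ) - 1 := by rw [Nat.cast_sub hn]; simp
        exact ⟨n - 1, by omega, by rw [e]; linarith, by rw [e]; linarith⟩
    obtain ⟨l, hl, h8, h9⟩ := h.exists_cell hi
    have h8' : (a l : ℝ) ≤ i := Nat.cast_le.2 h8
    have h9' : (i : ℝ) + 1 ≤ a (l + 1) := by exact_mod_cast h9
    refine (ih (h₂.trans hx)).step l j (h.proj_mem_cell hl (by linarith) (by linarith)).1
      (proj_mono a K h₂) (h.proj_mem_cell hl (by linarith) (by linarith)).2 h₄ h₅ h₆ ?_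
    have := h.dist_proj hn (hx0.trans h₂) hx
    have := dist_triangle (pt (fun k => v (a k)) (proj a K x')) (pt v x') (pt w y')
    linarith [dist_comm (pt v x') (pt (fun k => v (a k)) (proj a K x'))]

/-- Chains of the simplified curve give chains of the curve. -/
theorem reachable_of_proj (h : IsSimplification v n K a μ) (hn : 1 ≤ n)
    (hr : Reachable (fun k => v (a k)) w r z y) (hz : z ≤ K) (hx : 0 ≤ x) (hxn : x ≤ n)
    (hp : proj a K x = z) : Reachable v w (r + μ) x y := by
  have hμ := h.nonneg hn
  obtain ⟨k, hr⟩ := hr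
  induction hr generalizing x with
  | start h' =>
    rw [h.zero] at h'
    have h0 : Reachable v w (r + μ) 0 0 := ⟨0, .start (by linarith)⟩
    refine h0.walk hx fun u hu => ?_
    have h1 : proj a K u = 0 :=
      le_antisymm (hp ▸ proj_mono a K hu.2) (proj_nonneg a K u)
    have := h.dist_proj hn hu.1 (hu.2.trans hxn)
    rw [h1, pt_zero, h.zero] at this
    rw [pt_zero]
    linarith [dist_triangle (pt v u) (v 0) (w 0)]
  | @step k z y z' y' l₀ j hr h₁ h₂ h₃ h₄ h₅ h₆ h₇ ih =>
    have hfib : ∀ u : ℝ, 0 ≤ u → u ≤ n → proj a K u = z' → dist (pt v u) (pt w y') ≤ r + μ := by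
      intro u hu hu' hpu
      have := h.dist_proj hn hu hu'
      rw [hpu] at this
      linarith [dist_triangle (pt v u) (pt (fun k => v (a k)) z') (pt w y')]
    obtain ⟨l, hl, h₁, h₃⟩ : ∃ l < K, (l : ℝ) ≤ z ∧ z' ≤ l + 1 := by
      rcases lt_or_ge l₀ K with hlt | hge
      · exact ⟨l₀, hlt, h₁, h₃⟩
      · have hK := h.pos hn
        have : (K : ℝ) ≤ l₀ := Nat.cast_le.2 hge
        have e : ((K - 1 : ℕ) : ℝ) = (K : ℝ) - 1 := by rw [Nat.cast_sub hK]; simp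
        exact ⟨K - 1, by omega, by rw [e]; linarith, by rw [e]; linarith⟩
    have hlt := h.lt l hl
    have hlt' : (a l : ℝ) + 1 ≤ a (l + 1) := by exact_mod_cast hlt
    have hb : ((a (l + 1) - 1 : ℕ) : ℝ) = (a (l + 1) : ℝ) - 1 := by
      rw [Nat.cast_sub (by omega)]; simp
    have hlast : (a (l + 1) : ℝ) ≤ n := by
      rw [← h.last]; exact_mod_cast h.le_of_le hl le_rfl
    have hal : (0 : ℝ) ≤ a l := Nat.cast_nonneg _
    -- The inverse on the crossing part of a piece; a step of the simplified chain is lifted to the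
    -- last original edge of the piece.
    have hpre : ∀ ζ, (l : ℝ) ≤ ζ → ζ ≤ l + 1 → proj a K ((a (l + 1) : ℝ) - 1 + (ζ - l)) = ζ := by
      intro ζ h1 h2
      rw [h.proj_eq hl (by linarith) (by linarith), max_eq_right (by linarith)]
      ring
    by_cases hzl : z' = l
    · have hz1 : z = z' := by linarith
      have h8 : Reachable v w (r + μ) x y := ih (h₂.trans hz) hx hxn (hp.trans hz1.symm)
      exact h8.step ⌊x⌋₊ j (Nat.floor_le hx) le_rfl (Nat.lt_floor_add_one x).le h₄ h₅ h₆
        (hfib x hx hxn hp)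
    · have hlz : (l : ℝ) < z' := lt_of_le_of_ne (by linarith) (Ne.symm hzl)
      have h8 : Reachable v w (r + μ) ((a (l + 1) : ℝ) - 1 + (z - l)) y :=
        ih (h₂.trans hz) (by linarith) (by linarith) (hpre z h₁ (by linarith))
      have h9 : Reachable v w (r + μ) ((a (l + 1) : ℝ) - 1 + (z' - l)) y' :=
        h8.step (a (l + 1) - 1) j (by rw [hb]; linarith) (by linarith) (by rw [hb]; linarith) h₄ h₅
          h₆ (hfib _ (by linarith) (by linarith) (hpre z' hlz.le h₃))
      -- The lifted point is the first one in its fibre of `proj`. The rest of the fibre is walked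
      -- along with the second curve at rest, at the cost of `μ`.
      have h10 : (a (l + 1) : ℝ) - 1 + (z' - l) ≤ x := by
        by_contra hlt2
        push Not at hlt2
        rcases le_or_gt (a l : ℝ) x with h11 | h11
        · rw [h.proj_eq hl h11 (by linarith)] at hp
          rcases le_total 0 (x - ((a (l + 1) : ℝ) - 1)) with h12 | h12
          · rw [max_eq_right h12] at hp; linarith
          · rw [max_eq_left h12] at hp; linarith
        · have h12 := proj_mono a K h11.le
          rw [h.proj_eq hl le_rfl (by linarith), max_eq_left (by linarith)] at h12
          linarith
      refine h9.walk h10 fun u hu => hfib u (by linarith [hu.1]) (hu.2.trans hxn) ?_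
      refine le_antisymm (hp ▸ proj_mono a K hu.2) ?_
      have := proj_mono a K hu.1
      rwa [hpre z' hlz.le h₃] at this

/-- Every parameter of the simplified curve corresponds to one of the curve, on the same piece. -/
theorem exists_proj_eq (h : IsSimplification v n K a μ) (hk : k < K) (h₁ : (k : ℝ) ≤ z)
    (h₂ : z ≤ k + 1) : ∃ x, (a k : ℝ) ≤ x ∧ x ≤ a (k + 1) ∧ proj a K x = z := by
  have hlt' : (a k : ℝ) + 1 ≤ a (k + 1) := by exact_mod_cast h.lt k hk
  refine ⟨(a (k + 1) : ℝ) - 1 + (z - k), by linarith, by linarith, ?_⟩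
  rw [h.proj_eq hk (by linarith) (by linarith), max_eq_right (by linarith)]
  ring

end IsSimplification

/-- The reachability problem of the simplified curves answers that of the curves approximately. -/
theorem reachable_simplification {v w : ℕ → E} {n m K M : ℕ} {a b : ℕ → ℕ} {μ r : ℝ} (hn : 1 ≤ n)
    (hm : 1 ≤ m) (hv : IsSimplification v n K a μ) (hw : IsSimplification w m M b μ)
    (h : Reachable v w r n m) :
    Reachable (fun k => v (a k)) (fun k => w (b k)) (r + 2 * μ) K M := by
  have h1 := hv.reachable_proj hn h le_rfl
  have h2 := hw.reachable_proj hm h1.symm le_rfl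
  rw [hv.proj_last hn, hw.proj_last hm] at h2
  convert h2.symm using 1
  ring

theorem reachable_of_simplification {v w : ℕ → E} {n m K M : ℕ} {a b : ℕ → ℕ} {μ r : ℝ}
    (hn : 1 ≤ n) (hm : 1 ≤ m) (hv : IsSimplification v n K a μ) (hw : IsSimplification w m M b μ)
    (h : Reachable (fun k => v (a k)) (fun k => w (b k)) r K M) :
    Reachable v w (r + 2 * μ) n m := by
  have h1 := hv.reachable_of_proj hn h le_rfl (Nat.cast_nonneg n) le_rfl (hv.proj_last hn)
  have h2 := hw.reachable_of_proj hm h1.symm le_rfl (Nat.cast_nonneg m) le_rfl (hw.proj_last hm)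
  convert h2.symm using 1
  ring

end Simplification

end PolygonalCurve

/-! ### Packed curves -/

namespace PolygonalCurve

section Length

open MeasureTheory

variable {E : Type*} [NormedAddCommGroup E] [NormedSpace ℝ E]

/-- The parameters of the `i`-th edge whose points lie in the closed ball `B(x, r)`. -/
def edgeInBall (v : ℕ → E) (x : E) (r : ℝ) (i : ℕ) : Set ℝ :=
  {s : ℝ | s ∈ Set.Icc (0 : ℝ) 1 ∧ v i + s • (v (i + 1) - v i) ∈ Metric.closedBall x r}

/-- The length inside the closed ball `B(x, r)` of the curve up to the parameter `t`. -/
noncomputable def lengthUpTo (v : ℕ → E) (n : ℕ) (x : E) (r t : ℝ) : ℝ :=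
  ∑ i ∈ Finset.range n,
    ‖v (i + 1) - v i‖ * (volume (edgeInBall v x r i ∩ Set.Iic (t - i))).toReal

variable {v : ℕ → E} {n : ℕ} {x u : E} {r h t t' : ℝ}

theorem volume_edgeInBall_lt_top (v : ℕ → E) (x : E) (r : ℝ) (i : ℕ) :
    volume (edgeInBall v x r i) < ⊤ :=
  (measure_mono fun _ hs => hs.1).trans_lt (measure_Icc_lt_top (a := (0 : ℝ)) (b := 1))

theorem measure_inter_Iic_mono (v : ℕ → E) (x : E) (r : ℝ) (i : ℕ) (htt : t ≤ t') :
    (volume (edgeInBall v x r i ∩ Set.Iic t)).toReal ≤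
      (volume (edgeInBall v x r i ∩ Set.Iic t')).toReal :=
  ENNReal.toReal_mono
    ((measure_mono Set.inter_subset_left).trans_lt (volume_edgeInBall_lt_top v x r i)).ne
    (measure_mono (Set.inter_subset_inter_right _ (Set.Iic_subset_Iic.2 htt)))

theorem lengthUpTo_mono (v : ℕ → E) (n : ℕ) (x : E) (r : ℝ) : Monotone (lengthUpTo v n x r) :=
  fun _ _ htt => Finset.sum_le_sum fun i _ =>
    mul_le_mul_of_nonneg_left (measure_inter_Iic_mono v x r i (by linarith)) (norm_nonneg _)

theorem lengthUpTo_nonneg (v : ℕ → E) (n : ℕ) (x : E) (r t : ℝ) : 0 ≤ lengthUpTo v n x r t :=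
  Finset.sum_nonneg fun _ _ => by positivity

/-- The interval from `α` to `β` contributes its full length on the `i`-th edge, and the other edges
contribute nonnegative amounts by monotonicity. Only the half-open interval has to be measurable for
the measures to add up. -/
theorem mul_le_lengthUpTo_sub {i : ℕ} (hi : i < n) {α β : ℝ} (hα : t ≤ α) (hβ : β ≤ t')
    (hαβ : α ≤ β) (h₁ : (i : ℝ) ≤ t) (h₂ : t' ≤ i + 1)
    (hin : ∀ τ ∈ Set.Icc α β, pt v τ ∈ Metric.closedBall x r) :
    ‖v (i + 1) - v i‖ * (β - α) ≤ lengthUpTo v n x r t' - lengthUpTo v n x r t := by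
  rw [lengthUpTo, lengthUpTo, ← Finset.sum_sub_distrib]
  refine le_trans ?_ (Finset.single_le_sum
    (f := fun i : ℕ => ‖v (i + 1) - v i‖ * (volume (edgeInBall v x r i ∩ Set.Iic (t' - i))).toReal -
      ‖v (i + 1) - v i‖ * (volume (edgeInBall v x r i ∩ Set.Iic (t - i))).toReal)
    (fun j _ => ?_) (Finset.mem_range.2 hi))
  · rw [← mul_sub]
    refine mul_le_mul_of_nonneg_left ?_ (norm_nonneg _)
    have hfin : ∀ τ, volume (edgeInBall v x r i ∩ Set.Iic τ) ≠ ⊤ := fun τ =>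
      ((measure_mono Set.inter_subset_left).trans_lt (volume_edgeInBall_lt_top v x r i)).ne
    have hsub : edgeInBall v x r i ∩ Set.Iic (t - i) ∪ Set.Ioc (α - i) (β - i) ⊆
        edgeInBall v x r i ∩ Set.Iic (t' - i) := by
      rintro s (hs | hs)
      · exact ⟨hs.1, by have := hs.2; simp only [Set.mem_Iic] at this ⊢; linarith⟩
      · have h3 := hin (i + s) ⟨by linarith [hs.1], by linarith [hs.2]⟩
        rw [pt_add v (by linarith [hs.1]) (by linarith [hs.2])] at h3
        exact ⟨⟨⟨by linarith [hs.1], by linarith [hs.2]⟩, h3⟩, by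
          simp only [Set.mem_Iic]; linarith [hs.2]⟩
    have hdisj : Disjoint (edgeInBall v x r i ∩ Set.Iic (t - i)) (Set.Ioc (α - i) (β - i)) := by
      rw [Set.disjoint_left]
      rintro s hs hs'
      have := hs.2
      simp only [Set.mem_Iic] at this
      linarith [hs'.1]
    have h4 := measure_mono (μ := volume) hsub
    rw [measure_union hdisj measurableSet_Ioc] at h4
    have h5 := ENNReal.toReal_mono (hfin _) h4
    rw [ENNReal.toReal_add (hfin _) measure_Ioc_lt_top.ne, Real.volume_Ioc,
      ENNReal.toReal_ofReal (by linarith)] at h5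
    linarith
  · rw [← mul_sub]
    exact mul_nonneg (norm_nonneg _)
      (sub_nonneg.2 (measure_inter_Iic_mono v x r j (by linarith)))

theorem dist_pt_le_of_mem_Icc {i : ℕ} {α β τ : ℝ} (h₁ : (i : ℝ) ≤ α) (h₂ : β ≤ i + 1)
    (hα : dist (pt v α) u ≤ h) (hβ : dist (pt v β) u ≤ h) (hτ : τ ∈ Set.Icc α β) :
    dist (pt v τ) u ≤ h := by
  rcases hτ.1.eq_or_lt with rfl | hlt
  · exact hα
  have hpos : 0 < β - α := by linarith [hτ.2]
  have := dist_pt_le (v := v) (w := fun _ => u) (i := i) (j := 0) (x := α) (x' := β) (y := 0)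
    (y' := 0) (θ := (τ - α) / (β - α)) (r := h) h₁ (by linarith) h₂ (by simp) le_rfl (by simp)
    (div_nonneg (by linarith) hpos.le) ((div_le_one hpos).2 (by linarith [hτ.2]))
    (by rwa [pt_const]) (by rwa [pt_const])
  rw [pt_const] at this
  convert this using 3
  field_simp
  ring

theorem continuousOn_pt (v : ℕ → E) (i : ℕ) : ContinuousOn (pt v) (Set.Icc (i : ℝ) (i + 1)) := by
  have : ContinuousOn (fun τ : ℝ => v i + (τ - i) • (v (i + 1) - v i)) (Set.Icc (i : ℝ) (i + 1)) := by
    fun_prop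
  exact this.congr fun τ hτ => pt_eq v hτ.1 hτ.2

theorem dist_pt_pt {i : ℕ} (h₁ : (i : ℝ) ≤ t) (h₂ : t ≤ t') (h₃ : t' ≤ i + 1) :
    dist (pt v t) (pt v t') = ‖v (i + 1) - v i‖ * (t' - t) := by
  rw [pt_eq v h₁ (by linarith), pt_eq v (by linarith) h₃, dist_eq_norm']
  have : v i + (t' - i) • (v (i + 1) - v i) - (v i + (t - i) • (v (i + 1) - v i)) =
      (t' - t) • (v (i + 1) - v i) := by module
  rw [this, norm_smul, Real.norm_of_nonneg (by linarith), mul_comm]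

/-- Inside the ball, the length bounds the change of the distance from a point. -/
theorem abs_min_dist_sub_le_of_cell {i : ℕ} (hi : i < n) (h₁ : (i : ℝ) ≤ t) (htt : t ≤ t')
    (h₂ : t' ≤ i + 1) (hu : Metric.closedBall u h ⊆ Metric.closedBall x r) :
    |min h (dist (pt v t') u) - min h (dist (pt v t) u)| ≤
      lengthUpTo v n x r t' - lengthUpTo v n x r t := by
  have hmono : 0 ≤ lengthUpTo v n x r t' - lengthUpTo v n x r t :=
    sub_nonneg.2 (lengthUpTo_mono v n x r htt)
  -- If both ends are within `h` of `u`, so is the segment between them. It then lies in the ball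
  -- and is counted with its full length.
  have key : ∀ α β, t ≤ α → β ≤ t' → α ≤ β → dist (pt v α) u ≤ h → dist (pt v β) u ≤ h →
      |dist (pt v β) u - dist (pt v α) u| ≤
        lengthUpTo v n x r t' - lengthUpTo v n x r t := by
    intro α β hα hβ hαβ h3 h4
    refine le_trans ?_ (mul_le_lengthUpTo_sub hi hα hβ hαβ h₁ h₂ fun τ hτ =>
      hu (dist_pt_le_of_mem_Icc (by linarith) (by linarith) h3 h4 hτ))
    rw [← dist_pt_pt (by linarith) hαβ (by linarith), dist_comm (pt v α) (pt v β)]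
    exact abs_dist_sub_le (pt v β) (pt v α) u
  have hcont : ContinuousOn (fun τ => dist (pt v τ) u) (Set.Icc t t') :=
    (continuous_id.dist continuous_const).comp_continuousOn
      ((continuousOn_pt v i).mono (Set.Icc_subset_Icc h₁ h₂))
  rcases le_or_gt (dist (pt v t) u) h with h3 | h3 <;>
    rcases le_or_gt (dist (pt v t') u) h with h4 | h4
  · rw [min_eq_right h3, min_eq_right h4]
    exact key t t' le_rfl le_rfl htt h3 h4
  -- If one end is farther than `h` from `u`, the segment is cut where the distance equals `h`,
  -- which leaves the truncated distance unchanged.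
  · obtain ⟨β, hβ, hβ'⟩ := intermediate_value_Icc htt hcont ⟨h3, h4.le⟩
    simp only at hβ'
    have := key t β le_rfl hβ.2 hβ.1 h3 hβ'.le
    rw [hβ'] at this
    rwa [min_eq_left h4.le, min_eq_right h3]
  · obtain ⟨α, hα, hα'⟩ := intermediate_value_Icc' htt hcont ⟨h4, h3.le⟩
    simp only at hα'
    have := key α t' hα.1 le_rfl hα.2 hα'.le h4
    rw [hα'] at this
    rwa [min_eq_right h4, min_eq_left h3.le]
  · rw [min_eq_left h3.le, min_eq_left h4.le]
    simpa using hmono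

/-- Truncation at `h` makes the estimate telescope over the edges: outside the ball about `u` the
truncated distance is constant, so excursions cost nothing. -/
theorem abs_min_dist_sub_le (h₁ : 0 ≤ t) (htt : t ≤ t') (h₂ : t' ≤ n)
    (hu : Metric.closedBall u h ⊆ Metric.closedBall x r) :
    |min h (dist (pt v t') u) - min h (dist (pt v t) u)| ≤
      lengthUpTo v n x r t' - lengthUpTo v n x r t := by
  obtain ⟨c, hc⟩ : ∃ c : ℕ, t' ≤ ⌊t⌋₊ + 1 + c := by
    obtain ⟨c, hc⟩ := exists_nat_ge (t' - (⌊t⌋₊ + 1))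
    exact ⟨c, by linarith⟩
  rcases htt.eq_or_lt with rfl | hlt
  · simp
  have hfl : ⌊t⌋₊ < n := (Nat.floor_lt h₁).2 (by linarith)
  induction c generalizing t with
  | zero => exact abs_min_dist_sub_le_of_cell hfl (Nat.floor_le h₁) htt (by simpa using hc) hu
  | succ c ih =>
    by_cases h3 : t' ≤ ⌊t⌋₊ + 1
    · exact abs_min_dist_sub_le_of_cell hfl (Nat.floor_le h₁) htt h3 hu
    · push Not at h3
      have e := abs_min_dist_sub_le_of_cell (v := v) hfl (Nat.floor_le h₁)
        (Nat.lt_floor_add_one t).le le_rfl hu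
      have h4 : ⌊(⌊t⌋₊ : ℝ) + 1⌋₊ = ⌊t⌋₊ + 1 := by exact_mod_cast Nat.floor_natCast (⌊t⌋₊ + 1)
      have h5 := ih (t := (⌊t⌋₊ : ℝ) + 1) (by positivity) h3.le
        (by rw [h4]; push_cast at hc ⊢; linarith) h3
        (by rw [h4]; exact_mod_cast h3.trans_le h₂)
      have h6 := abs_sub_le (min h (dist (pt v t') u)) (min h (dist (pt v ((⌊t⌋₊ : ℝ) + 1)) u))
        (min h (dist (pt v t) u))
      linarith

/-- A piece of the curve that meets `B(x, ρ)` and has extent `h` has length `h` in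
`B(x, ρ + h)`. -/
theorem le_lengthUpTo_sub {ρ : ℝ} (h₁ : 0 ≤ t) (htt : t ≤ t') (h₂ : t' ≤ n) (hh : 0 ≤ h)
    (hρ : dist (pt v t) x ≤ ρ ∨ dist (pt v t') x ≤ ρ) (hd : h ≤ dist (pt v t) (pt v t')) :
    h ≤ lengthUpTo v n x (ρ + h) t' - lengthUpTo v n x (ρ + h) t := by
  have hball : ∀ u, dist u x ≤ ρ → Metric.closedBall u h ⊆ Metric.closedBall x (ρ + h) :=
    fun u hu => Metric.closedBall_subset_closedBall' (by linarith)
  rcases hρ with hρ | hρ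
  · have := abs_min_dist_sub_le (v := v) h₁ htt h₂ (hball _ hρ)
    rw [dist_self, min_eq_right hh, dist_comm, min_eq_left hd, sub_zero] at this
    exact (le_abs_self _).trans this
  · have := abs_min_dist_sub_le (v := v) h₁ htt h₂ (hball _ hρ)
    rw [dist_self, min_eq_right hh, min_eq_left hd, abs_sub_comm, sub_zero] at this
    exact (le_abs_self _).trans this

/-- Pieces in increasing order use disjoint parts of the length inside the ball; the last piece is
split off in each step. -/
theorem sum_lengthUpTo_sub_le (J : Finset ℕ) (f g : ℕ → ℝ) {x : E} {r : ℝ}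
    (hfg : ∀ j ∈ J, f j ≤ g j) (hlt : ∀ j ∈ J, ∀ j' ∈ J, j < j' → g j ≤ f j') (T : ℝ)
    (hT : ∀ j ∈ J, g j ≤ T) :
    ∑ j ∈ J, (lengthUpTo v n x r (g j) - lengthUpTo v n x r (f j)) ≤ lengthUpTo v n x r T := by
  induction J using Finset.induction_on_max generalizing T with
  | empty => simpa using lengthUpTo_nonneg v n x r T
  | insert a s ha ih =>
    have has : a ∉ s := fun h => lt_irrefl _ (ha a h)
    rw [Finset.sum_insert has]
    have h1 := ih (fun j hj => hfg j (Finset.mem_insert_of_mem hj))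
      (fun j hj j' hj' => hlt j (Finset.mem_insert_of_mem hj) j' (Finset.mem_insert_of_mem hj'))
      (f a) (fun j hj => hlt j (Finset.mem_insert_of_mem hj) a (Finset.mem_insert_self _ _) (ha j hj))
    have h2 := lengthUpTo_mono v n x r (hT a (Finset.mem_insert_self _ _))
    linarith

end Length

/-! ### Disjoint pieces of a packed curve near a point -/

section Packed

open MeasureTheory

variable {d n : ℕ} {p : Fin n → EuclideanSpace ℝ (Fin d)} {c : ℝ}

theorem lengthUpTo_le_lengthInBall (hn : 1 ≤ n) (x : EuclideanSpace ℝ (Fin d)) (r t : ℝ) :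
    lengthUpTo (ext p) n x r t ≤ lengthInBall p x r := by
  obtain ⟨k, rfl⟩ : ∃ k, n = k + 1 := ⟨n - 1, by omega⟩
  rw [lengthUpTo, Finset.sum_range_succ, lengthInBall]
  -- The additional edge of the prolonged curve has length zero.
  have h1 : ext p (k + 1) = ext p k := by simp [ext]
  rw [h1, sub_self, norm_zero, zero_mul, add_zero]
  refine Finset.sum_le_sum fun i hi => ?_
  rw [Finset.mem_range] at hi
  have e1 : ext p i = vertex p i := by
    simp only [ext, Nat.add_sub_cancel]; rw [min_eq_left (by omega)]
  have e2 : ext p (i + 1) = vertex p (i + 1) := by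
    simp only [ext, Nat.add_sub_cancel]; rw [min_eq_left (by omega)]
  rw [segmentLengthInBall, e1, e2]
  refine mul_le_mul_of_nonneg_left ?_ (norm_nonneg _)
  have h3 := volume_edgeInBall_lt_top (ext p) x r i
  have h4 := ENNReal.toReal_mono h3.ne (measure_mono (μ := volume)
    (Set.inter_subset_left (s := edgeInBall (ext p) x r i) (t := Set.Iic (t - i))))
  refine h4.trans (le_of_eq ?_)
  rw [edgeInBall, e1, e2]

/-- In a packed curve, only few disjoint pieces of extent `h` meet a ball. -/
theorem IsPacked.card_mul_le (hp : IsPacked c p) (hn : 1 ≤ n) {x : EuclideanSpace ℝ (Fin d)}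
    {ρ h : ℝ} (hρ : 0 ≤ ρ) (hh : 0 < h) (J : Finset ℕ) (f g : ℕ → ℝ)
    (hf : ∀ j ∈ J, 0 ≤ f j) (hfg : ∀ j ∈ J, f j ≤ g j) (hg : ∀ j ∈ J, g j ≤ n)
    (hlt : ∀ j ∈ J, ∀ j' ∈ J, j < j' → g j ≤ f j')
    (hnear : ∀ j ∈ J, dist (pt (ext p) (f j)) x ≤ ρ ∨ dist (pt (ext p) (g j)) x ≤ ρ)
    (hfar : ∀ j ∈ J, h ≤ dist (pt (ext p) (f j)) (pt (ext p) (g j))) :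
    J.card * h ≤ c * (ρ + h) := by
  have h1 : ∑ j ∈ J, h ≤ ∑ j ∈ J, (lengthUpTo (ext p) n x (ρ + h) (g j) -
      lengthUpTo (ext p) n x (ρ + h) (f j)) :=
    Finset.sum_le_sum fun j hj =>
      le_lengthUpTo_sub (hf j hj) (hfg j hj) (hg j hj) hh.le (hnear j hj) (hfar j hj)
  rw [Finset.sum_const, nsmul_eq_mul] at h1
  exact h1.trans ((sum_lengthUpTo_sub_le J f g hfg hlt n hg).trans
    ((lengthUpTo_le_lengthInBall hn _ _ _).trans (hp x _ (by linarith))))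

end Packed

end PolygonalCurve

/-! ### The number of reachable cells -/

namespace PolygonalCurve

section Cells

variable {E : Type*} [NormedAddCommGroup E] [NormedSpace ℝ E]

/-- Some point of the closed cell `(i, j)` of the free space is reachable. -/
def CellReachable (v w : ℕ → E) (r : ℝ) (i j : ℕ) : Prop :=
  ∃ x y : ℝ, (i ≤ x ∧ x ≤ i + 1) ∧ (j ≤ y ∧ y ≤ j + 1) ∧ Reachable v w r x y

open Classical in
/-- The cells of the free space of curves with `K` and `M` edges that satisfy `Q`. -/
noncomputable def cellsWith (K M : ℕ) (Q : ℕ → ℕ → Prop) : Finset (ℕ × ℕ) :=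
  (Finset.range K ×ˢ Finset.range M).filter fun c => Q c.1 c.2

theorem mem_cellsWith {K M : ℕ} {Q : ℕ → ℕ → Prop} {i j : ℕ} :
    (i, j) ∈ cellsWith K M Q ↔ (i < K ∧ j < M) ∧ Q i j := by
  simp [cellsWith]

/-- The reachable cells of the free space of curves with `K` and `M` edges. -/
noncomputable def reachableCells (v w : ℕ → E) (r : ℝ) (K M : ℕ) : Finset (ℕ × ℕ) :=
  cellsWith K M (CellReachable v w r)

theorem mem_reachableCells {v w : ℕ → E} {r : ℝ} {K M i j : ℕ} :
    (i, j) ∈ reachableCells v w r K M ↔ (i < K ∧ j < M) ∧ CellReachable v w r i j := mem_cellsWith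

theorem CellReachable.symm {v w : ℕ → E} {r : ℝ} {i j : ℕ} (h : CellReachable v w r i j) :
    CellReachable w v r j i := by
  obtain ⟨x, y, hx, hy, h⟩ := h
  exact ⟨y, x, hy, hx, h.symm⟩

theorem card_reachableCells_symm (v w : ℕ → E) (r : ℝ) (K M : ℕ) :
    (reachableCells v w r K M).card = (reachableCells w v r M K).card := by
  refine Finset.card_bij (fun c _ => (c.2, c.1)) ?_ ?_ ?_
  · rintro ⟨i, j⟩ h
    rw [mem_reachableCells] at h ⊢
    exact ⟨h.1.symm, h.2.symm⟩
  · rintro ⟨i, j⟩ - ⟨i', j'⟩ - h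
    simpa [and_comm] using h
  · rintro ⟨i, j⟩ h
    rw [mem_reachableCells] at h
    exact ⟨(j, i), mem_reachableCells.2 ⟨h.1.symm, h.2.symm⟩, rfl⟩

theorem card_cellsWith_le (K M : ℕ) (Q : ℕ → ℕ → Prop) (β : ℝ)
    (h : ∀ j < M, ∀ J : Finset ℕ, (∀ i ∈ J, i < K ∧ Q i j) → (J.card : ℝ) ≤ β) :
    ((cellsWith K M Q).card : ℝ) ≤ M * β := by
  classical
  have : (cellsWith K M Q).card =
      ∑ j ∈ Finset.range M, ((Finset.range K).filter fun i => Q i j).card := by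
    simp only [cellsWith, Finset.card_filter]
    rw [Finset.sum_product_right]
  rw [this]
  push_cast
  refine (Finset.sum_le_sum fun j hj => h j (Finset.mem_range.1 hj) _ fun i hi => ?_).trans ?_
  · simpa using hi
  · simp

theorem card_cellsWith_le' (K M : ℕ) (Q : ℕ → ℕ → Prop) (β : ℝ)
    (h : ∀ i < K, ∀ J : Finset ℕ, (∀ j ∈ J, j < M ∧ Q i j) → (J.card : ℝ) ≤ β) :
    ((cellsWith K M Q).card : ℝ) ≤ K * β := by
  classical
  have : (cellsWith K M Q).card =
      ∑ i ∈ Finset.range K, ((Finset.range M).filter fun j => Q i j).card := by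
    simp only [cellsWith, Finset.card_filter]
    rw [Finset.sum_product]
  rw [this]
  push_cast
  refine (Finset.sum_le_sum fun j hj => h j (Finset.mem_range.1 hj) _ fun i hi => ?_).trans ?_
  · simpa using hi
  · simp

theorem dist_pt_vertex_le (v : ℕ → E) {i : ℕ} {x : ℝ} (h₁ : (i : ℝ) ≤ x) (h₂ : x ≤ i + 1) :
    dist (pt v x) (v i) ≤ dist (v i) (v (i + 1)) := by
  have := dist_pt_pt (v := v) le_rfl h₁ h₂
  rw [pt_natCast, dist_comm] at this
  rw [this, dist_comm, dist_eq_norm]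
  exact mul_le_of_le_one_right (norm_nonneg _) (by linarith)

end Cells

/-! ### Charging reachable cells to edges -/

section Count

variable {d n m K M : ℕ} {p : Fin n → EuclideanSpace ℝ (Fin d)} {w : ℕ → EuclideanSpace ℝ (Fin d)}
  {a : ℕ → ℕ} {c μ r : ℝ}

/-- The piece of the curve that belongs to an edge of its simplification has an extent of at least
half the length of the edge, and comes close to the other curve if the edge does. -/
theorem exists_piece (hv : IsSimplification (ext p) n K a μ) (hn : 1 ≤ n) {i j : ℕ} (hi : i < K)
    (hc : CellReachable (fun k => ext p (a k)) w r i j) :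
    ∃ f g : ℝ, (a i : ℝ) ≤ f ∧ f ≤ g ∧ g ≤ a (i + 1) ∧
      (dist (pt (ext p) f) (w j) ≤ dist (w j) (w (j + 1)) + (r + μ) ∨
        dist (pt (ext p) g) (w j) ≤ dist (w j) (w (j + 1)) + (r + μ)) ∧
      dist (ext p (a i)) (ext p (a (i + 1))) / 2 ≤ dist (pt (ext p) f) (pt (ext p) g) := by
  obtain ⟨x, y, hx, hy, hr⟩ := hc
  obtain ⟨u, hu₁, hu₂, hu⟩ := hv.exists_proj_eq hi hx.1 hx.2
  have hun : u ≤ n := hu₂.trans (by rw [← hv.last]; exact_mod_cast hv.le_of_le hi le_rfl)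
  have h1 := hv.dist_proj hn ((Nat.cast_nonneg _).trans hu₁) hun
  rw [hu] at h1
  have h2 : dist (pt (ext p) u) (w j) ≤ dist (w j) (w (j + 1)) + (r + μ) := by
    have := dist_triangle4 (pt (ext p) u) (pt (fun k => ext p (a k)) x) (pt w y) (w j)
    linarith [hr.dist_le, dist_pt_vertex_le w hy.1 hy.2]
  have h3 := dist_triangle (ext p (a i)) (pt (ext p) u) (ext p (a (i + 1)))
  -- One end of the edge is at least half its length away from the point with parameter `u`, and the
  -- piece between the two is taken.
  rcases le_total (dist (ext p (a i)) (ext p (a (i + 1))) / 2)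
    (dist (ext p (a i)) (pt (ext p) u)) with h4 | h4
  · exact ⟨a i, u, le_rfl, hu₁, hu₂, .inr h2, by rwa [pt_natCast]⟩
  · exact ⟨u, a (i + 1), hu₁, hu₂, le_rfl, .inl h2, by rw [pt_natCast]; linarith⟩

/-- Edges of the packed curve that are long in comparison with the `j`-th edge of the other curve,
and reach it. -/
theorem card_long_edges_le (hp : IsPacked c p) (hn : 1 ≤ n) (hc : 0 ≤ c) (hμ : 0 < μ) (hr : 0 ≤ r)
    (hv : IsSimplification (ext p) n K a μ) {κ : ℝ} (hκ : r + μ ≤ κ * μ) (j : ℕ)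
    (hj : μ < dist (w j) (w (j + 1))) (J : Finset ℕ)
    (hmem : ∀ i ∈ J, i < K ∧ CellReachable (fun k => ext p (a k)) w r i j ∧ i + 1 < K ∧
      dist (w j) (w (j + 1)) ≤ max (dist (ext p (a i)) (ext p (a (i + 1)))) (8 * (r + μ))) :
    (J.card : ℝ) ≤ c * (18 * κ + 4) := by
  have hex : ∀ i ∈ J, ∃ f g : ℝ, (a i : ℝ) ≤ f ∧ f ≤ g ∧ g ≤ a (i + 1) ∧
      (dist (pt (ext p) f) (w j) ≤ dist (w j) (w (j + 1)) + (r + μ) ∨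
        dist (pt (ext p) g) (w j) ≤ dist (w j) (w (j + 1)) + (r + μ)) ∧
      dist (ext p (a i)) (ext p (a (i + 1))) / 2 ≤ dist (pt (ext p) f) (pt (ext p) g) :=
    fun i hi => exists_piece hv hn (hmem i hi).1 (hmem i hi).2.1
  choose! f g h₁ h₂ h₃ h₄ h₅ using hex
  have main : ∀ h, 0 < h → (∀ i ∈ J, h ≤ dist (ext p (a i)) (ext p (a (i + 1))) / 2) →
      J.card * h ≤ c * (dist (w j) (w (j + 1)) + (r + μ) + h) := by
    intro h hh hle
    refine hp.card_mul_le hn (by positivity) hh J f g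
      (fun i hi => (Nat.cast_nonneg _).trans (h₁ i hi)) h₂ (fun i hi => (h₃ i hi).trans ?_) ?_ h₄
      (fun i hi => (hle i hi).trans (h₅ i hi))
    · rw [← hv.last]
      exact_mod_cast hv.le_of_le (hmem i hi).1 le_rfl
    · intro i hi i' hi' hlt
      refine (h₃ i hi).trans (le_trans ?_ (h₁ i' hi'))
      exact_mod_cast hv.le_of_le hlt (hmem i' hi').1.le
  have hκ0 : 0 ≤ κ := by
    by_contra hneg
    push Not at hneg
    nlinarith
  rcases le_or_gt (dist (w j) (w (j + 1))) (8 * (r + μ)) with h8 | h8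
  -- A short edge of `w`: all edges in `J` are longer than `μ`, none being the last one, so the
  -- pieces have extent `μ / 2`. They meet a ball of radius at most `9 κ μ`.
  · have := main (μ / 2) (by linarith) fun i hi => by linarith [hv.far i (hmem i hi).2.2.1]
    have h9 : c * (dist (w j) (w (j + 1)) + (r + μ) + μ / 2) ≤ c * (9 * (κ * μ) + μ / 2) := by
      gcongr
      linarith
    have h10 : (J.card : ℝ) * (μ / 2) ≤ c * (18 * κ + 1) * (μ / 2) := by
      linarith
    have h11 := le_of_mul_le_mul_right h10 (by linarith)
    linarith [mul_nonneg hc hκ0]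
  · set F := dist (w j) (w (j + 1)) with hF
    have hF0 : 0 < F := by linarith
    -- A long edge of `w`: the maximum must then be attained by the edge `i`, whose length is at
    -- least `F`. The pieces have extent `F / 2` and meet a ball of radius at most `9F/8`.
    have := main (F / 2) (by linarith) fun i hi => by
      rcases le_max_iff.1 (hmem i hi).2.2.2 with h | h
      · linarith
      · linarith
    have h9 : c * (F + (r + μ) + F / 2) ≤ c * (4 * (F / 2)) := by
      gcongr
      linarith
    have h10 : (J.card : ℝ) * (F / 2) ≤ c * 4 * (F / 2) := by linarith
    have h11 := le_of_mul_le_mul_right h10 (by linarith)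
    linarith [mul_nonneg hc hκ0]

/-- Edges of the other curve that are long in comparison with the `i`-th edge of the packed curve,
and reach it: all of them but the last one are matched to disjoint pieces of the packed curve. -/
theorem card_short_edges_le (hp : IsPacked c p) (hn : 1 ≤ n) (hc : 0 ≤ c) (hμ : 0 < μ) (hr : 0 ≤ r)
    (hv : IsSimplification (ext p) n K a μ) (i : ℕ) (hi : i < K) (J : Finset ℕ)
    (hmem : ∀ j ∈ J, CellReachable (fun k => ext p (a k)) w r i j ∧
      max (dist (ext p (a i)) (ext p (a (i + 1)))) (8 * (r + μ)) < dist (w j) (w (j + 1))) :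
    (J.card : ℝ) ≤ 6 * c + 1 := by
  set e := dist (ext p (a i)) (ext p (a (i + 1))) with he
  set L := max e (8 * (r + μ)) with hL
  rcases J.eq_empty_or_nonempty with hJe | hJne
  · rw [hJe]; simp; linarith
  have hLe : e ≤ L := le_max_left _ _
  have hLR : 8 * (r + μ) ≤ L := le_max_right _ _
  have hL0 : 0 < L := by linarith
  -- A chain to the cell of the last edge `j₀` traverses all earlier edges of `J` completely. Lifted
  -- to the packed curve, it matches them monotonically.
  set j₀ := J.max' hJne with hj₀
  obtain ⟨x, y, hx, hy, hxy⟩ := (hmem j₀ (J.max'_mem hJne)).1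
  obtain ⟨u, hu₁, hu₂, hu⟩ := hv.exists_proj_eq hi hx.1 hx.2
  have hun : u ≤ n := hu₂.trans (by rw [← hv.last]; exact_mod_cast hv.le_of_le hi le_rfl)
  have hxK : x ≤ K := by
    have : ((i + 1 : ℕ) : ℝ) ≤ K := Nat.cast_le.2 hi
    push_cast at this
    linarith [hx.2]
  obtain ⟨k, hk⟩ := hv.reachable_of_proj hn hxy hxK ((Nat.cast_nonneg _).trans hu₁) hun hu
  obtain ⟨ξ, hξ, hξ'⟩ := hk.exists_monotone_selection
  have hlt : ∀ j ∈ J.erase j₀, (j : ℝ) + 1 ≤ y := by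
    intro j hj
    have h1 : j < j₀ := lt_of_le_of_ne (J.le_max' j (Finset.mem_of_mem_erase hj))
      (Finset.ne_of_mem_erase hj)
    have h2 : ((j + 1 : ℕ) : ℝ) ≤ j₀ := Nat.cast_le.2 h1
    push_cast at h2
    linarith [hy.1]
  -- The edge `j` is longer than `L`, so half of it, at least `L / 2`, lies on one side of its point
  -- in the reachable cell. Matching within `r + μ ≤ L / 8` at both ends leaves an extent of `L /
  -- 4`. The point itself is matched within `(r + μ) + r + e ≤ 5/4 L` of the vertex.
  have hex : ∀ j ∈ J.erase j₀, ∃ f g : ℝ, ((j : ℝ) ≤ f ∧ f ≤ g ∧ g ≤ j + 1) ∧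
      (dist (pt (ext p) (ξ f)) (ext p (a i)) ≤ 5 / 4 * L ∨
        dist (pt (ext p) (ξ g)) (ext p (a i)) ≤ 5 / 4 * L) ∧
      L / 4 ≤ dist (pt (ext p) (ξ f)) (pt (ext p) (ξ g)) := by
    intro j hj
    have hj0 : (0 : ℝ) ≤ j := Nat.cast_nonneg _
    have hjy := hlt j hj
    obtain ⟨⟨x', z, hx', hz, hxz⟩, hF⟩ := hmem j (Finset.mem_of_mem_erase hj)
    have d1 := (hξ' z ⟨by linarith, by linarith⟩).2
    have d2 := (hξ' j ⟨by linarith, by linarith⟩).2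
    have d3 := (hξ' (j + 1 : ℕ) ⟨by positivity, by push_cast; linarith⟩).2
    rw [pt_natCast] at d2 d3
    have hnear : dist (pt (ext p) (ξ z)) (ext p (a i)) ≤ 5 / 4 * L := by
      have h1 := dist_triangle4 (pt (ext p) (ξ z)) (pt w z) (pt (fun k => ext p (a k)) x')
        (ext p (a i))
      have h2 := hxz.dist_le
      rw [dist_comm] at h2
      have h3 : dist (pt (fun k => ext p (a k)) x') (ext p (a i)) ≤ e :=
        dist_pt_vertex_le (fun k => ext p (a k)) hx'.1 hx'.2
      linarith
    have h3 := dist_triangle (w j) (pt w z) (w (j + 1))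
    rcases le_total (L / 2) (dist (w j) (pt w z)) with h4 | h4
    · refine ⟨j, z, ⟨le_rfl, hz.1, hz.2⟩, .inr hnear, ?_⟩
      have := dist_triangle4 (w j) (pt (ext p) (ξ j)) (pt (ext p) (ξ z)) (pt w z)
      rw [dist_comm (w j) (pt (ext p) (ξ j))] at this
      linarith
    · refine ⟨z, (j + 1 : ℕ), ⟨hz.1, by push_cast; exact hz.2, by simp⟩, .inl hnear, ?_⟩
      have := dist_triangle4 (pt w z) (pt (ext p) (ξ z)) (pt (ext p) (ξ (j + 1 : ℕ))) (w (j + 1))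
      rw [dist_comm (pt w z) (pt (ext p) (ξ z))] at this
      linarith
  choose! f g h₁ h₂ h₃ using hex
  have hI : ∀ j ∈ J.erase j₀, f j ∈ Set.Icc 0 y ∧ g j ∈ Set.Icc 0 y := by
    intro j hj
    have hj0 : (0 : ℝ) ≤ j := Nat.cast_nonneg _
    have := h₁ j hj
    have := hlt j hj
    exact ⟨⟨by linarith, by linarith⟩, ⟨by linarith, by linarith⟩⟩
  have main := hp.card_mul_le hn (x := ext p (a i)) (ρ := 5 / 4 * L) (h := L / 4) (by linarith)
    (by linarith) (J.erase j₀) (fun j => ξ (f j)) (fun j => ξ (g j))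
    (fun j hj => (hξ' _ (hI j hj).1).1.1)
    (fun j hj => hξ (hI j hj).1 (hI j hj).2 (h₁ j hj).2.1)
    (fun j hj => (hξ' _ (hI j hj).2).1.2.trans hun)
    (fun j hj j' hj' hjj => hξ (hI j hj).2 (hI j' hj').1 (by
      have h5 : ((j + 1 : ℕ) : ℝ) ≤ j' := Nat.cast_le.2 hjj
      push_cast at h5
      linarith [(h₁ j hj).2.2, (h₁ j' hj').1])) h₂ h₃
  have h6 : ((J.erase j₀).card : ℝ) * (L / 4) ≤ 6 * c * (L / 4) := by linarith
  have h7 := le_of_mul_le_mul_right h6 (by linarith)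
  have h8 : (J.card : ℝ) = (J.erase j₀).card + 1 := by
    rw [← Finset.card_erase_add_one (J.max'_mem hJne)]; push_cast; rfl
  linarith

/-- If one of the curves is packed, simplification leaves few reachable cells. -/
theorem card_reachableCells_le (hp : IsPacked c p) (hn : 1 ≤ n) (hc : 1 ≤ c) (hμ : 0 < μ)
    (hr : 0 ≤ r) {b : ℕ → ℕ} (hv : IsSimplification (ext p) n K a μ)
    (hw : IsSimplification w m M b μ) {κ : ℝ} (hκ : r + μ ≤ κ * μ) :
    ((reachableCells (fun k => ext p (a k)) (fun k => w (b k)) r K M).card : ℝ) ≤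
      c * (18 * κ + 8) * (K + M) := by
  have hκ0 : 0 ≤ κ := by
    by_contra hneg
    push Not at hneg
    nlinarith
  set v' : ℕ → EuclideanSpace ℝ (Fin d) := fun k => ext p (a k) with hv'
  set w' : ℕ → EuclideanSpace ℝ (Fin d) := fun k => w (b k) with hw'
  set QA : ℕ → ℕ → Prop := fun i j => j + 1 < M ∧ CellReachable v' w' r i j ∧ i + 1 < K ∧
    dist (w' j) (w' (j + 1)) ≤ max (dist (v' i) (v' (i + 1))) (8 * (r + μ)) with hQA
  set QB : ℕ → ℕ → Prop := fun i j => CellReachable v' w' r i j ∧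
    max (dist (v' i) (v' (i + 1))) (8 * (r + μ)) < dist (w' j) (w' (j + 1)) with hQB
  -- The last edge of a simplification may be short, so the last row and column are counted
  -- separately; they have only `K + M` cells altogether.
  have hsub : reachableCells v' w' r K M ⊆ cellsWith K M (fun i _ => i + 1 = K) ∪
      cellsWith K M (fun _ j => j + 1 = M) ∪ cellsWith K M QA ∪ cellsWith K M QB := by
    rintro ⟨i, j⟩ hij
    rw [mem_reachableCells] at hij
    obtain ⟨⟨hi, hj⟩, hcell⟩ := hij
    simp only [Finset.mem_union, mem_cellsWith]
    by_cases h1 : i + 1 = K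
    · exact .inl (.inl (.inl ⟨⟨hi, hj⟩, h1⟩))
    by_cases h2 : j + 1 = M
    · exact .inl (.inl (.inr ⟨⟨hi, hj⟩, h2⟩))
    rcases le_or_gt (dist (w' j) (w' (j + 1))) (max (dist (v' i) (v' (i + 1))) (8 * (r + μ)))
      with h3 | h3
    · exact .inl (.inr ⟨⟨hi, hj⟩, by omega, hcell, by omega, h3⟩)
    · exact .inr ⟨⟨hi, hj⟩, hcell, h3⟩
  have c1 : ((cellsWith K M (fun i _ => i + 1 = K)).card : ℝ) ≤ M * 1 :=
    card_cellsWith_le K M _ 1 fun j _ J hJ => by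
      norm_cast
      refine Finset.card_le_one.2 fun i hi i' hi' => ?_
      have h1 := (hJ i hi).2
      have h2 := (hJ i' hi').2
      omega
  have c2 : ((cellsWith K M (fun _ j => j + 1 = M)).card : ℝ) ≤ K * 1 :=
    card_cellsWith_le' K M _ 1 fun j _ J hJ => by
      norm_cast
      refine Finset.card_le_one.2 fun i hi i' hi' => ?_
      have h1 := (hJ i hi).2
      have h2 := (hJ i' hi').2
      omega
  have c3 : ((cellsWith K M QA).card : ℝ) ≤ M * (c * (18 * κ + 4)) := by
    refine card_cellsWith_le K M QA _ fun j _ J hJ => ?_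
    rcases J.eq_empty_or_nonempty with rfl | ⟨i, hi⟩
    · simp only [Finset.card_empty, Nat.cast_zero]
      positivity
    · exact card_long_edges_le (w := w') hp hn (by linarith) hμ hr hv hκ j (hw.far j (hJ i hi).2.1) J
        fun i hi => ⟨(hJ i hi).1, (hJ i hi).2.2⟩
  have c4 : ((cellsWith K M QB).card : ℝ) ≤ K * (6 * c + 1) :=
    card_cellsWith_le' K M QB _ fun i hi J hJ =>
      card_short_edges_le (w := w') hp hn (by linarith) hμ hr hv i hi J fun j hj => (hJ j hj).2
  have h1 := (Finset.card_le_card hsub).trans ((Finset.card_union_le _ _).trans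
    (Nat.add_le_add_right ((Finset.card_union_le _ _).trans
      (Nat.add_le_add_right (Finset.card_union_le _ _) _)) _))
  have h2 : ((reachableCells v' w' r K M).card : ℝ) ≤
      M * 1 + K * 1 + M * (c * (18 * κ + 4)) + K * (6 * c + 1) := by
    have h1' := Nat.cast_le (α := ℝ).2 h1
    push_cast at h1'
    linarith
  refine h2.trans ?_
  have h3 : (1 + c * (18 * κ + 4)) * (M : ℝ) ≤ c * (18 * κ + 8) * M := by
    gcongr
    linarith
  have h4 : (1 + (6 * c + 1)) * (K : ℝ) ≤ c * (18 * κ + 8) * K := by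
    gcongr
    linarith [mul_nonneg (by linarith : (0 : ℝ) ≤ c) hκ0]
  linarith

end Count

end PolygonalCurve

/-! ### Exploration of the free space, cell by cell -/

namespace PolygonalCurve

/-! ### Reachable intervals on the sides of a cell -/

section Sides

variable {E : Type*} [NormedAddCommGroup E] [NormedSpace ℝ E]

/-- `[lo, hi]` (empty if `hi < lo`) represents the reachable part of the left side of the cell
`(i, j)`. On the left side of the whole free space only the start has to be represented. -/
structure LeftRep (v w : ℕ → E) (r : ℝ) (i j : ℕ) (lo hi : ℝ) : Prop where
  nonneg : lo ≤ hi → 0 ≤ lo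
  le_one : lo ≤ hi → hi ≤ 1
  sound : ∀ y, lo ≤ y → y ≤ hi → Reachable v w r i (j + y)
  complete : 1 ≤ i → ∀ y, 0 ≤ y → y ≤ 1 → Reachable v w r i (j + y) → lo ≤ y ∧ y ≤ hi
  start : i = 0 → j = 0 → Reachable v w r 0 0 → lo ≤ 0 ∧ 0 ≤ hi

/-- `[lo, hi]` (empty if `hi < lo`) represents the reachable part of the lower side of the cell
`(i, j)`. On the lower side of the whole free space nothing has to be represented. -/
structure BottomRep (v w : ℕ → E) (r : ℝ) (i j : ℕ) (lo hi : ℝ) : Prop where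
  nonneg : lo ≤ hi → 0 ≤ lo
  le_one : lo ≤ hi → hi ≤ 1
  sound : ∀ x, lo ≤ x → x ≤ hi → Reachable v w r (i + x) j
  complete : 1 ≤ j → ∀ x, 0 ≤ x → x ≤ 1 → Reachable v w r (i + x) j → lo ≤ x ∧ x ≤ hi

/-- What is known about the left and the lower side of a cell determines the reachable part of it. -/
structure Adequate (v w : ℕ → E) (r : ℝ) (i j : ℕ) (llo lhi blo bhi : ℝ) : Prop where
  left_nonneg : llo ≤ lhi → 0 ≤ llo
  left_le_one : llo ≤ lhi → lhi ≤ 1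
  left_sound : ∀ y, llo ≤ y → y ≤ lhi → Reachable v w r i (j + y)
  left_complete : ∀ y, 0 ≤ y → y ≤ 1 → Reachable v w r i (j + y) →
    llo ≤ lhi ∧ llo ≤ y ∨ blo ≤ bhi ∧ blo ≤ 0
  bottom_nonneg : blo ≤ bhi → 0 ≤ blo
  bottom_le_one : blo ≤ bhi → bhi ≤ 1
  bottom_sound : ∀ x, blo ≤ x → x ≤ bhi → Reachable v w r (i + x) j
  bottom_complete : ∀ x, 0 ≤ x → x ≤ 1 → Reachable v w r (i + x) j →
    blo ≤ bhi ∧ blo ≤ x ∨ llo ≤ lhi ∧ llo ≤ 0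

/-- `[lo, hi]` is the set of the parameters in `[0, 1]` of points of the segment from `a` to `b` at
distance at most `r` from `p`. -/
structure IsFreeInterval (p a b : E) (r lo hi : ℝ) : Prop where
  nonneg : lo ≤ hi → 0 ≤ lo
  le_one : lo ≤ hi → hi ≤ 1
  iff : ∀ s, 0 ≤ s → s ≤ 1 → (dist p (a + s • (b - a)) ≤ r ↔ lo ≤ s ∧ s ≤ hi)

variable {v w : ℕ → E} {r : ℝ} {i j : ℕ} {llo lhi blo bhi lo hi : ℝ}

theorem Reachable.natCast_left_of_bottom {x : ℝ} (hx : 0 ≤ x) (h : Reachable v w r (i + x) 0) :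
    Reachable v w r i 0 :=
  let ⟨_, h⟩ := h; h.natCast_zero rfl i (by linarith)

theorem Reachable.natCast_bottom_of_left {y : ℝ} (hy : 0 ≤ y) (h : Reachable v w r 0 (j + y)) :
    Reachable v w r 0 j := (h.symm.natCast_left_of_bottom hy).symm

/-- Nothing is stored for the border of the free space beyond the start. If a point of a border side
is reachable, then so is the corner nearer to the start, and this corner is recorded on the other
side of the cell. -/
theorem LeftRep.adequate (hL : LeftRep v w r i j llo lhi) (hB : BottomRep v w r i j blo bhi) :
    Adequate v w r i j llo lhi blo bhi where
  left_nonneg := hL.nonneg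
  left_le_one := hL.le_one
  left_sound := hL.sound
  left_complete y hy hy' h := by
    rcases Nat.eq_zero_or_pos i with rfl | hi
    · have h0 : Reachable v w r 0 j := Reachable.natCast_bottom_of_left hy (by simpa using h)
      rcases Nat.eq_zero_or_pos j with rfl | hj
      · have := hL.start rfl rfl (by simpa using h0)
        exact .inl ⟨this.1.trans this.2, by linarith⟩
      · have := hB.complete hj 0 le_rfl zero_le_one (by simpa using h0)
        exact .inr ⟨this.1.trans this.2, this.1⟩
    · have := hL.complete hi y hy hy' h
      exact .inl ⟨this.1.trans this.2, this.1⟩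
  bottom_nonneg := hB.nonneg
  bottom_le_one := hB.le_one
  bottom_sound := hB.sound
  bottom_complete x hx hx' h := by
    rcases Nat.eq_zero_or_pos j with rfl | hj
    · have h0 : Reachable v w r i 0 := Reachable.natCast_left_of_bottom hx (by simpa using h)
      rcases Nat.eq_zero_or_pos i with rfl | hi
      · have := hL.start rfl rfl (by simpa using h0)
        exact .inr ⟨this.1.trans this.2, this.1⟩
      · have := hL.complete hi 0 le_rfl zero_le_one (by simpa using h0)
        exact .inr ⟨this.1.trans this.2, this.1⟩
    · have := hB.complete hj x hx hx' h
      exact .inl ⟨this.1.trans this.2, this.1⟩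

namespace Adequate

theorem symm (h : Adequate v w r i j llo lhi blo bhi) : Adequate w v r j i blo bhi llo lhi :=
  ⟨h.bottom_nonneg, h.bottom_le_one, fun x h₁ h₂ => (h.bottom_sound x h₁ h₂).symm,
    fun x h₁ h₂ h₃ => h.bottom_complete x h₁ h₂ h₃.symm,
    h.left_nonneg, h.left_le_one, fun x h₁ h₂ => (h.left_sound x h₁ h₂).symm,
    fun x h₁ h₂ h₃ => h.left_complete x h₁ h₂ h₃.symm⟩

/-- A chain enters the cell through its lower or left side, and by convexity a single step leads on
from the entry point. From the lower side every free point of the right side can be reached; from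
the left side monotonicity requires height at least `llo`. -/
theorem right_iff (h : Adequate v w r i j llo lhi blo bhi) {y : ℝ} (hy : 0 ≤ y) (hy' : y ≤ 1) :
    Reachable v w r ((i + 1 : ℕ) : ℝ) (j + y) ↔
      dist (v (i + 1)) (w j + y • (w (j + 1) - w j)) ≤ r ∧
        (blo ≤ bhi ∨ llo ≤ lhi ∧ llo ≤ y) := by
  have hd : dist (pt v ((i + 1 : ℕ) : ℝ)) (pt w (j + y)) =
      dist (v (i + 1)) (w j + y • (w (j + 1) - w j)) := by
    rw [pt_natCast, pt_add w hy hy']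
  constructor
  · intro hr
    refine ⟨hd ▸ hr.dist_le, ?_⟩
    obtain ⟨k, hr⟩ := hr
    rcases hr.entry i j (by simp) (by simp) (by linarith) (by linarith) with
      ⟨x, h1, h2, h3⟩ | ⟨z, h1, h2, h3⟩
    · push_cast at h2
      rcases h.bottom_complete (x - i) (by linarith) (by linarith) (by simpa using h3) with h4 | h4
      · exact .inl h4.1
      · exact .inr ⟨h4.1, h4.2.trans hy⟩
    · rcases h.left_complete (z - j) (by linarith) (by linarith) (by simpa using h3) with h4 | h4
      · exact .inr ⟨h4.1, by linarith [h4.2]⟩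
      · exact .inl h4.1
  · rintro ⟨h1, h2 | ⟨h2, h3⟩⟩
    · have h4 := h.bottom_sound blo le_rfl h2
      have h5 := h.bottom_nonneg h2
      have h6 := h.bottom_le_one h2
      exact h4.step i j (by linarith) (by push_cast; linarith) (by simp) le_rfl (by linarith)
        (by linarith) (hd ▸ h1)
    · have h4 := h.left_sound llo le_rfl h2
      have h5 := h.left_nonneg h2
      exact h4.step i j le_rfl (by simp) (by simp) (by linarith) (by linarith)
        (by linarith) (hd ▸ h1)

theorem cellReachable_iff (h : Adequate v w r i j llo lhi blo bhi) :
    CellReachable v w r i j ↔ llo ≤ lhi ∨ blo ≤ bhi := by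
  constructor
  · rintro ⟨x, y, hx, hy, k, hr⟩
    rcases hr.entry i j hx.1 hx.2 hy.1 hy.2 with ⟨x, h1, h2, h3⟩ | ⟨z, h1, h2, h3⟩
    · rcases h.bottom_complete (x - i) (by linarith) (by linarith) (by simpa using h3) with h4 | h4
      · exact .inr h4.1
      · exact .inl h4.1
    · rcases h.left_complete (z - j) (by linarith) (by linarith) (by simpa using h3) with h4 | h4
      · exact .inl h4.1
      · exact .inr h4.1
  · rintro (h1 | h1)
    · exact ⟨_, _, ⟨le_rfl, by simp⟩, ⟨by linarith [h.left_nonneg h1], by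
        linarith [h.left_le_one h1]⟩, h.left_sound llo le_rfl h1⟩
    · exact ⟨_, _, ⟨by linarith [h.bottom_nonneg h1], by linarith [h.bottom_le_one h1]⟩,
        ⟨le_rfl, by simp⟩, h.bottom_sound blo le_rfl h1⟩

theorem leftRep_succ (h : Adequate v w r i j llo lhi blo bhi) (hne : llo ≤ lhi ∨ blo ≤ bhi)
    (hf : IsFreeInterval (v (i + 1)) (w j) (w (j + 1)) r lo hi) {lo' : ℝ}
    (hlo : blo ≤ bhi → lo' = lo) (hlo' : ¬ blo ≤ bhi → lo' = max lo llo) :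
    LeftRep v w r (i + 1) j lo' hi := by
  have hle : lo ≤ lo' := by
    by_cases hb : blo ≤ bhi
    · exact (hlo hb).ge
    · rw [hlo' hb]; exact le_max_left _ _
  have hiff : ∀ y, 0 ≤ y → y ≤ 1 →
      (Reachable v w r ((i + 1 : ℕ) : ℝ) (j + y) ↔ lo' ≤ y ∧ y ≤ hi) := by
    intro y hy hy'
    rw [h.right_iff hy hy', hf.iff y hy hy']
    by_cases hb : blo ≤ bhi
    · simp [hb, hlo hb]
    · have hl := hne.resolve_right hb
      simp only [hb, hl, hlo' hb, max_le_iff, true_and, false_or]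
      tauto
  refine ⟨fun h1 => (hf.nonneg (hle.trans h1)).trans hle, fun h1 => hf.le_one (hle.trans h1),
    fun y h1 h2 => ?_, fun _ y hy hy' => (hiff y hy hy').1, fun h1 => by omega⟩
  have h3 : lo ≤ hi := hle.trans (h1.trans h2)
  exact (hiff y ((hf.nonneg h3).trans (hle.trans h1)) (h2.trans (hf.le_one h3))).2 ⟨h1, h2⟩

theorem bottomRep_succ (h : Adequate v w r i j llo lhi blo bhi) (hne : llo ≤ lhi ∨ blo ≤ bhi)
    (hf : IsFreeInterval (w (j + 1)) (v i) (v (i + 1)) r lo hi) {lo' : ℝ}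
    (hlo : llo ≤ lhi → lo' = lo) (hlo' : ¬ llo ≤ lhi → lo' = max lo blo) :
    BottomRep v w r i (j + 1) lo' hi := by
  have := h.symm.leftRep_succ hne.symm hf hlo hlo'
  exact ⟨this.nonneg, this.le_one, fun x h1 h2 => (this.sound x h1 h2).symm,
    fun _ x h1 h2 h3 => this.complete (by omega) x h1 h2 h3.symm⟩

end Adequate

/-- Every reachable cell except the first shares a reachable point with the cell below or to the
left. This is the induction step for showing that skipped cells are unreachable. -/
theorem CellReachable.cases (h : CellReachable v w r i j) :
    (1 ≤ j ∧ ∃ x, 0 ≤ x ∧ x ≤ 1 ∧ Reachable v w r (i + x) j) ∨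
      (1 ≤ i ∧ ∃ y, 0 ≤ y ∧ y ≤ 1 ∧ Reachable v w r i (j + y)) ∨
      (i = 0 ∧ j = 0 ∧ Reachable v w r 0 0) := by
  obtain ⟨x, y, hx, hy, k, hr⟩ := h
  have key : (∃ x, 0 ≤ x ∧ x ≤ 1 ∧ Reachable v w r (i + x) j) ∨
      ∃ y, 0 ≤ y ∧ y ≤ 1 ∧ Reachable v w r i (j + y) := by
    rcases hr.entry i j hx.1 hx.2 hy.1 hy.2 with ⟨x, h1, h2, h3⟩ | ⟨z, h1, h2, h3⟩
    · exact .inl ⟨x - i, by linarith, by linarith, by simpa using h3⟩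
    · exact .inr ⟨z - j, by linarith, by linarith, by simpa using h3⟩
  rcases Nat.eq_zero_or_pos i with rfl | hi <;> rcases Nat.eq_zero_or_pos j with rfl | hj
  · refine .inr (.inr ⟨rfl, rfl, ?_⟩)
    rcases key with ⟨x, h1, h2, h3⟩ | ⟨y, h1, h2, h3⟩
    · simpa using Reachable.natCast_left_of_bottom (i := 0) h1 (by simpa using h3)
    · simpa using Reachable.natCast_bottom_of_left (j := 0) h1 (by simpa using h3)
  · rcases key with h | ⟨y, h1, h2, h3⟩
    · exact .inl ⟨hj, h⟩
    · exact .inl ⟨hj, 0, le_rfl, zero_le_one, by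
        simpa using Reachable.natCast_bottom_of_left h1 (by simpa using h3)⟩
  · rcases key with ⟨x, h1, h2, h3⟩ | h
    · exact .inr (.inl ⟨hi, 0, le_rfl, zero_le_one, by
        simpa using Reachable.natCast_left_of_bottom h1 (by simpa using h3)⟩)
    · exact .inr (.inl ⟨hi, h⟩)
  · rcases key with h | h
    · exact .inl ⟨hj, h⟩
    · exact .inr (.inl ⟨hi, h⟩)

end Sides

/-! ### Invariant of the row-wise exploration -/

section Exploration

variable {E : Type*} [NormedAddCommGroup E] [NormedSpace ℝ E]

theorem key_inj {K i j i' j' : ℕ} (hi : i < K) (hi' : i' < K) (h : j * K + i = j' * K + i') :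
    i = i' ∧ j = j' := by
  have h1 := congrArg (· % K) h
  simp only [Nat.mul_add_mod_self_right, Nat.mod_eq_of_lt hi, Nat.mod_eq_of_lt hi'] at h1
  subst h1
  exact ⟨rfl, Nat.eq_of_mul_eq_mul_right (by omega) (Nat.add_right_cancel h)⟩

/-- The state of the exploration of the free space of curves with `K` and `M` edges before the cell
`(i, j)` with the key `c = j * K + i`. Cells are explored in the order of their keys. The interval
`[llo, lhi]` represents the left side of the cell `(i, j)`. The entries `q < T` of the queue describe
the cells `(qi q, qj q)`, with key `qk q`, whose lower side is known to have a nonempty reachable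
part `[qlo q, qhi q]`; those with `q < k` have been dealt with. The flag `ans` is `1` if the end of
the free space has been reached. -/
structure Exploration (v w : ℕ → E) (r : ℝ) (K M c i j k T : ℕ) (llo lhi : ℝ) (qk qi qj : ℕ → ℕ)
    (qlo qhi : ℕ → ℝ) (ans : ℕ) : Prop where
  key : c = j * K + i
  i_lt : i < K
  j_le : j ≤ M
  left : LeftRep v w r i j llo lhi
  left_end : j = M → ¬ llo ≤ lhi
  item_key : ∀ q < T, qk q = qj q * K + qi q
  item_i : ∀ q < T, qi q < K
  item_j : ∀ q < T, 1 ≤ qj q ∧ qj q < M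
  item_ne : ∀ q < T, qlo q ≤ qhi q
  item_rep : ∀ q < T, BottomRep v w r (qi q) (qj q) (qlo q) (qhi q)
  sorted : ∀ q q', q < q' → q' < T → qk q < qk q'
  below : ∀ q < T, qk q < c + K
  head_le : k ≤ T
  head_lt : ∀ q < k, qk q < c
  le_head : ∀ q, k ≤ q → q < T → c ≤ qk q
  complete : ∀ i' j', i' < K → j' + 1 < M → j' * K + i' < c →
    (∃ x, 0 ≤ x ∧ x ≤ 1 ∧ Reachable v w r (i' + x) ((j' + 1 : ℕ) : ℝ)) →
    ∃ q < T, qk q = (j' + 1) * K + i'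
  ans_le : ans ≤ 1
  ans_sound : ans = 1 → Reachable v w r K M
  ans_complete : K * M ≤ c → Reachable v w r K M → ans = 1

namespace Exploration

variable {v w : ℕ → E} {r : ℝ} {K M c i j k T : ℕ} {llo lhi : ℝ} {qk qi qj : ℕ → ℕ}
    {qlo qhi : ℕ → ℝ} {ans : ℕ}

theorem init (hK : 1 ≤ K) (hM : 1 ≤ M) (qk qi qj : ℕ → ℕ) (qlo qhi : ℕ → ℝ) {llo lhi : ℝ}
    (h : dist (v 0) (w 0) ≤ r → llo = 0 ∧ lhi = 0) (h' : ¬ dist (v 0) (w 0) ≤ r → lhi < llo) :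
    Exploration v w r K M 0 0 0 0 0 llo lhi qk qi qj qlo qhi 0 where
  key := by simp
  i_lt := hK
  j_le := by omega
  left := by
    by_cases hd : dist (v 0) (w 0) ≤ r
    · obtain ⟨rfl, rfl⟩ := h hd
      refine ⟨fun _ => le_rfl, fun _ => zero_le_one, fun y h1 h2 => ?_, fun h => by omega,
        fun _ _ _ => ⟨le_rfl, le_rfl⟩⟩
      obtain rfl : y = 0 := le_antisymm h2 h1
      exact ⟨0, by simpa using .start hd⟩
    · have hlt := h' hd
      exact ⟨fun h => by linarith, fun h => by linarith, fun y h1 h2 => by linarith,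
        fun h => by omega, fun _ _ h => absurd (by simpa using h.dist_le) hd⟩
  left_end := by omega
  item_key := by simp
  item_i := by simp
  item_j := by simp
  item_ne := by simp
  item_rep := by simp
  sorted := by simp
  below := by simp
  head_le := le_rfl
  head_lt := by simp
  le_head := by simp
  complete := by simp
  ans_le := by omega
  ans_sound := by simp
  ans_complete h := by have := Nat.mul_pos hK hM; omega

/-- If the left side of the current cell cannot be reached, nothing can be reached before the next
cell in the queue. -/
theorem not_cellReachable (h : Exploration v w r K M c i j k T llo lhi qk qi qj qlo qhi ans)
    (hl : ¬ llo ≤ lhi) {c₁ : ℕ} (hc : ∀ q, k ≤ q → q < T → c₁ ≤ qk q) :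
    ∀ c' i' j', c' = j' * K + i' → i' < K → j' < M → c ≤ c' → c' < c₁ →
      ¬ CellReachable v w r i' j' := by
  intro c'
  induction c' using Nat.strong_induction_on with
  | _ c' ih =>
    intro i' j' hc' hi' hj' hcc hcc₁ hr
    rcases hr.cases with ⟨hj1, x, hx, hx', h1⟩ | ⟨hi1, y, hy, hy', h1⟩ | ⟨rfl, rfl, h1⟩
    · obtain ⟨j₀, rfl⟩ : ∃ j₀, j' = j₀ + 1 := ⟨j' - 1, by omega⟩
      have hK : (j₀ + 1) * K + i' = j₀ * K + i' + K := by ring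
      -- If the cell below has been explored, this cell is in the queue and its key is not in the
      -- gap. Otherwise the cell below lies in the gap itself and is unreachable by induction.
      by_cases hlt : j₀ * K + i' < c
      · obtain ⟨q, hq, hq'⟩ := h.complete i' j₀ hi' hj' hlt ⟨x, hx, hx', h1⟩
        rcases lt_or_ge q k with hqk | hqk
        · have := h.head_lt q hqk
          omega
        · have := hc q hqk hq
          omega
      · refine ih (j₀ * K + i') (by omega) i' j₀ rfl hi' (by omega) (by omega) (by omega)
          ⟨_, _, ⟨by linarith, by linarith⟩, ⟨by simp, by simp⟩, h1⟩
    · obtain ⟨i₀, rfl⟩ : ∃ i₀, i' = i₀ + 1 := ⟨i' - 1, by omega⟩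
      by_cases hlt : j' * K + i₀ < c
      · have : c = j' * K + (i₀ + 1) := by omega
        obtain ⟨rfl, rfl⟩ := key_inj h.i_lt hi' (h.key.symm.trans this)
        have := h.left.complete hi1 y hy hy' h1
        exact hl (this.1.trans this.2)
      · refine ih (j' * K + i₀) (by omega) i₀ j' rfl (by omega) hj' (by omega) (by omega)
          ⟨_, _, ⟨by simp, by simp⟩, ⟨by linarith, by linarith⟩, h1⟩
    · have : c = 0 * K + 0 := by omega
      obtain ⟨rfl, rfl⟩ := key_inj h.i_lt hi' (h.key.symm.trans this)
      have := h.left.start rfl rfl h1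
      exact hl (this.1.trans this.2)

/-- Going on with the next cell in the queue. -/
theorem jump (h : Exploration v w r K M c i j k T llo lhi qk qi qj qlo qhi ans)
    (hl : ¬ llo ≤ lhi) (hk : k < T) :
    Exploration v w r K M (qk k) (qi k) (qj k) k T llo lhi qk qi qj qlo qhi ans := by
  have hck : c ≤ qk k := h.le_head k le_rfl hk
  have hmin : ∀ q, k ≤ q → q < T → qk k ≤ qk q := by
    intro q hq hq'
    rcases hq.eq_or_lt with rfl | hlt
    · exact le_rfl
    · exact (h.sorted k q hlt hq').le
  have hskip := h.not_cellReachable hl hmin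
  have hj := h.item_j k hk
  refine ⟨h.item_key k hk, h.item_i k hk, hj.2.le, ?_, fun _ => hl, h.item_key, h.item_i, h.item_j,
    h.item_ne, h.item_rep, h.sorted, fun q hq => (h.below q hq).trans_le (by omega), h.head_le,
    fun q hq => (h.head_lt q hq).trans_le hck, hmin, ?_, h.ans_le, h.ans_sound, ?_⟩
  · refine ⟨fun h => absurd h hl, fun h => absurd h hl, fun y h1 h2 => absurd (h1.trans h2) hl, ?_,
      fun _ h0 => by omega⟩
    intro hi1 y hy hy' hr
    exfalso
    have hkey := h.item_key k hk
    have hi := h.item_i k hk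
    generalize qi k = i₁ at *
    obtain ⟨i₀, rfl⟩ : ∃ i₀, i₁ = i₀ + 1 := ⟨i₁ - 1, by omega⟩
    by_cases hlt : qj k * K + i₀ < c
    · have : c = qj k * K + (i₀ + 1) := by omega
      obtain ⟨rfl, rfl⟩ := key_inj h.i_lt hi (h.key.symm.trans this)
      have := h.left.complete hi1 y hy hy' hr
      exact hl (this.1.trans this.2)
    · exact hskip (qj k * K + i₀) i₀ (qj k) rfl (by omega) hj.2 (by omega) (by omega)
        ⟨_, _, ⟨by simp, by simp⟩, ⟨by linarith, by linarith⟩, hr⟩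
  · intro i' j' hi' hj' hlt hr
    by_cases hc : j' * K + i' < c
    · exact h.complete i' j' hi' hj' hc hr
    · obtain ⟨x, hx, hx', hr⟩ := hr
      exact absurd ⟨_, _, ⟨by linarith, by linarith⟩, ⟨by simp, by simp⟩, hr⟩
        (hskip _ i' j' rfl hi' (by omega) (by omega) hlt)
  · intro hle
    exfalso
    have h1 := h.item_key k hk
    have h2 := h.item_i k hk
    have h3 : (qj k + 1) * K ≤ M * K := Nat.mul_le_mul_right K hj.2
    have h4 : (qj k + 1) * K = qj k * K + K := by ring
    have h5 : K * M = M * K := Nat.mul_comm _ _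
    omega

/-- What the queue says about the lower side of the current cell. -/
theorem bottomRep (h : Exploration v w r K M c i j k T llo lhi qk qi qj qlo qhi ans) (hj : j < M)
    {blo bhi : ℝ} (h₁ : k < T ∧ qk k = c → blo = qlo k ∧ bhi = qhi k)
    (h₂ : ¬ (k < T ∧ qk k = c) → bhi < blo) : BottomRep v w r i j blo bhi := by
  by_cases hm : k < T ∧ qk k = c
  · obtain ⟨rfl, rfl⟩ := h₁ hm
    have h3 := h.item_key k hm.1
    have h4 := h.item_rep k hm.1
    obtain ⟨rfl, rfl⟩ := key_inj h.i_lt (h.item_i k hm.1) (h.key.symm.trans (hm.2.symm.trans h3))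
    exact h4
  · have hlt := h₂ hm
    refine ⟨fun h => by linarith, fun h => by linarith, fun x h1 h2 => by linarith, ?_⟩
    intro hj1 x hx hx' hr
    exfalso
    obtain ⟨j₀, rfl⟩ : ∃ j₀, j = j₀ + 1 := ⟨j - 1, by omega⟩
    have hkey := h.key
    have hK : (j₀ + 1) * K + i = j₀ * K + i + K := by ring
    have := h.i_lt
    -- The cell below has been explored, so a reachable lower side would have produced an entry with
    -- key `c`. Since the queue is sorted, this entry would be its head.
    obtain ⟨q, hq, hq'⟩ := h.complete i j₀ h.i_lt hj (by omega) ⟨x, hx, hx', hr⟩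
    have hqk : k ≤ q := by
      by_contra hlt'
      have := h.head_lt q (by omega)
      omega
    have hkT : k < T := by omega
    have h5 := h.le_head k le_rfl hkT
    have h6 : qk k ≤ qk q := by
      rcases hqk.eq_or_lt with rfl | hlt'
      · exact le_rfl
      · exact (h.sorted k q hlt' hq).le
    exact hm ⟨hkT, by omega⟩

/-- Exploring the current cell. -/
theorem next (h : Exploration v w r K M c i j k T llo lhi qk qi qj qlo qhi ans) (hj : j < M)
    {rlo rhi tlo thi : ℝ} (hR : LeftRep v w r (i + 1) j rlo rhi)
    (hT : BottomRep v w r i (j + 1) tlo thi)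
    {c' i' j' k' T' ans' : ℕ} {llo' lhi' : ℝ} {qk' qi' qj' : ℕ → ℕ} {qlo' qhi' : ℕ → ℝ}
    (hc' : c' = c + 1)
    (hk' : k < T ∧ qk k = c → k' = k + 1) (hk'' : ¬ (k < T ∧ qk k = c) → k' = k)
    (hpush : tlo ≤ thi ∧ j + 2 ≤ M → T' = T + 1 ∧ qk' = Function.update qk T (c + K) ∧
      qi' = Function.update qi T i ∧ qj' = Function.update qj T (j + 1) ∧
      qlo' = Function.update qlo T tlo ∧ qhi' = Function.update qhi T thi)
    (hpush' : ¬ (tlo ≤ thi ∧ j + 2 ≤ M) → T' = T ∧ qk' = qk ∧ qi' = qi ∧ qj' = qj ∧ qlo' = qlo ∧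
      qhi' = qhi)
    (hin : i + 2 ≤ K → i' = i + 1 ∧ j' = j ∧ llo' = rlo ∧ lhi' = rhi ∧ ans' = ans)
    (hend : ¬ i + 2 ≤ K → i' = 0 ∧ j' = j + 1 ∧ lhi' < llo' ∧
      (M ≤ j + 1 ∧ rlo ≤ 1 ∧ 1 ≤ rhi → ans' = 1) ∧
      (¬ (M ≤ j + 1 ∧ rlo ≤ 1 ∧ 1 ≤ rhi) → ans' = ans)) :
    Exploration v w r K M c' i' j' k' T' llo' lhi' qk' qi' qj' qlo' qhi' ans' := by
  have hkey := h.key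
  have hiK := h.i_lt
  have hold : ∀ q < T, qk' q = qk q ∧ qi' q = qi q ∧ qj' q = qj q ∧ qlo' q = qlo q ∧
      qhi' q = qhi q := by
    intro q hq
    by_cases hp : tlo ≤ thi ∧ j + 2 ≤ M
    · obtain ⟨-, rfl, rfl, rfl, rfl, rfl⟩ := hpush hp
      simp [Function.update_of_ne (show q ≠ T by omega)]
    · obtain ⟨-, rfl, rfl, rfl, rfl, rfl⟩ := hpush' hp
      simp
  have hTT : T ≤ T' := by
    by_cases hp : tlo ≤ thi ∧ j + 2 ≤ M
    · have := (hpush hp).1; omega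
    · have := (hpush' hp).1; omega
  have hnew : ∀ q < T', q < T ∨ (tlo ≤ thi ∧ j + 2 ≤ M) ∧ q = T ∧ qk' q = c + K ∧ qi' q = i ∧
      qj' q = j + 1 ∧ qlo' q = tlo ∧ qhi' q = thi := by
    intro q hq
    by_cases hp : tlo ≤ thi ∧ j + 2 ≤ M
    · obtain ⟨rfl, rfl, rfl, rfl, rfl, rfl⟩ := hpush hp
      rcases Nat.lt_succ_iff_lt_or_eq.1 hq with hlt | rfl
      · exact .inl hlt
      · exact .inr ⟨hp, by simp⟩
    · exact .inl ((hpush' hp).1 ▸ hq)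
  have hcase : (i + 2 ≤ K ∧ i' = i + 1 ∧ j' = j) ∨ (i + 1 = K ∧ i' = 0 ∧ j' = j + 1) := by
    by_cases hi2 : i + 2 ≤ K
    · exact .inl ⟨hi2, (hin hi2).1, (hin hi2).2.1⟩
    · exact .inr ⟨by omega, (hend hi2).1, (hend hi2).2.1⟩
  have hK1 : (j + 1) * K = j * K + K := by ring
  have hkey' : c' = j' * K + i' := by
    rcases hcase with ⟨h3, rfl, rfl⟩ | ⟨h3, rfl, rfl⟩ <;> omega
  have hsound : ∀ (h3 : ¬ i + 2 ≤ K), M ≤ j + 1 →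
      (Reachable v w r K M ↔ rlo ≤ 1 ∧ 1 ≤ rhi) := by
    intro h3 h4
    obtain rfl : K = i + 1 := by omega
    obtain rfl : M = j + 1 := by omega
    constructor
    · intro hr
      exact hR.complete (by omega) 1 zero_le_one le_rfl (by push_cast at hr ⊢; exact hr)
    · intro hr
      have := hR.sound 1 hr.1 hr.2
      push_cast at this ⊢
      exact this
  refine
    { key := hkey'
      i_lt := by rcases hcase with ⟨h3, rfl, rfl⟩ | ⟨h3, rfl, rfl⟩ <;> omega
      j_le := by rcases hcase with ⟨h3, rfl, rfl⟩ | ⟨h3, rfl, rfl⟩ <;> omega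
      left := ?_
      left_end := ?_
      item_key := ?_
      item_i := ?_
      item_j := ?_
      item_ne := ?_
      item_rep := ?_
      sorted := ?_
      below := ?_
      head_le := ?_
      head_lt := ?_
      le_head := ?_
      complete := ?_
      ans_le := ?_
      ans_sound := ?_
      ans_complete := ?_ }
  · by_cases hi2 : i + 2 ≤ K
    · obtain ⟨rfl, rfl, rfl, rfl, -⟩ := hin hi2
      exact hR
    · obtain ⟨rfl, rfl, hlt, -⟩ := hend hi2
      exact ⟨fun h => by linarith, fun h => by linarith, fun y h1 h2 => by linarith,
        fun h => by omega, fun _ h0 => by omega⟩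
  · intro hjM
    rcases hcase with ⟨h3, rfl, rfl⟩ | ⟨h3, rfl, rfl⟩
    · omega
    · have := (hend (by omega)).2.2.1
      exact not_le.2 this
  · intro q hq
    rcases hnew q hq with hlt | ⟨-, rfl, e1, e2, e3, -, -⟩
    · obtain ⟨e1, e2, e3, -, -⟩ := hold q hlt
      rw [e1, e2, e3]; exact h.item_key q hlt
    · rw [e1, e2, e3]; omega
  · intro q hq
    rcases hnew q hq with hlt | ⟨-, rfl, e1, e2, e3, -, -⟩
    · obtain ⟨e1, e2, e3, -, -⟩ := hold q hlt
      rw [e2]; exact h.item_i q hlt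
    · rw [e2]; exact hiK
  · intro q hq
    rcases hnew q hq with hlt | ⟨hp, rfl, e1, e2, e3, -, -⟩
    · obtain ⟨e1, e2, e3, -, -⟩ := hold q hlt
      rw [e3]; exact h.item_j q hlt
    · rw [e3]; omega
  · intro q hq
    rcases hnew q hq with hlt | ⟨hp, rfl, -, -, -, e4, e5⟩
    · obtain ⟨-, -, -, e4, e5⟩ := hold q hlt
      rw [e4, e5]; exact h.item_ne q hlt
    · rw [e4, e5]; exact hp.1
  · intro q hq
    rcases hnew q hq with hlt | ⟨hp, rfl, e1, e2, e3, e4, e5⟩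
    · obtain ⟨e1, e2, e3, e4, e5⟩ := hold q hlt
      rw [e2, e3, e4, e5]; exact h.item_rep q hlt
    · rw [e2, e3, e4, e5]; exact hT
  · intro q q' hqq hq'
    rcases hnew q' hq' with hlt | ⟨hp, rfl, e1, -⟩
    · rw [(hold q (by omega)).1, (hold q' hlt).1]
      exact h.sorted q q' hqq hlt
    -- The new key `c + K` exceeds all keys in the queue, so appending keeps it sorted.
    · rw [e1, (hold q hqq).1]
      exact h.below q hqq
  · intro q hq
    rcases hnew q hq with hlt | ⟨hp, rfl, e1, -⟩
    · rw [(hold q hlt).1]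
      have := h.below q hlt
      omega
    · rw [e1]; omega
  · by_cases hm : k < T ∧ qk k = c
    · rw [hk' hm]; omega
    · rw [hk'' hm]; exact h.head_le.trans hTT
  · intro q hq
    have hhead := h.head_le
    by_cases hm : k < T ∧ qk k = c
    · rw [hk' hm] at hq
      rw [(hold q (by omega)).1]
      rcases Nat.lt_succ_iff_lt_or_eq.1 hq with hlt | rfl
      · have := h.head_lt q hlt
        omega
      · omega
    · rw [hk'' hm] at hq
      rw [(hold q (by omega)).1]
      have := h.head_lt q hq
      omega
  · intro q hkq hq
    rcases hnew q hq with hlt | ⟨hp, rfl, e1, -⟩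
    · rw [(hold q hlt).1]
      by_cases hm : k < T ∧ qk k = c
      · rw [hk' hm] at hkq
        have := h.sorted k q hkq hlt
        omega
      · rw [hk'' hm] at hkq
        have h5 := h.le_head q hkq hlt
        have h6 : qk k ≤ qk q := by
          rcases hkq.eq_or_lt with rfl | hlt'
          · exact le_rfl
          · exact (h.sorted k q hlt' hlt).le
        have h7 := h.le_head k le_rfl (by omega)
        have h8 : qk k ≠ c := fun h9 => hm ⟨by omega, h9⟩
        omega
    · rw [e1]; omega
  · intro i₁ j₁ hi₁ hj₁ hlt hr
    rcases Nat.lt_or_ge (j₁ * K + i₁) c with hlt' | hge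
    · obtain ⟨q, hq, hq'⟩ := h.complete i₁ j₁ hi₁ hj₁ hlt' hr
      exact ⟨q, by omega, by rw [(hold q hq).1, hq']⟩
    -- The only newly explored cell is the current one, and a nonempty reachable upper side has just
    -- been pushed.
    · have heq : j * K + i = j₁ * K + i₁ := by omega
      obtain ⟨rfl, rfl⟩ := key_inj hiK hi₁ heq
      obtain ⟨x, hx, hx', hr⟩ := hr
      have h5 := hT.complete (by omega) x hx hx' hr
      have hp : tlo ≤ thi ∧ j + 2 ≤ M := ⟨h5.1.trans h5.2, by omega⟩
      obtain ⟨rfl, rfl, -⟩ := hpush hp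
      exact ⟨T, by omega, by simp; omega⟩
  · by_cases hi2 : i + 2 ≤ K
    · rw [(hin hi2).2.2.2.2]; exact h.ans_le
    · obtain ⟨-, -, -, h3, h4⟩ := hend hi2
      by_cases hcond : M ≤ j + 1 ∧ rlo ≤ 1 ∧ 1 ≤ rhi
      · rw [h3 hcond]
      · rw [h4 hcond]; exact h.ans_le
  · intro ha
    by_cases hi2 : i + 2 ≤ K
    · rw [(hin hi2).2.2.2.2] at ha; exact h.ans_sound ha
    · obtain ⟨-, -, -, h3, h4⟩ := hend hi2
      by_cases hcond : M ≤ j + 1 ∧ rlo ≤ 1 ∧ 1 ≤ rhi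
      · exact (hsound hi2 hcond.1).2 hcond.2
      · rw [h4 hcond] at ha; exact h.ans_sound ha
  · intro hle hr
    have h5 : (j + 1) * K ≤ M * K := Nat.mul_le_mul_right K hj
    have h6 : K * M = M * K := Nat.mul_comm _ _
    have h7 : i + 1 = K := by omega
    have h8 : j + 1 = M := by
      have : M * K ≤ (j + 1) * K := by omega
      have := Nat.le_of_mul_le_mul_right this (by omega)
      omega
    obtain ⟨-, -, -, h3, h4⟩ := hend (by omega)
    exact h3 ⟨h8.ge, (hsound (by omega) h8.ge).1 hr⟩

/-- At the end of the exploration, the flag tells whether the end of the free space is reachable. -/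
theorem finish (h : Exploration v w r K M c i j k T llo lhi qk qi qj qlo qhi ans)
    (hM : 1 ≤ M) (hl : ¬ llo ≤ lhi) (hk : T ≤ k) : ans = 1 ↔ Reachable v w r K M := by
  refine ⟨h.ans_sound, fun hr => h.ans_complete ?_ hr⟩
  have hskip := h.not_cellReachable hl (c₁ := K * M) (fun q h1 h2 => by omega)
  have hK : 1 ≤ K := by have := h.i_lt; omega
  by_contra hlt
  have e1 : ((K - 1 : ℕ) : ℝ) = (K : ℝ) - 1 := by rw [Nat.cast_sub hK]; simp
  have e2 : ((M - 1 : ℕ) : ℝ) = (M : ℝ) - 1 := by rw [Nat.cast_sub hM]; simp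
  have hcell : CellReachable v w r (K - 1) (M - 1) :=
    ⟨K, M, ⟨by rw [e1]; linarith, by rw [e1]; linarith⟩, ⟨by rw [e2]; linarith, by rw [e2]; linarith⟩, hr⟩
  have e3 : (M - 1) * K + K = K * M := by
    obtain ⟨M', rfl⟩ : ∃ M', M = M' + 1 := ⟨M - 1, by omega⟩
    simp; ring
  by_cases hc : c ≤ (M - 1) * K + (K - 1)
  · exact hskip _ (K - 1) (M - 1) rfl (by omega) (by omega) hc (by omega) hcell
  · omega

/-- The number of reachable cells that have not been explored. -/
noncomputable def remaining (v w : ℕ → E) (r : ℝ) (K M c : ℕ) : ℕ :=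
  ((reachableCells v w r K M).filter fun z => c ≤ z.2 * K + z.1).card

theorem remaining_le (v w : ℕ → E) (r : ℝ) (K M c : ℕ) :
    remaining v w r K M c ≤ (reachableCells v w r K M).card :=
  Finset.card_le_card (Finset.filter_subset _ _)

/-- The measure behind the running time: every iteration explores a reachable cell and moves beyond
its key. -/
theorem remaining_lt {c₀ : ℕ} (hi : i < K) (hj : j < M) (hc : c = j * K + i) (hc₀ : c₀ ≤ c)
    (hr : CellReachable v w r i j) : remaining v w r K M (c + 1) < remaining v w r K M c₀ := by
  refine Finset.card_lt_card ⟨fun z hz => ?_, fun hsub => ?_⟩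
  · rw [Finset.mem_filter] at hz ⊢
    exact ⟨hz.1, by omega⟩
  · have h1 : (i, j) ∈ (reachableCells v w r K M).filter fun z => c₀ ≤ z.2 * K + z.1 :=
      Finset.mem_filter.2 ⟨mem_reachableCells.2 ⟨⟨hi, hj⟩, hr⟩, by simp only; omega⟩
    have h2 := (Finset.mem_filter.1 (hsub h1)).2
    simp only at h2
    omega

end Exploration

end Exploration

end PolygonalCurve

/-! ### Distances from squared distances of vertices -/

namespace PolygonalCurve

section Distances

variable {E : Type*} [NormedAddCommGroup E] [InnerProductSpace ℝ E]

/-- Stewart's identity. It reduces distances to points on a segment to three squared vertex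
distances, so the program reads coordinates only in `sqDist` when it computes distances. -/
theorem dist_sq_segment (p a b : E) (s : ℝ) :
    dist p (a + s • (b - a)) ^ 2 =
      (1 - s) * dist a p ^ 2 + s * dist b p ^ 2 - s * (1 - s) * dist a b ^ 2 := by
  have e1 : p - (a + s • (b - a)) = (1 - s) • (p - a) + s • (p - b) := by module
  have e2 : a - b = (p - b) - (p - a) := by abel
  rw [dist_comm a p, dist_comm b p, dist_eq_norm, dist_eq_norm, dist_eq_norm, dist_eq_norm, e1, e2,
    norm_add_sq_real, norm_sub_sq_real (p - b) (p - a), norm_smul, norm_smul, mul_pow, mul_pow, Real.norm_eq_abs,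
    Real.norm_eq_abs, sq_abs, sq_abs, inner_smul_left, inner_smul_right, real_inner_comm]
  simp only [conj_trivial]
  ring

/-- The free interval on a segment, from the squared distances of the three points. -/
theorem isFreeInterval_of_sq {p a b : E} {r A C₁ C₂ B D lo hi : ℝ} (hr : 0 ≤ r)
    (hA : A = dist a b ^ 2) (hC₁ : C₁ = dist a p ^ 2) (hC₂ : C₂ = dist b p ^ 2)
    (hB : B = (A + C₁ - C₂) / 2) (hD : D = B * B - A * (C₁ - r * r))
    (h₁ : A ≤ 0 → C₁ ≤ r * r → lo = 0 ∧ hi = 1)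
    (h₂ : A ≤ 0 → ¬ C₁ ≤ r * r → lo = 1 ∧ hi = 0)
    (h₃ : ¬ A ≤ 0 → 0 ≤ D → lo = max 0 ((B - √D) / A) ∧ hi = min 1 ((B + √D) / A))
    (h₄ : ¬ A ≤ 0 → ¬ 0 ≤ D → lo = 1 ∧ hi = 0) : IsFreeInterval p a b r lo hi := by
  have hsq : ∀ s : ℝ, dist p (a + s • (b - a)) ≤ r ↔ A * s ^ 2 - 2 * B * s + C₁ ≤ r * r := by
    intro s
    rw [← abs_of_nonneg (dist_nonneg (x := p) (y := a + s • (b - a))), ← abs_of_nonneg hr, ← sq_le_sq,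
      dist_sq_segment, ← hA, ← hC₁, ← hC₂, hB, abs_of_nonneg hr, pow_two r]
    constructor <;> intro h <;> linarith
  by_cases hA0 : A ≤ 0
  · have hA1 : A = 0 := le_antisymm hA0 (by rw [hA]; positivity)
    have hab : a = b := by
      rw [hA1] at hA
      exact dist_eq_zero.1 (pow_eq_zero_iff two_ne_zero |>.1 hA.symm)
    have hB0 : B = 0 := by rw [hB, hA1, hC₁, hC₂, hab]; simp
    have h5 : ∀ s : ℝ, dist p (a + s • (b - a)) ≤ r ↔ C₁ ≤ r * r := by
      intro s; rw [hsq, hA1, hB0]; simp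
    by_cases hC : C₁ ≤ r * r
    · obtain ⟨rfl, rfl⟩ := h₁ hA0 hC
      exact ⟨fun _ => le_rfl, fun _ => le_rfl, fun s hs hs' => by simp [h5, hC, hs, hs']⟩
    · obtain ⟨rfl, rfl⟩ := h₂ hA0 hC
      exact ⟨fun h => by linarith, fun h => by linarith, fun s hs hs' => by
        rw [h5]; exact ⟨fun h => absurd h hC, fun h => by linarith [h.1, h.2]⟩⟩
  · have hA1 : 0 < A := not_le.1 hA0
    -- The square is completed after multiplication by `A > 0`.
    have h5 : ∀ s : ℝ, dist p (a + s • (b - a)) ≤ r ↔ (A * s - B) ^ 2 ≤ D := by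
      intro s
      rw [hsq, hD]
      constructor
      · intro h
        nlinarith [mul_le_mul_of_nonneg_left h hA1.le]
      · intro h
        refine le_of_mul_le_mul_left ?_ hA1
        nlinarith
    by_cases hD0 : 0 ≤ D
    · obtain ⟨rfl, rfl⟩ := h₃ hA0 hD0
      refine ⟨fun _ => le_max_left _ _, fun _ => min_le_left _ _, fun s hs hs' => ?_⟩
      rw [h5, Real.sq_le hD0, max_le_iff, le_min_iff, div_le_iff₀ hA1, le_div_iff₀ hA1]
      constructor
      · rintro ⟨h6, h7⟩
        exact ⟨⟨hs, by linarith⟩, hs', by linarith⟩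
      · rintro ⟨⟨-, h6⟩, -, h7⟩
        exact ⟨by linarith, by linarith⟩
    · obtain ⟨rfl, rfl⟩ := h₄ hA0 hD0
      exact ⟨fun h => by linarith, fun h => by linarith, fun s hs hs' => by
        rw [h5]
        exact ⟨fun h => absurd ((sq_nonneg _).trans h) hD0, fun h => by linarith [h.1, h.2]⟩⟩

end Distances

end PolygonalCurve

/-! ### The program for free intervals -/

namespace RealRAM

open PolygonalCurve

/-- The coordinates of the point `a` start at entry `o` of the array `x`. -/
def PointAt {d : ℕ} (x : ℕ → ℝ) (o : ℕ) (a : EuclideanSpace ℝ (Fin d)) : Prop :=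
  ∀ k : Fin d, x (o + k) = a k

theorem sqDistAt_eq {d : ℕ} {x y : ℕ → ℝ} {o o' : ℕ} {a b : EuclideanSpace ℝ (Fin d)}
    (ha : PointAt x o a) (hb : PointAt y o' b) : sqDistAt d x y o o' = dist a b ^ 2 := by
  rw [EuclideanSpace.dist_eq, Real.sq_sqrt (Finset.sum_nonneg fun _ _ => sq_nonneg _), sqDistAt,
    Finset.sum_range]
  refine Finset.sum_congr rfl fun k _ => ?_
  rw [ha k, hb k, Real.dist_eq, sq_abs, pow_two]

/-- The expression `e` has the value `o` whenever the memory of natural numbers is as in `σ`, up to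
the variables used by `sqDist`. -/
def StableEval (σ : Store) (e : NatExpr) (o : ℕ) : Prop :=
  ∀ σ', Frame [3, 4, 5] [] ⟨σ.nat, σ'.real⟩ σ' → e.eval σ' = o

theorem StableEval.eval {σ σ' : Store} {e : NatExpr} {o : ℕ} {Rs : List ℕ} (h : StableEval σ e o)
    (hF : Frame [3, 4, 5] Rs σ σ') : e.eval σ' = o :=
  h σ' ⟨hF.nat, fun _ _ => rfl⟩

/-- Puts the free interval on the segment between the points at the entries `ea` and `eb` of the
array `X`, for the point at the entry `ep` of the array `Y` and for the radius in the variable `18`,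
into the variables `22` and `23`. -/
def freeInterval (X Y : ℕ) (ea eb ep : NatExpr) : Program :=
  sqDist X X ea eb ;;
  setRealVar 19 (realVar 4) ;;
  sqDist X Y ea ep ;;
  setRealVar 20 (realVar 4) ;;
  sqDist X Y eb ep ;;
  setRealVar 21 (realVar 4) ;;
  setRealVar 32 ((realVar 19 + realVar 20 - realVar 21) / realConst 2) ;;
  setRealVar 33 (realVar 32 * realVar 32 -
    realVar 19 * (realVar 20 - realVar 18 * realVar 18)) ;;
  Program.branch (Test.realLe (realVar 19) (realConst 0))
    (Program.branch (Test.realLe (realVar 20) (realVar 18 * realVar 18))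
      (setRealVar 22 (realConst 0) ;; setRealVar 23 (realConst 1))
      (setRealVar 22 (realConst 1) ;; setRealVar 23 (realConst 0)))
    (Program.branch (Test.realLe (realConst 0) (realVar 33))
      (setRealVar 22 ((realVar 32 - RealExpr.sqrt (realVar 33)) / realVar 19) ;;
        setRealVar 23 ((realVar 32 + RealExpr.sqrt (realVar 33)) / realVar 19) ;;
        Program.branch (Test.realLe (realConst 0) (realVar 22)) Program.skip
          (setRealVar 22 (realConst 0)) ;;
        Program.branch (Test.realLe (realVar 23) (realConst 1)) Program.skip
          (setRealVar 23 (realConst 1)))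
      (setRealVar 22 (realConst 1) ;; setRealVar 23 (realConst 0)))

/-- The real variables changed by `freeInterval`. -/
abbrev freeIntervalVars : List ℕ := [4, 19, 20, 21, 22, 23, 32, 33]

theorem freeInterval_ends {X Y : ℕ} {ea eb ep : NatExpr} {σ : Store} {d oa ob op : ℕ}
    {a b p : EuclideanSpace ℝ (Fin d)} {r : ℝ} {Φ : Store → Prop} (hX : X < 2) (hY : Y < 2)
    (hd : σ.nat 0 0 = d) (hea : StableEval σ ea oa) (heb : StableEval σ eb ob)
    (hep : StableEval σ ep op) (hca : ea.cost ≤ 10) (hcb : eb.cost ≤ 10) (hcp : ep.cost ≤ 10)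
    (ha : PointAt (σ.real X) oa a) (hb : PointAt (σ.real X) ob b) (hp : PointAt (σ.real Y) op p)
    (hr : σ.real 18 0 = r) (hr0 : 0 ≤ r)
    (hΦ : ∀ σ', Frame [3, 4, 5] freeIntervalVars σ σ' →
      IsFreeInterval p a b r (σ'.real 22 0) (σ'.real 23 0) → Φ σ') :
    Ends (freeInterval X Y ea eb ep) σ (1000 * (d + 1)) Φ := by
  have hXm : X ∉ freeIntervalVars := by simp; omega
  have hYm : Y ∉ freeIntervalVars := by simp; omega
  have hX4 : X ≠ 4 := by omega
  have hY4 : Y ≠ 4 := by omega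
  have hs4 : ([4] : List ℕ) ⊆ freeIntervalVars := by decide
  refine sqDist_then (d := d) hX4 hX4 hd
    (hea.eval (Frame.refl _ [] σ))
    (heb.eval ((Frame.refl [3, 4, 5] [] σ).setNat (by decide) _ _)) hca hcb ?_
  intro σ₁ F₁ v₁
  replace F₁ := F₁.mono (fun _ h => h) hs4
  rw [sqDistAt_eq ha hb] at v₁
  refine Ends.setRealVar_then ?_
  have F₁' := F₁.setReal (a := 19) (by decide) 0 ((realVar 4).eval σ₁)
  -- The new memory becomes opaque; only its frame and the entries needed later are retained.
  generalize hσ₁ : σ₁.setReal 19 0 ((realVar 4).eval σ₁) = σ₁' at F₁'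
  have e19 : σ₁'.real 19 0 = dist a b ^ 2 := by rw [← hσ₁]; simp [v₁]
  refine sqDist_then (d := d) hX4 hY4
    (by rw [F₁'.nat 0 (by decide), hd]) (hea.eval F₁')
    (hep.eval (F₁'.setNat (by decide) _ _)) hca hcp ?_
  intro σ₂ F₂ v₂
  rw [F₁'.real X hXm, F₁'.real Y hYm, sqDistAt_eq ha hp] at v₂
  refine Ends.setRealVar_then ?_
  have e19' : σ₂.real 19 0 = dist a b ^ 2 := by rw [F₂.real 19 (by decide), e19]
  have F₂' := (F₁'.trans (F₂.mono (fun _ h => h) hs4)).setReal (a := 20) (by decide) 0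
    ((realVar 4).eval σ₂)
  generalize hσ₂ : σ₂.setReal 20 0 ((realVar 4).eval σ₂) = σ₂' at F₂'
  replace e19' : σ₂'.real 19 0 = dist a b ^ 2 := by rw [← hσ₂]; simp [e19']
  have e20 : σ₂'.real 20 0 = dist a p ^ 2 := by rw [← hσ₂]; simp [v₂]
  refine sqDist_then (d := d) hX4 hY4
    (by rw [F₂'.nat 0 (by decide), hd]) (heb.eval F₂')
    (hep.eval (F₂'.setNat (by decide) _ _)) hcb hcp ?_
  intro σ₃ F₃ v₃
  rw [F₂'.real X hXm, F₂'.real Y hYm, sqDistAt_eq hb hp] at v₃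
  have f19 : σ₃.real 19 0 = dist a b ^ 2 := by rw [F₃.real 19 (by decide), e19']
  have f20 : σ₃.real 20 0 = dist a p ^ 2 := by rw [F₃.real 20 (by decide), e20]
  have F₃' := F₂'.trans (F₃.mono (fun _ h => h) hs4)
  have f18 : σ₃.real 18 0 = r := by rw [F₃'.real 18 (by decide), hr]
  refine Ends.setRealVar_then (Ends.setRealVar_then (Ends.setRealVar_then ?_))
  have F₄ := ((F₃'.setReal (a := 21) (by decide) 0 ((realVar 4).eval σ₃)).setReal (a := 32)
    (by decide) 0 (((realVar 19 + realVar 20 - realVar 21) / realConst 2).eval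
      (σ₃.setReal 21 0 ((realVar 4).eval σ₃)))).setReal (a := 33)
    (by decide) 0 ((realVar 32 * realVar 32 -
      realVar 19 * (realVar 20 - realVar 18 * realVar 18)).eval
        ((σ₃.setReal 21 0 ((realVar 4).eval σ₃)).setReal 32 0
          (((realVar 19 + realVar 20 - realVar 21) / realConst 2).eval
      (σ₃.setReal 21 0 ((realVar 4).eval σ₃)))))
  generalize hσ₄ : Store.setReal _ 33 0 _ = σ₄ at F₄ ⊢
  have g18 : σ₄.real 18 0 = r := by rw [← hσ₄]; simp [f18]
  have g19 : σ₄.real 19 0 = dist a b ^ 2 := by rw [← hσ₄]; simp [f19]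
  have g20 : σ₄.real 20 0 = dist a p ^ 2 := by rw [← hσ₄]; simp [f20]
  have g32 : σ₄.real 32 0 = (dist a b ^ 2 + dist a p ^ 2 - dist b p ^ 2) / 2 := by
    rw [← hσ₄]; simp [f19, f20, v₃]
  have g33 : σ₄.real 33 0 = σ₄.real 32 0 * σ₄.real 32 0 -
      dist a b ^ 2 * (dist a p ^ 2 - r * r) := by
    rw [← hσ₄]; simp [f18, f19, f20]
  have key := fun lo hi => isFreeInterval_of_sq (p := p) (a := a) (b := b) (lo := lo) (hi := hi)
    hr0 rfl rfl rfl g32 g33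
  refine Ends.branch_le (fun hA => ?_) (fun hA => ?_)
  · simp only [Test.holds_realLe, eval_realVar, eval_realConst, g19, Nat.cast_zero] at hA
    refine Ends.branch_le (fun hC => ?_) (fun hC => ?_)
    · simp only [Test.holds_realLe, eval_realVar, RealExpr.eval_mul, g20, g18] at hC
      refine Ends.setRealVar_then (Ends.setRealVar_le ?_)
      refine hΦ _ ((F₄.setReal (by decide) _ _).setReal (by decide) _ _) (key _ _ ?_ ?_ ?_ ?_)
      · intros; simp
      · intro _ h; exact absurd hC h
      · intro h; exact absurd hA h
      · intro h; exact absurd hA h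
    · simp only [Test.holds_realLe, eval_realVar, RealExpr.eval_mul, g20, g18] at hC
      refine Ends.setRealVar_then (Ends.setRealVar_le ?_)
      refine hΦ _ ((F₄.setReal (by decide) _ _).setReal (by decide) _ _) (key _ _ ?_ ?_ ?_ ?_)
      · intro _ h; exact absurd h hC
      · intros; simp
      · intro h; exact absurd hA h
      · intro h; exact absurd hA h
  · simp only [Test.holds_realLe, eval_realVar, eval_realConst, g19, Nat.cast_zero] at hA
    refine Ends.branch_le (fun hD => ?_) (fun hD => ?_)
    · simp only [Test.holds_realLe, eval_realVar, eval_realConst, Nat.cast_zero] at hD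
      refine Ends.setRealVar_then (Ends.setRealVar_then ?_)
      have F₅ := (F₄.setReal (a := 22) (by decide) 0
        (((realVar 32 - RealExpr.sqrt (realVar 33)) / realVar 19).eval σ₄)).setReal (a := 23)
        (by decide) 0 (((realVar 32 + RealExpr.sqrt (realVar 33)) / realVar 19).eval
          (σ₄.setReal 22 0 (((realVar 32 - RealExpr.sqrt (realVar 33)) / realVar 19).eval σ₄)))
      generalize hσ₅ : Store.setReal _ 23 0 _ = σ₅ at F₅ ⊢
      have k22 : σ₅.real 22 0 = (σ₄.real 32 0 - √(σ₄.real 33 0)) / dist a b ^ 2 := by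
        rw [← hσ₅]; simp [g19]
      have k23 : σ₅.real 23 0 = (σ₄.real 32 0 + √(σ₄.real 33 0)) / dist a b ^ 2 := by
        rw [← hσ₅]; simp [g19]
      have fin : ∀ σ₆, Frame [3, 4, 5] freeIntervalVars σ σ₆ →
          σ₆.real 22 0 = max 0 ((σ₄.real 32 0 - √(σ₄.real 33 0)) / dist a b ^ 2) →
          σ₆.real 23 0 = min 1 ((σ₄.real 32 0 + √(σ₄.real 33 0)) / dist a b ^ 2) → Φ σ₆ :=
        fun σ₆ F h1 h2 => hΦ σ₆ F (key _ _ (fun h => absurd h hA) (fun h => absurd h hA)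
          (fun _ _ => ⟨h1, h2⟩) fun _ h => absurd hD h)
      have last : ∀ σ₆, Frame [3, 4, 5] freeIntervalVars σ σ₆ →
          σ₆.real 22 0 = max 0 ((σ₄.real 32 0 - √(σ₄.real 33 0)) / dist a b ^ 2) →
          σ₆.real 23 0 = (σ₄.real 32 0 + √(σ₄.real 33 0)) / dist a b ^ 2 →
          Ends (Program.branch (Test.realLe (realVar 23) (realConst 1)) Program.skip
            (setRealVar 23 (realConst 1))) σ₆ 80 Φ := by
        intro σ₆ F h1 h2
        refine Ends.branch_le (fun h => Ends.skip_le (fin _ F h1 ?_)) (fun h =>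
          Ends.setRealVar_le (fin _ (F.setReal (by decide) _ _) (by simpa using h1) ?_))
        · simp only [Test.holds_realLe, eval_realVar, eval_realConst, h2, Nat.cast_one] at h
          rw [h2, min_eq_right h]
        · simp only [Test.holds_realLe, eval_realVar, eval_realConst, h2, Nat.cast_one] at h
          rw [min_eq_left (by linarith)]; simp
      refine Ends.branch_then
        (fun h => Ends.skip_then ((last _ F₅ ?_ k23).mono_time (by omega)))
        (fun h => Ends.setRealVar_then
          ((last _ (F₅.setReal (by decide) _ _) ?_ (by simpa using k23)).mono_time (by omega)))
      · simp only [Test.holds_realLe, eval_realVar, eval_realConst, k22, Nat.cast_zero] at h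
        rw [k22, max_eq_right h]
      · simp only [Test.holds_realLe, eval_realVar, eval_realConst, k22, Nat.cast_zero] at h
        rw [max_eq_left (by linarith)]; simp
    · simp only [Test.holds_realLe, eval_realVar, eval_realConst, Nat.cast_zero] at hD
      refine Ends.setRealVar_then (Ends.setRealVar_le ?_)
      refine hΦ _ ((F₄.setReal (by decide) _ _).setReal (by decide) _ _) (key _ _ ?_ ?_ ?_ ?_)
      · intro h; exact absurd h hA
      · intro h; exact absurd h hA
      · intro _ h; exact absurd h hD
      · intros; simp

end RealRAM

/-! ### Repeating the last vertex -/

namespace RealRAM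

open PolygonalCurve

/-- The array `x` lists the vertices of the curve `p`, the last one twice. -/
def CurveAt {d n : ℕ} (x : ℕ → ℝ) (p : Fin n → EuclideanSpace ℝ (Fin d)) : Prop :=
  ∀ i ≤ n, PointAt x (i * d) (ext p i)

theorem curveArray_add {d n : ℕ} (p : Fin n → EuclideanSpace ℝ (Fin d)) (i : ℕ) (k : Fin d) :
    curveArray p (i * d + k) = vertex p i k := by
  have hd : 0 < d := k.pos
  have h1 : (i * d + k) / d = i := by
    rw [Nat.add_comm, Nat.add_mul_div_right _ _ hd, Nat.div_eq_of_lt k.2, Nat.zero_add]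
  have h2 : (i * d + k) % d = k := by
    rw [Nat.add_comm, Nat.add_mul_mod_self_right, Nat.mod_eq_of_lt k.2]
  simp only [curveArray, hd, dif_pos, h1, h2]

/-- Repeats the last vertex of the curve in the array `X`, the number of whose vertices is in the
variable `N`. -/
def repeatLast (X N : ℕ) : Program :=
  setNatVar 6 (NatExpr.const 1) ;;
  setNatVar 8 (NatExpr.const 0) ;;
  Program.loop (Test.natLe (natVar 6 + NatExpr.const 1) (natVar N))
    (setNatVar 6 (natVar 6 + NatExpr.const 1) ;; setNatVar 8 (natVar 8 + natVar 0)) ;;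
  setNatVar 6 (NatExpr.const 0) ;;
  Program.loop (Test.natLe (natVar 6 + NatExpr.const 1) (natVar 0))
    (Program.storeReal X (natVar 8 + natVar 0 + natVar 6) (RealExpr.load X (natVar 8 + natVar 6)) ;;
      setNatVar 6 (natVar 6 + NatExpr.const 1))

/-- Without multiplication of natural numbers, the offset of the last vertex is found by repeated
addition. -/
theorem repeatLast_ends {X N d n : ℕ} {σ : Store} {p : Fin n → EuclideanSpace ℝ (Fin d)}
    {Φ : Store → Prop} (hN : N < 3) (hn : 1 ≤ n) (hd : σ.nat 0 0 = d) (hσN : σ.nat N 0 = n)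
    (hx : σ.real X = curveArray p)
    (hΦ : ∀ σ', Frame [6, 8] [X] σ σ' → CurveAt (σ'.real X) p → Φ σ') :
    Ends (repeatLast X N) σ (400 * (n + d + 1)) Φ := by
  have hN' : N ∉ [6, 8] := by simp; omega
  refine Ends.setNatVar_then (Ends.setNatVar_then ?_)
  have F₀ := ((Frame.refl [6, 8] [X] σ).setNat (a := 6) (by decide) 0 1).setNat (a := 8)
    (by decide) 0 0
  let I : ℕ → Store → Prop := fun v σ' => Frame [6, 8] [X] σ σ' ∧ σ'.real X = curveArray p ∧
    ∃ k, k + 1 ≤ n ∧ v = n - k ∧ σ'.nat 6 0 = k + 1 ∧ σ'.nat 8 0 = k * d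
  refine Ends.then_le ((n + 1) * (80 + 40)) (Ends.loop_le 80 I (v := n) ?_ ?_ ?_ le_rfl)
  · exact ⟨F₀, by simpa using hx, 0, by omega, by simp, by simp, by simp⟩
  · rintro v σ' ⟨hF, hX, k, hk, rfl, h6, h8⟩ hb
    have h0 : σ'.nat 0 0 = d := by rw [hF.nat 0 (by decide), hd]
    simp only [Test.holds_natLe, NatExpr.eval_add, eval_natVar, NatExpr.eval_const, h6,
      hF.nat N hN', hσN] at hb
    refine Ends.setNatVar_then (Ends.setNatVar_le ?_)
    refine ⟨n - (k + 1), by omega, (hF.setNat (by decide) _ _).setNat (by decide) _ _,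
      by simpa using hX, k + 1, hb, rfl, by simp [h6], ?_⟩
    simp [h8, h0]; ring
  rintro v σ₁ ⟨F₁, hX₁, k, hk, -, h6, h8⟩ hb
  have h0 : σ₁.nat 0 0 = d := by rw [F₁.nat 0 (by decide), hd]
  simp only [Test.holds_natLe, NatExpr.eval_add, eval_natVar, NatExpr.eval_const, h6,
      F₁.nat N hN', hσN] at hb
  obtain rfl : n = k + 1 := by omega
  refine Ends.setNatVar_then ?_
  -- The copied entries lie behind all coordinates of the curve, so the source is never overwritten.
  let J : ℕ → Store → Prop := fun v σ' => Frame [6, 8] [X] σ σ' ∧ σ'.nat 8 0 = k * d ∧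
    ∃ l, l ≤ d ∧ v = d - l ∧ σ'.nat 6 0 = l ∧
      (∀ i, i < (k + 1) * d → σ'.real X i = curveArray p i) ∧
      ∀ i < l, σ'.real X ((k + 1) * d + i) = curveArray p (k * d + i)
  refine Ends.loop_le 80 J (v := d) ?_ ?_ ?_ (by omega)
  · exact ⟨F₁.setNat (by decide) _ _, by simpa using h8, 0, by omega, by simp, by simp,
      fun i _ => by simp [hX₁], by simp⟩
  · rintro v σ' ⟨hF, h8, l, hl, rfl, h6, hX, hX'⟩ hb
    have h0 : σ'.nat 0 0 = d := by rw [hF.nat 0 (by decide), hd]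
    simp only [Test.holds_natLe, NatExpr.eval_add, eval_natVar, NatExpr.eval_const, h6, h0] at hb
    refine Ends.storeReal_then (Ends.setNatVar_le ?_)
    have e : k * d + d + l = (k + 1) * d + l := by ring
    refine ⟨d - (l + 1), by omega, (hF.setReal (by simp) _ _).setNat (by decide) _ _,
      by simpa using h8, l + 1, hb, rfl, by simp [h6], fun i hi => ?_, fun i hi => ?_⟩
    · simp only [NatExpr.eval_add, eval_natVar, h8, h0, h6, Store.real_setNat,
        Store.real_setReal_self]
      rw [Function.update_of_ne (by rw [e]; omega), hX i hi]
    · simp only [NatExpr.eval_add, eval_natVar, h8, h0, h6, Store.real_setNat,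
        Store.real_setReal_self, RealExpr.eval_load]
      rcases (Nat.lt_succ_iff.1 hi).eq_or_lt with rfl | hlt
      · rw [e, Function.update_self]
        exact hX _ (by linarith)
      · rw [Function.update_of_ne (by rw [e]; omega), hX' i hlt]
  rintro v σ₂ ⟨F₂, -, l, hl, -, h6, hX, hX'⟩ hb
  have h0 : σ₂.nat 0 0 = d := by rw [F₂.nat 0 (by decide), hd]
  simp only [Test.holds_natLe, NatExpr.eval_add, eval_natVar, NatExpr.eval_const, h6, h0] at hb
  obtain rfl : l = d := by omega
  refine hΦ σ₂ F₂ fun i hi c => ?_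
  rcases hi.eq_or_lt with rfl | hlt
  · rw [hX' c c.2, curveArray_add, ext]
    simp
  · have hlt' : i * l + c < (k + 1) * l := by
      have := Nat.mul_le_mul_right l (show i + 1 ≤ k + 1 by omega)
      have := c.2
      have : (i + 1) * l = i * l + l := by ring
      omega
    rw [hX _ hlt', curveArray_add, ext, min_eq_left (by omega)]

/-! ### Simplification -/

/-- Simplifies the curve in the array `X`, with number of vertices in the variable `N`, for the
distance in the variable `17`: the offsets of the chosen vertices are put into the array `S`, and
their number, not counting the first one, into the variable `L`. -/
def simplify (X N S L : ℕ) : Program :=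
  setNatVar 14 (NatExpr.const 0) ;;
  setNatVar 15 (NatExpr.const 0) ;;
  setNatVar 16 (NatExpr.const 0) ;;
  setNatVar L (NatExpr.const 0) ;;
  Program.storeNat S (NatExpr.const 0) (NatExpr.const 0) ;;
  Program.loop (Test.natLe (natVar 14 + NatExpr.const 1) (natVar N))
    (setNatVar 14 (natVar 14 + NatExpr.const 1) ;;
      setNatVar 15 (natVar 15 + natVar 0) ;;
      sqDist X X (natVar 16) (natVar 15) ;;
      Program.branch (Test.or (Test.not (Test.realLe (realVar 4) (realVar 17 * realVar 17)))
          (Test.natLe (natVar N) (natVar 14)))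
        (setNatVar L (natVar L + NatExpr.const 1) ;;
          Program.storeNat S (natVar L) (natVar 15) ;;
          setNatVar 16 (natVar 15))
        Program.skip)

/-- The first `b` vertices have been scanned by `simplify`. -/
structure PartialSimplification {E : Type*} [PseudoMetricSpace E] (v : ℕ → E) (n b K : ℕ)
    (a : ℕ → ℕ) (μ : ℝ) : Prop where
  zero : a 0 = 0
  b_le : b ≤ n
  last_le : a K ≤ b
  last_lt : b < n → a K < n
  last_eq : b = n → a K = n
  lt : ∀ k < K, a k < a (k + 1)
  near : ∀ k < K, ∀ b, a k ≤ b → b < a (k + 1) → dist (v (a k)) (v b) ≤ μ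
  near_last : ∀ b', a K ≤ b' → b' ≤ b → dist (v (a K)) (v b') ≤ μ
  far : ∀ k < K, a (k + 1) < n → μ < dist (v (a k)) (v (a (k + 1)))

namespace PartialSimplification

variable {E : Type*} [PseudoMetricSpace E] {v : ℕ → E} {n b K : ℕ} {a : ℕ → ℕ} {μ : ℝ}

theorem init (v : ℕ → E) {n : ℕ} {a : ℕ → ℕ} (hn : 1 ≤ n) (hμ : 0 ≤ μ) (ha : a 0 = 0) :
    PartialSimplification v n 0 0 a μ where
  zero := ha
  b_le := by omega
  last_le := by omega
  last_lt _ := by omega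
  last_eq _ := by omega
  lt := by simp
  near := by simp
  near_last b' _ h := by
    obtain rfl : b' = 0 := by omega
    simpa [ha] using hμ
  far := by simp

theorem skip (h : PartialSimplification v n b K a μ) (hb : b + 1 < n)
    (hd : dist (v (a K)) (v (b + 1)) ≤ μ) : PartialSimplification v n (b + 1) K a μ where
  zero := h.zero
  b_le := hb.le
  last_le := h.last_le.trans (by omega)
  last_lt _ := h.last_lt (by omega)
  last_eq := by omega
  lt := h.lt
  near := h.near
  near_last b' h1 h2 := by
    rcases h2.eq_or_lt with rfl | h3
    · exact hd
    · exact h.near_last b' h1 (by omega)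
  far := h.far

theorem push (h : PartialSimplification v n b K a μ) (hb : b < n) (hμ : 0 ≤ μ)
    (hd : b + 1 < n → μ < dist (v (a K)) (v (b + 1))) :
    PartialSimplification v n (b + 1) (K + 1) (Function.update a (K + 1) (b + 1)) μ := by
  have e : ∀ k ≤ K, Function.update a (K + 1) (b + 1) k = a k := fun k hk =>
    Function.update_of_ne (by omega) _ _
  have e' : Function.update a (K + 1) (b + 1) (K + 1) = b + 1 := Function.update_self _ _ _
  refine ⟨by rw [e 0 (by omega), h.zero], hb, by rw [e'], by rw [e']; exact id, by rw [e']; exact id,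
    fun k hk => ?_, fun k hk => ?_, fun b' h1 h2 => ?_, fun k hk => ?_⟩
  · rcases (Nat.lt_succ_iff.1 hk).eq_or_lt with rfl | hlt
    · rw [e', e k le_rfl]
      have := h.last_le
      omega
    · rw [e k hlt.le, e (k + 1) hlt]
      exact h.lt k hlt
  · rcases (Nat.lt_succ_iff.1 hk).eq_or_lt with rfl | hlt
    · rw [e', e k le_rfl]
      exact fun b' h1 h2 => h.near_last b' h1 (by omega)
    · rw [e k hlt.le, e (k + 1) hlt]
      exact h.near k hlt
  · rw [e'] at h1 ⊢
    obtain rfl : b' = b + 1 := by omega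
    simpa using hμ
  · rcases (Nat.lt_succ_iff.1 hk).eq_or_lt with rfl | hlt
    · rw [e', e k le_rfl]
      exact hd
    · rw [e k hlt.le, e (k + 1) hlt]
      exact h.far k hlt

theorem isSimplification {d : ℕ} {v : ℕ → EuclideanSpace ℝ (Fin d)}
    (h : PartialSimplification v n n K a μ) :
    IsSimplification v n K a μ where
  zero := h.zero
  last := h.last_eq rfl
  lt := h.lt
  near := h.near
  far k hk := h.far k (by omega) (by
    have h1 : a (k + 1) < a (k + 2) := h.lt (k + 1) hk
    have h2 : ∀ l, k + 2 ≤ l → l ≤ K → a (k + 2) ≤ a l := by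
      intro l hl
      induction l, hl using Nat.le_induction with
      | base => exact fun _ => le_rfl
      | succ l hl ih => exact fun hK => (ih (by omega)).trans (h.lt l (by omega)).le
    have h3 := h2 K hk le_rfl
    rw [h.last_eq rfl] at h3
    omega)

end PartialSimplification

/-- A greedy scan: each vertex is compared once with the last kept one, and the final vertex is
always kept. Offsets are stored instead of indices, which avoids multiplications later. -/
theorem simplify_ends {X N S L d n : ℕ} {σ : Store} {p : Fin n → EuclideanSpace ℝ (Fin d)} {μ : ℝ}
    {Φ : Store → Prop} (hX : X < 2) (hN : N < 3) (hS : S = 10 ∨ S = 12) (hL : L = 11 ∨ L = 13)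
    (hn : 1 ≤ n) (hd : σ.nat 0 0 = d)
    (hσN : σ.nat N 0 = n) (hx : CurveAt (σ.real X) p) (hμ : σ.real 17 0 = μ) (hμ0 : 0 ≤ μ)
    (hΦ : ∀ σ' K a, Frame [3, 4, 5, 14, 15, 16, S, L] [4] σ σ' → IsSimplification (ext p) n K a μ →
      σ'.nat L 0 = K → (∀ k ≤ K, σ'.nat S k = a k * d) → Φ σ') :
    Ends (simplify X N S L) σ (1000 * (n + 1) * (d + 1)) Φ := by
  have hN' : N ∉ [3, 4, 5, 14, 15, 16, S, L] := by
    simp only [List.mem_cons, List.not_mem_nil, or_false]; omega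
  have h0' : 0 ∉ [3, 4, 5, 14, 15, 16, S, L] := by
    simp only [List.mem_cons, List.not_mem_nil, or_false]; omega
  have hsub : ([3, 4, 5] : List ℕ) ⊆ [3, 4, 5, 14, 15, 16, S, L] := by simp
  have hbudget : 200 + (n + 1) * (90 * (d + 1) + 240 + 40) ≤ 1000 * (n + 1) * (d + 1) := by
    have e₁ : (n + 1) * (90 * (d + 1) + 240 + 40) = 90 * (n * d) + 370 * n + 90 * d + 370 := by ring
    have e₂ : 1000 * (n + 1) * (d + 1) = 1000 * (n * d) + 1000 * n + 1000 * d + 1000 := by ring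
    omega
  generalize 1000 * (n + 1) * (d + 1) = B at hbudget
  refine Ends.setNatVar_then (Ends.setNatVar_then (Ends.setNatVar_then (Ends.setNatVar_then
    (Ends.storeNat_then ?_))))
  let I : ℕ → Store → Prop := fun v σ' => Frame [3, 4, 5, 14, 15, 16, S, L] [4] σ σ' ∧
    ∃ b K a, PartialSimplification (ext p) n b K a μ ∧ v = n - b ∧ σ'.nat 14 0 = b ∧
      σ'.nat 15 0 = b * d ∧ σ'.nat 16 0 = a K * d ∧ σ'.nat L 0 = K ∧
      ∀ k ≤ K, σ'.nat S k = a k * d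
  refine Ends.loop_le (90 * (d + 1) + 240) I (v := n) ?_ ?_ ?_ (by omega)
  · refine ⟨(((((Frame.refl _ _ σ).setNat (by simp) _ _).setNat (by simp) _ _).setNat
      (by simp) _ _).setNat (by simp) _ _).setNat (by simp) _ _, 0, 0, fun _ => 0,
      .init _ hn hμ0 rfl, by simp, ?_, ?_, ?_, ?_, ?_⟩
    · rcases hL with rfl | rfl <;> rcases hS with rfl | rfl <;> simp
    · rcases hL with rfl | rfl <;> rcases hS with rfl | rfl <;> simp
    · rcases hL with rfl | rfl <;> rcases hS with rfl | rfl <;> simp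
    · rcases hL with rfl | rfl <;> rcases hS with rfl | rfl <;> simp
    · intro k hk
      obtain rfl : k = 0 := by omega
      simp
  · rintro v σ₁ ⟨F₁, b, K, a, H, rfl, h14, h15, h16, hLK, hSa⟩ hb
    have h0 : σ₁.nat 0 0 = d := by rw [F₁.nat 0 h0', hd]
    simp only [Test.holds_natLe, NatExpr.eval_add, eval_natVar, NatExpr.eval_const, h14,
      F₁.nat N hN', hσN] at hb
    refine Ends.setNatVar_then (Ends.setNatVar_then ?_)
    have F₂ := (F₁.setNat (a := 14) (by simp) 0
      ((natVar 14 + NatExpr.const 1).eval σ₁)).setNat (a := 15) (by simp) 0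
      ((natVar 15 + natVar 0).eval (σ₁.setNat 14 0 ((natVar 14 + NatExpr.const 1).eval σ₁)))
    generalize hσ₂ : Store.setNat _ 15 0 _ = σ₂ at F₂ ⊢
    have g14 : σ₂.nat 14 0 = b + 1 := by rw [← hσ₂]; simp [h14]
    have g15 : σ₂.nat 15 0 = (b + 1) * d := by rw [← hσ₂]; simp [h15, h0]; ring
    have g16 : σ₂.nat 16 0 = a K * d := by rw [← hσ₂]; simp [h16]
    have gL : σ₂.nat L = σ₁.nat L := by rw [← hσ₂]; rcases hL with rfl | rfl <;> simp
    have gS : σ₂.nat S = σ₁.nat S := by rw [← hσ₂]; rcases hS with rfl | rfl <;> simp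
    refine sqDist_then (d := d) (o := a K * d) (o' := (b + 1) * d) (by omega) (by omega)
      (by rw [F₂.nat 0 h0', hd]) (by simp [g16]) (by simp [g15]) (Nat.le_of_ble_eq_true rfl)
      (Nat.le_of_ble_eq_true rfl) ?_
    intro σ₃ F₃ v₃
    have k14 : σ₃.nat 14 0 = b + 1 := by rw [F₃.nat 14 (by decide), g14]
    have k15 : σ₃.nat 15 0 = (b + 1) * d := by rw [F₃.nat 15 (by decide), g15]
    have k16 : σ₃.nat 16 0 = a K * d := by rw [F₃.nat 16 (by decide), g16]
    have kL : σ₃.nat L 0 = K := by rw [F₃.nat L (by rcases hL with rfl | rfl <;> simp), gL, hLK]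
    have kS : ∀ k ≤ K, σ₃.nat S k = a k * d := fun k hk => by
      rw [F₃.nat S (by rcases hS with rfl | rfl <;> simp), gS, hSa k hk]
    have F₄ := F₂.trans (F₃.mono hsub (fun _ h => h))
    have k4 : σ₃.real 4 0 = dist (ext p (a K)) (ext p (b + 1)) ^ 2 := by
      have hX4 : X ∉ [4] := by simp; omega
      have hx' : CurveAt (σ₂.real X) p := by rw [F₂.real X hX4]; exact hx
      rw [v₃, sqDistAt_eq (hx' _ (H.last_le.trans H.b_le)) (hx' _ hb)]
    have k17 : σ₃.real 17 0 = μ := by rw [F₄.real 17 (by decide), hμ]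
    refine Ends.branch_le (fun hc => ?_) (fun hc => ?_)
    · simp only [Test.holds_or, Test.holds_not, Test.holds_realLe, Test.holds_natLe, eval_realVar,
        RealExpr.eval_mul, k4, k17, eval_natVar, F₄.nat N hN', hσN, k14] at hc
      refine Ends.setNatVar_then (Ends.storeNat_then (Ends.setNatVar_le ?_))
      have HP := H.push hb hμ0 (fun hlt => by
        rcases hc with hc | hc
        · rw [← pow_two, sq_le_sq₀ dist_nonneg hμ0] at hc
          exact not_le.1 hc
        · omega)
      refine ⟨n - (b + 1), by omega, ((F₄.setNat (by simp) _ _).setNat (by simp) _ _).setNat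
        (by simp) _ _, b + 1, K + 1, _, HP, rfl, ?_, ?_, ?_, ?_, ?_⟩
      · rcases hL with rfl | rfl <;> rcases hS with rfl | rfl <;> simp [k14]
      · rcases hL with rfl | rfl <;> rcases hS with rfl | rfl <;> simp [k15]
      · rcases hL with rfl | rfl <;> rcases hS with rfl | rfl <;> simp [k15]
      · rcases hL with rfl | rfl <;> rcases hS with rfl | rfl <;> simp [kL]
      · intro k hk
        have e : σ₃.nat 15 0 = (b + 1) * d := k15
        have : Function.update (σ₃.nat S) (K + 1) ((b + 1) * d) k =
            Function.update a (K + 1) (b + 1) k * d := by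
          rcases hk.eq_or_lt with rfl | hlt
          · simp
          · rw [Function.update_of_ne (by omega), Function.update_of_ne (by omega),
              kS k (by omega)]
        rw [← this]
        rcases hL with rfl | rfl <;> rcases hS with rfl | rfl <;> simp [kL, k15]
    · simp only [Test.holds_or, Test.holds_not, Test.holds_realLe, Test.holds_natLe, eval_realVar,
        RealExpr.eval_mul, k4, k17, eval_natVar, F₄.nat N hN', hσN, k14, not_or, not_not] at hc
      rw [← pow_two, sq_le_sq₀ dist_nonneg hμ0] at hc
      exact Ends.skip_le ⟨n - (b + 1), by omega, F₄, b + 1, K, a, H.skip (by omega) hc.1, rfl, k14,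
        k15, k16, kL, kS⟩
  · rintro v σ₁ ⟨F₁, b, K, a, H, -, h14, -, -, hLK, hSa⟩ hb
    simp only [Test.holds_natLe, NatExpr.eval_add, eval_natVar, NatExpr.eval_const, h14,
      F₁.nat N hN', hσN] at hb
    obtain rfl : b = n := by have := H.b_le; omega
    exact hΦ σ₁ K a F₁ H.isSimplification hLK hSa

end RealRAM

/-! ### The traversal by arc length -/

namespace RealRAM

open PolygonalCurve

/-- Goes on to the next vertex of the curve in `X`; its index is in `I`, its offset in `O`, the
parameter on its edge in `S`. The analogous data of the other curve are in `Y`, `J`, `O'`, `T`, and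
the number of its vertices in `M`, its squared edge length in `B`. The lengths of the remaining
parts of the edges are in `R` and `R'`, and the largest distance met is in the variable `7`. -/
def advance (X Y I O S J O' T R R' B M : ℕ) : Program :=
  Program.branch (Test.natLe (natVar J + NatExpr.const 1) (natVar M))
    (setRealVar T (realVar T + (realConst 1 - realVar T) * (realVar R / realVar R')))
    Program.skip ;;
  setNatVar I (natVar I + NatExpr.const 1) ;;
  setNatVar O (natVar O + natVar 0) ;;
  setRealVar S (realConst 0) ;;
  sqDist Y X (natVar O') (natVar O) ;;
  setRealVar 12 (realVar 4) ;;
  sqDist Y X (natVar O' + natVar 0) (natVar O) ;;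
  setRealVar 13 (RealExpr.sqrt ((realConst 1 - realVar T) * realVar 12 + realVar T * realVar 4 -
    realVar T * (realConst 1 - realVar T) * realVar B)) ;;
  Program.branch (Test.realLe (realVar 13) (realVar 7)) Program.skip (setRealVar 7 (realVar 13))

/-- The two admissible allocations of variables are exchanged by swapping the curves, so one proof
serves both directions of `walk`. -/
theorem advance_ends {X Y I O S J O' T R R' B M d n m i j : ℕ}
    (hreg : [X, Y, I, O, S, J, O', T, R, R', B, M] = [0, 1, 6, 8, 5, 7, 9, 6, 10, 11, 9, 2] ∨
      [X, Y, I, O, S, J, O', T, R, R', B, M] = [1, 0, 7, 9, 6, 6, 8, 5, 11, 10, 8, 1])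
    {v w : ℕ → EuclideanSpace ℝ (Fin d)} {σ : Store} {s t D : ℝ} {Φ : Store → Prop}
    (hd : σ.nat 0 0 = d) (hM : σ.nat M 0 = m) (hI : σ.nat I 0 = i) (hO : σ.nat O 0 = i * d)
    (hJ : σ.nat J 0 = j) (hO' : σ.nat O' 0 = j * d) (hT : σ.real T 0 = t) (hD : σ.real 7 0 = D)
    (hx : ∀ i ≤ n, PointAt (σ.real X) (i * d) (v i))
    (hy : ∀ j ≤ m, PointAt (σ.real Y) (j * d) (w j))
    (hR : σ.real R 0 = (1 - s) * dist (v i) (v (i + 1)))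
    (hR' : j < m → σ.real R' 0 = (1 - t) * dist (w j) (w (j + 1)))
    (hB : j < m → σ.real B 0 = dist (w j) (w (j + 1)) ^ 2)
    (W : WalkInv v w n m i j s t D) (hi : i < n)
    (hle : j < m → (1 - s) * dist (v i) (v (i + 1)) ≤ (1 - t) * dist (w j) (w (j + 1)))
    (hΦ : ∀ σ' t' D', Frame [3, 4, 5, I, O] [4, 12, 13, 7, S, T] σ σ' → σ'.nat I 0 = i + 1 →
      σ'.nat O 0 = (i + 1) * d → σ'.real S 0 = 0 → σ'.real T 0 = t' → σ'.real 7 0 = D' →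
      WalkInv v w n m (i + 1) j 0 t' D' → Φ σ') :
    Ends (advance X Y I O S J O' T R R' B M) σ (600 * (d + 1)) Φ := by
  simp only [List.cons.injEq, and_true] at hreg
  have hY4 : Y ≠ 4 := by omega
  have hX4 : X ≠ 4 := by omega
  -- the part after the update of the parameter `t`
  have main : ∀ σ₁ t', Frame [3, 4, 5, I, O] [4, 12, 13, 7, S, T] σ σ₁ → σ₁.nat = σ.nat →
      σ₁.real 7 0 = D → σ₁.real T 0 = t' →
      (j < m → t' = t + (1 - t) *
        (((1 - s) * dist (v i) (v (i + 1))) / ((1 - t) * dist (w j) (w (j + 1))))) →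
      (j = m → t' = t) → Ends
      (setNatVar I (natVar I + NatExpr.const 1) ;;
        setNatVar O (natVar O + natVar 0) ;;
        setRealVar S (realConst 0) ;;
        sqDist Y X (natVar O') (natVar O) ;;
        setRealVar 12 (realVar 4) ;;
        sqDist Y X (natVar O' + natVar 0) (natVar O) ;;
        setRealVar 13 (RealExpr.sqrt ((realConst 1 - realVar T) * realVar 12 +
          realVar T * realVar 4 - realVar T * (realConst 1 - realVar T) * realVar B)) ;;
        Program.branch (Test.realLe (realVar 13) (realVar 7)) Program.skip
          (setRealVar 7 (realVar 13))) σ₁ (600 * (d + 1) - 100) Φ := by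
    intro σ₁ t' F₁ hnat hD₁ hT₁ ht ht'
    refine Ends.setNatVar_then (Ends.setNatVar_then (Ends.setRealVar_then ?_))
    have F₂ := ((F₁.setNat (a := I) (by simp) 0 ((natVar I + NatExpr.const 1).eval σ₁)).setNat
      (a := O) (by simp) 0 ((natVar O + natVar 0).eval (σ₁.setNat I 0
        ((natVar I + NatExpr.const 1).eval σ₁)))).setReal (a := S) (by simp) 0
        ((realConst 0).eval ((σ₁.setNat I 0 ((natVar I + NatExpr.const 1).eval σ₁)).setNat O 0
          ((natVar O + natVar 0).eval (σ₁.setNat I 0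
        ((natVar I + NatExpr.const 1).eval σ₁)))))
    generalize hσ₂ : Store.setReal _ S 0 _ = σ₂ at F₂ ⊢
    have gI : σ₂.nat I 0 = i + 1 := by
      rw [← hσ₂]
      rcases hreg with ⟨rfl, rfl, rfl, rfl, rfl, rfl, rfl, rfl, rfl, rfl, rfl, rfl⟩ |
        ⟨rfl, rfl, rfl, rfl, rfl, rfl, rfl, rfl, rfl, rfl, rfl, rfl⟩ <;> simp [hnat, hI]
    have gO : σ₂.nat O 0 = (i + 1) * d := by
      rw [← hσ₂, Nat.add_mul, Nat.one_mul]
      rcases hreg with ⟨rfl, rfl, rfl, rfl, rfl, rfl, rfl, rfl, rfl, rfl, rfl, rfl⟩ |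
        ⟨rfl, rfl, rfl, rfl, rfl, rfl, rfl, rfl, rfl, rfl, rfl, rfl⟩ <;> simp [hnat, hO, hd]
    have gS : σ₂.real S 0 = 0 := by rw [← hσ₂]; simp
    have gT : σ₂.real T 0 = t' := by
      rw [← hσ₂]
      rcases hreg with ⟨rfl, rfl, rfl, rfl, rfl, rfl, rfl, rfl, rfl, rfl, rfl, rfl⟩ |
        ⟨rfl, rfl, rfl, rfl, rfl, rfl, rfl, rfl, rfl, rfl, rfl, rfl⟩ <;> simp [hT₁]
    have g7 : σ₂.real 7 0 = D := by
      rw [← hσ₂]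
      rcases hreg with ⟨rfl, rfl, rfl, rfl, rfl, rfl, rfl, rfl, rfl, rfl, rfl, rfl⟩ |
        ⟨rfl, rfl, rfl, rfl, rfl, rfl, rfl, rfl, rfl, rfl, rfl, rfl⟩ <;> simp [hD₁]
    have hNO : O' ∉ [3, 4, 5, I, O] := by
      simp only [List.mem_cons, List.not_mem_nil, or_false]; omega
    have hN0 : 0 ∉ [3, 4, 5, I, O] := by
      simp only [List.mem_cons, List.not_mem_nil, or_false]; omega
    have hXn : X ∉ [4, 12, 13, 7, S, T] := by
      simp only [List.mem_cons, List.not_mem_nil, or_false]; omega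
    have hYn : Y ∉ [4, 12, 13, 7, S, T] := by
      simp only [List.mem_cons, List.not_mem_nil, or_false]; omega
    have hBn : B ∉ [4, 12, 13, 7, S, T] := by
      simp only [List.mem_cons, List.not_mem_nil, or_false]; omega
    have hI3 : I ∉ [3, 4, 5] := by
      simp only [List.mem_cons, List.not_mem_nil, or_false]; omega
    have hO3 : O ∉ [3, 4, 5] := by
      simp only [List.mem_cons, List.not_mem_nil, or_false]; omega
    have hO3' : O' ∉ [3, 4, 5] := by
      simp only [List.mem_cons, List.not_mem_nil, or_false]; omega
    have hS4 : S ∉ [4] := by simp only [List.mem_cons, List.not_mem_nil, or_false]; omega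
    have hT4 : T ∉ [4] := by simp only [List.mem_cons, List.not_mem_nil, or_false]; omega
    have hB4 : B ∉ [4] := by simp only [List.mem_cons, List.not_mem_nil, or_false]; omega
    have hsub : ([3, 4, 5] : List ℕ) ⊆ [3, 4, 5, I, O] := by simp
    have hsub' : ([4] : List ℕ) ⊆ [4, 12, 13, 7, S, T] := by simp
    have gO' : σ₂.nat O' 0 = j * d := by rw [F₂.nat O' hNO, hO']
    have g0 : σ₂.nat 0 0 = d := by rw [F₂.nat 0 hN0, hd]
    have hO4 : O ≠ 4 := by omega
    refine sqDist_then (d := d) (o := j * d) (o' := (i + 1) * d) hY4 hX4 g0 (by simp [gO'])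
      (by simp [hO4, gO]) (Nat.le_of_ble_eq_true rfl) (Nat.le_of_ble_eq_true rfl) ?_
    intro σ₃ F₃ v₃
    rw [F₂.real X hXn, F₂.real Y hYn, sqDistAt_eq (hy j W.j_le) (hx (i + 1) hi)] at v₃
    have F₃' := F₂.trans (F₃.mono hsub hsub')
    refine Ends.setRealVar_then ?_
    have F₄ := F₃'.setReal (a := 12) (by simp) 0 ((realVar 4).eval σ₃)
    generalize hσ₄ : Store.setReal _ 12 0 _ = σ₄ at F₄ ⊢
    have k12 : σ₄.real 12 0 = dist (w j) (v (i + 1)) ^ 2 := by rw [← hσ₄]; simp [v₃]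
    have hT12 : T ≠ 12 := by omega
    have hS12 : S ≠ 12 := by omega
    have kI : σ₄.nat I 0 = i + 1 := by rw [← hσ₄]; simp [F₃.nat I hI3, gI]
    have kO : σ₄.nat O 0 = (i + 1) * d := by rw [← hσ₄]; simp [F₃.nat O hO3, gO]
    have kS : σ₄.real S 0 = 0 := by rw [← hσ₄]; simp [hS12, F₃.real S hS4, gS]
    have kT : σ₄.real T 0 = t' := by rw [← hσ₄]; simp [hT12, F₃.real T hT4, gT]
    have k7 : σ₄.real 7 0 = D := by rw [← hσ₄]; simp [F₃.real 7 (by decide), g7]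
    have kO' : σ₄.nat O' 0 = j * d := by rw [F₄.nat O' hNO, hO']
    have k0 : σ₄.nat 0 0 = d := by rw [F₄.nat 0 hN0, hd]
    refine sqDist_then (d := d) (o := (j + 1) * d) (o' := (i + 1) * d) hY4 hX4 k0
      (by simp [kO', k0]; ring) (by simp [hO4, kO]) (Nat.le_of_ble_eq_true rfl)
      (Nat.le_of_ble_eq_true rfl) ?_
    intro σ₅ F₅ v₅
    rw [F₄.real X hXn, F₄.real Y hYn] at v₅
    have F₅' := F₄.trans (F₅.mono hsub hsub')
    refine Ends.setRealVar_then ?_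
    have hB5 : σ₅.real B 0 = σ.real B 0 := by rw [F₅'.real B hBn]
    have hT5 : σ₅.real T 0 = t' := by rw [F₅.real T hT4, kT]
    have h12 : σ₅.real 12 0 = dist (w j) (v (i + 1)) ^ 2 := by rw [F₅.real 12 (by decide), k12]
    -- If `j = m`, there is no next vertex and variables `4` and `B` hold irrelevant values, but `t'
    -- = 0` multiplies them away.
    have hval : √((1 - t') * dist (w j) (v (i + 1)) ^ 2 + t' * σ₅.real 4 0 -
        t' * (1 - t') * σ.real B 0) = dist (v (i + 1)) (w j + t' • (w (j + 1) - w j)) := by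
      rcases W.j_le.eq_or_lt with hjm | hjm
      · rw [ht' hjm, W.t_eq hjm, dist_comm]
        simp
      · rw [v₅, sqDistAt_eq (hy (j + 1) hjm) (hx (i + 1) hi), hB hjm, ← dist_sq_segment,
          Real.sqrt_sq dist_nonneg]
    have F₆ := F₅'.setReal (a := 13) (by simp) 0 ((RealExpr.sqrt ((realConst 1 - realVar T) *
      realVar 12 + realVar T * realVar 4 - realVar T * (realConst 1 - realVar T) *
        realVar B)).eval σ₅)
    generalize hσ₆ : Store.setReal _ 13 0 _ = σ₆ at F₆ ⊢
    have l13 : σ₆.real 13 0 = dist (v (i + 1)) (w j + t' • (w (j + 1) - w j)) := by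
      rw [← hσ₆, ← hval]; simp [hT5, h12, hB5]
    have hT13 : T ≠ 13 := by omega
    have hS13 : S ≠ 13 := by omega
    have hT7 : T ≠ 7 := by omega
    have hS7 : S ≠ 7 := by omega
    have l7 : σ₆.real 7 0 = D := by rw [← hσ₆]; simp [F₅.real 7 (by decide), k7]
    have lI : σ₆.nat I 0 = i + 1 := by rw [← hσ₆]; simp [F₅.nat I hI3, kI]
    have lO : σ₆.nat O 0 = (i + 1) * d := by rw [← hσ₆]; simp [F₅.nat O hO3, kO]
    have lS : σ₆.real S 0 = 0 := by rw [← hσ₆]; simp [hS13, F₅.real S hS4, kS]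
    have lT : σ₆.real T 0 = t' := by rw [← hσ₆]; simp [hT13, hT5]
    refine Ends.branch_le (fun hc => Ends.skip_le ?_) (fun hc => Ends.setRealVar_le ?_)
    · simp only [Test.holds_realLe, eval_realVar, l13, l7] at hc
      exact hΦ σ₆ t' D F₆ lI lO lS lT l7 (W.advance hi hle ht ht' (max_eq_left hc).symm)
    · simp only [Test.holds_realLe, eval_realVar, l13, l7, not_le] at hc
      refine hΦ _ t' _ (F₆.setReal (by simp) _ _) (by simpa using lI) (by simpa using lO)
        (by simpa [hS7] using lS) (by simpa [hT7] using lT) rfl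
        (W.advance hi hle ht ht' ?_)
      rw [max_eq_right hc.le]
      simp [l13]
  have hT7 : (7 : ℕ) ≠ T := by omega
  refine Ends.branch_then (fun hc => Ends.setRealVar_then ?_) (fun hc => Ends.skip_then ?_)
  · simp only [Test.holds_natLe, NatExpr.eval_add, eval_natVar, NatExpr.eval_const, hJ, hM] at hc
    refine (main _ _ ((Frame.refl _ _ σ).setReal (by simp) _ _) rfl (by simp [hT7, hD])
      rfl (fun _ => ?_) (fun h => by omega)).mono_time (by omega)
    simp [hT, hR, hR' hc]
  · simp only [Test.holds_natLe, NatExpr.eval_add, eval_natVar, NatExpr.eval_const, hJ, hM] at hc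
    refine (main _ _ (Frame.refl _ _ σ) rfl hD rfl (fun h => by omega)
      (fun _ => hT)).mono_time (by omega)

/-- Puts the largest distance met in the simultaneous traversal of the curves in the arrays `0` and
`1` into the variable `7`. -/
def walk : Program :=
  setNatVar 6 (NatExpr.const 0) ;;
  setNatVar 7 (NatExpr.const 0) ;;
  setNatVar 8 (NatExpr.const 0) ;;
  setNatVar 9 (NatExpr.const 0) ;;
  setRealVar 5 (realConst 0) ;;
  setRealVar 6 (realConst 0) ;;
  sqDist 0 1 (natVar 8) (natVar 9) ;;
  setRealVar 7 (RealExpr.sqrt (realVar 4)) ;;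
  Program.loop (Test.or (Test.natLe (natVar 6 + NatExpr.const 1) (natVar 1))
      (Test.natLe (natVar 7 + NatExpr.const 1) (natVar 2)))
    (sqDist 0 0 (natVar 8) (natVar 8 + natVar 0) ;;
      setRealVar 8 (realVar 4) ;;
      setRealVar 10 ((realConst 1 - realVar 5) * RealExpr.sqrt (realVar 4)) ;;
      sqDist 1 1 (natVar 9) (natVar 9 + natVar 0) ;;
      setRealVar 9 (realVar 4) ;;
      setRealVar 11 ((realConst 1 - realVar 6) * RealExpr.sqrt (realVar 4)) ;;
      Program.branch (Test.or (Test.natLe (natVar 2) (natVar 7))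
          (Test.and (Test.natLe (natVar 6 + NatExpr.const 1) (natVar 1))
            (Test.realLe (realVar 10) (realVar 11))))
        (advance 0 1 6 8 5 7 9 6 10 11 9 2)
        (advance 1 0 7 9 6 6 8 5 11 10 8 1))

/-- The variables of natural numbers changed by `walk`. -/
abbrev walkNatVars : List ℕ := [3, 4, 5, 6, 7, 8, 9]

/-- The variables of real numbers changed by `walk`. -/
abbrev walkRealVars : List ℕ := [4, 5, 6, 7, 8, 9, 10, 11, 12, 13]

theorem walk_ends {d n m : ℕ} {p : Fin n → EuclideanSpace ℝ (Fin d)}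
    {q : Fin m → EuclideanSpace ℝ (Fin d)} {σ : Store} {Φ : Store → Prop}
    (hd : σ.nat 0 0 = d) (hn : σ.nat 1 0 = n) (hm : σ.nat 2 0 = m)
    (hx : CurveAt (σ.real 0) p) (hy : CurveAt (σ.real 1) q)
    (hΦ : ∀ σ' D, Frame walkNatVars walkRealVars σ σ' → σ'.real 7 0 = D →
      Reachable (ext p) (ext q) D n m →
      (∀ r k, Reach (ext p) (ext q) r k n m → D ≤ (2 * k + 1) * r) → Φ σ') :
    Ends walk σ (3000 * (n + m + 1) * (d + 1)) Φ := by
  have hbudget : 1000 * (d + 1) + (n + m + 1) * (1000 * (d + 1) + 40) ≤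
      3000 * (n + m + 1) * (d + 1) := by
    have e₁ : (n + m + 1) * (1000 * (d + 1) + 40) = 1000 * ((n + m) * d) + 1040 * (n + m) + 1000 * d
      + 1040 := by ring
    have e₂ : 3000 * (n + m + 1) * (d + 1) = 3000 * ((n + m) * d) + 3000 * (n + m) + 3000 * d
      + 3000 := by ring
    omega
  -- The product is replaced by a variable budget, so that the remaining time comparisons are
  -- linear.
  suffices key : ∀ B, 1000 * (d + 1) + (n + m + 1) * (1000 * (d + 1) + 40) ≤ B → Ends walk σ B Φ from
    key _ hbudget
  clear hbudget
  intro B hbudget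
  refine Ends.setNatVar_then (Ends.setNatVar_then (Ends.setNatVar_then (Ends.setNatVar_then
    (Ends.setRealVar_then (Ends.setRealVar_then ?_)))))
  refine sqDist_then (d := d) (o := 0) (o' := 0) (by omega) (by omega) (by simp [hd]) (by simp)
    (by simp) (Nat.le_of_ble_eq_true rfl) (Nat.le_of_ble_eq_true rfl) ?_
  intro σ₁ F₁ v₁
  simp only [NatExpr.eval_const, eval_realConst, Nat.cast_zero] at F₁ v₁
  have hx0 : PointAt (σ.real 0) 0 (ext p 0) := by simpa using hx 0 (by omega)
  have hy0 : PointAt (σ.real 1) 0 (ext q 0) := by simpa using hy 0 (by omega)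
  simp only [ne_eq, OfNat.zero_ne_ofNat, OfNat.one_ne_ofNat, not_false_eq_true,
    Store.real_setReal_of_ne, Store.real_setNat] at v₁
  rw [sqDistAt_eq hx0 hy0] at v₁
  have F₁' : Frame walkNatVars walkRealVars σ σ₁ := by
    refine Frame.trans ?_ (F₁.mono (by decide) (by decide))
    exact ((((((Frame.refl walkNatVars walkRealVars σ).setNat (by decide) _ _).setNat (by decide)
      _ _).setNat (by decide) _ _).setNat (by decide) _ _).setReal (by decide) _ _).setReal
      (by decide) _ _
  refine Ends.setRealVar_then ?_
  let I : ℕ → Store → Prop := fun u σ' => Frame walkNatVars walkRealVars σ σ' ∧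
    ∃ i j s t D, WalkInv (ext p) (ext q) n m i j s t D ∧ u = n + m - (i + j) ∧ σ'.nat 6 0 = i ∧
      σ'.nat 7 0 = j ∧ σ'.nat 8 0 = i * d ∧ σ'.nat 9 0 = j * d ∧ σ'.real 5 0 = s ∧
      σ'.real 6 0 = t ∧ σ'.real 7 0 = D
  refine Ends.loop_le (1000 * (d + 1)) I (v := n + m) ?_ ?_ ?_ (by omega)
  · refine ⟨F₁'.setReal (by decide) _ _, 0, 0, 0, 0, _, .init _ _ n m, by simp, ?_, ?_, ?_, ?_, ?_,
      ?_, ?_⟩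
    · simp [F₁.nat 6 (by decide)]
    · simp [F₁.nat 7 (by decide)]
    · simp [F₁.nat 8 (by decide)]
    · simp [F₁.nat 9 (by decide)]
    · simp [F₁.real 5 (by decide)]
    · simp [F₁.real 6 (by decide)]
    · simp [v₁, Real.sqrt_sq dist_nonneg]
  · rintro u σ₂ ⟨F₂, i, j, s, t, D, W, rfl, h6, h7, h8, h9, r5, r6, r7⟩ hb
    have h0 : σ₂.nat 0 0 = d := by rw [F₂.nat 0 (by decide), hd]
    have h1 : σ₂.nat 1 0 = n := by rw [F₂.nat 1 (by decide), hn]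
    have h2 : σ₂.nat 2 0 = m := by rw [F₂.nat 2 (by decide), hm]
    simp only [Test.holds_or, Test.holds_natLe, NatExpr.eval_add, eval_natVar, NatExpr.eval_const,
      h6, h7, h1, h2] at hb
    have hin := W.i_le
    have hjm := W.j_le
    refine sqDist_then (d := d) (o := i * d) (o' := (i + 1) * d) (by omega) (by omega) h0
      (by simp [h8]) (by simp [h8, h0]; ring) (Nat.le_of_ble_eq_true rfl)
      (Nat.le_of_ble_eq_true rfl) ?_
    intro σ₃ F₃ v₃
    rw [F₂.real 0 (by decide)] at v₃
    refine Ends.setRealVar_then (Ends.setRealVar_then ?_)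
    have F₃' : Frame [3, 4, 5] [4, 8, 10] σ₂ _ := ((F₃.mono (fun _ h => h)
      (by decide)).setReal (a := 8) (by decide) 0 ((realVar 4).eval σ₃)).setReal (a := 10)
        (by decide) 0 (((realConst 1 - realVar 5) * RealExpr.sqrt (realVar 4)).eval
          (σ₃.setReal 8 0 ((realVar 4).eval σ₃)))
    generalize hσ₄ : Store.setReal _ 10 0 _ = σ₄ at F₃' ⊢
    -- Once a curve is finished, its edge data are meaningless and are never relied upon, hence the
    -- condition.
    have g8 : i < n → σ₄.real 8 0 = dist (ext p i) (ext p (i + 1)) ^ 2 := fun hi => by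
      rw [← hσ₄, ← sqDistAt_eq (hx i hin) (hx (i + 1) hi), ← v₃]; simp
    have g10 : i < n → σ₄.real 10 0 = (1 - s) * dist (ext p i) (ext p (i + 1)) := fun hi => by
      rw [← hσ₄]
      simp [F₃.real 5 (by decide), r5, v₃, sqDistAt_eq (hx i hin) (hx (i + 1) hi),
        Real.sqrt_sq dist_nonneg]
    refine sqDist_then (d := d) (o := j * d) (o' := (j + 1) * d) (by omega) (by omega)
      (by rw [F₃'.nat 0 (by decide), h0])
      (by simp [F₃'.nat 9 (by decide), h9])
      (by simp [F₃'.nat 9 (by decide), F₃'.nat 0 (by decide), h9, h0]; ring)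
      (Nat.le_of_ble_eq_true rfl) (Nat.le_of_ble_eq_true rfl) ?_
    intro σ₅ F₅ v₅
    rw [F₃'.real 1 (by decide), F₂.real 1 (by decide)] at v₅
    refine Ends.setRealVar_then (Ends.setRealVar_then ?_)
    have F₅' : Frame [3, 4, 5] [4, 8, 10, 9, 11] σ₂ _ := (((F₃'.mono (fun _ h => h)
      (by decide)).trans (F₅.mono (fun _ h => h) (by decide))).setReal (a := 9) (by decide) 0
        ((realVar 4).eval σ₅)).setReal (a := 11)
        (by decide) 0 (((realConst 1 - realVar 6) * RealExpr.sqrt (realVar 4)).eval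
          (σ₅.setReal 9 0 ((realVar 4).eval σ₅)))
    generalize hσ₆ : Store.setReal _ 11 0 _ = σ₆ at F₅' ⊢
    have k8 : i < n → σ₆.real 8 0 = dist (ext p i) (ext p (i + 1)) ^ 2 := fun hi => by
      rw [← g8 hi, ← hσ₆]; simp [F₅.real 8 (by decide)]
    have k10 : i < n → σ₆.real 10 0 = (1 - s) * dist (ext p i) (ext p (i + 1)) := fun hi => by
      rw [← g10 hi, ← hσ₆]; simp [F₅.real 10 (by decide)]
    have k9 : j < m → σ₆.real 9 0 = dist (ext q j) (ext q (j + 1)) ^ 2 := fun hj => by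
      rw [← hσ₆, ← sqDistAt_eq (hy j hjm) (hy (j + 1) hj), ← v₅]; simp
    have k11 : j < m → σ₆.real 11 0 = (1 - t) * dist (ext q j) (ext q (j + 1)) := fun hj => by
      rw [← hσ₆]
      simp [F₅.real 6 (by decide), F₃'.real 6 (by decide), r6, v₅,
        sqDistAt_eq (hy j hjm) (hy (j + 1) hj), Real.sqrt_sq dist_nonneg]
    have F₆ := F₂.trans (F₅'.mono (by decide) (by decide))
    have a0 : σ₆.nat 0 0 = d := by rw [F₆.nat 0 (by decide), hd]
    have a1 : σ₆.nat 1 0 = n := by rw [F₆.nat 1 (by decide), hn]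
    have a2 : σ₆.nat 2 0 = m := by rw [F₆.nat 2 (by decide), hm]
    have a6 : σ₆.nat 6 0 = i := by rw [F₅'.nat 6 (by decide), h6]
    have a7 : σ₆.nat 7 0 = j := by rw [F₅'.nat 7 (by decide), h7]
    have a8 : σ₆.nat 8 0 = i * d := by rw [F₅'.nat 8 (by decide), h8]
    have a9 : σ₆.nat 9 0 = j * d := by rw [F₅'.nat 9 (by decide), h9]
    have b5 : σ₆.real 5 0 = s := by rw [F₅'.real 5 (by decide), r5]
    have b6 : σ₆.real 6 0 = t := by rw [F₅'.real 6 (by decide), r6]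
    have b7 : σ₆.real 7 0 = D := by rw [F₅'.real 7 (by decide), r7]
    have hx6 : CurveAt (σ₆.real 0) p := by rw [F₆.real 0 (by decide)]; exact hx
    have hy6 : CurveAt (σ₆.real 1) q := by rw [F₆.real 1 (by decide)]; exact hy
    refine Ends.branch_le (fun hc => ?_) (fun hc => ?_)
    · simp only [Test.holds_or, Test.holds_and, Test.holds_natLe, Test.holds_realLe,
        NatExpr.eval_add, eval_natVar, NatExpr.eval_const, eval_realVar, a6, a7, a1, a2] at hc
      have hi : i < n := by omega
      refine (advance_ends (.inl rfl) a0 a2 a6 a8 a7 a9 b6 b7 hx6 hy6 (k10 hi) k11 k9 W hi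
        (fun hj => ?_) ?_).mono_time (by omega)
      · rw [← k10 hi, ← k11 hj]
        exact (hc.resolve_left (by omega)).2
      · intro σ₇ t' D' F₇ c6 c8 c5 c6' c7 W'
        exact ⟨n + m - (i + 1 + j), by omega, F₆.trans (F₇.mono (by decide) (by decide)), _, _, _,
          _, _, W', rfl, c6, by rw [F₇.nat 7 (by decide), a7], c8, by rw [F₇.nat 9 (by decide), a9],
          c5, c6', c7⟩
    · simp only [Test.holds_or, Test.holds_and, Test.holds_natLe, Test.holds_realLe,
        NatExpr.eval_add, eval_natVar, NatExpr.eval_const, eval_realVar, a6, a7, a1, a2, not_or,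
        not_and] at hc
      have hj : j < m := by omega
      refine (advance_ends (.inr rfl) a0 a1 a7 a9 a6 a8 b5 b7 hy6 hx6 (k11 hj) k10 k8 W.symm hj
        (fun hi => ?_) ?_).mono_time (by omega)
      · rw [← k10 hi, ← k11 hj]
        exact (not_le.1 (hc.2 hi)).le
      · intro σ₇ t' D' F₇ c6 c8 c5 c6' c7 W'
        exact ⟨n + m - (i + (j + 1)), by omega, F₆.trans (F₇.mono (by decide) (by decide)), _, _, _,
          _, _, W'.symm, rfl, by rw [F₇.nat 6 (by decide), a6], c6,
          by rw [F₇.nat 8 (by decide), a8], c8, c6', c5, c7⟩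
  · rintro u σ₂ ⟨F₂, i, j, s, t, D, W, -, h6, h7, -, -, -, -, r7⟩ hb
    simp only [Test.holds_or, Test.holds_natLe, NatExpr.eval_add, eval_natVar, NatExpr.eval_const,
      h6, h7, F₂.nat 1 (by decide), hn, F₂.nat 2 (by decide), hm] at hb
    have hin := W.i_le
    have hjm := W.j_le
    obtain rfl : i = n := by omega
    obtain rfl : j = m := by omega
    refine hΦ σ₂ D F₂ r7 ?_ W.le
    have := W.reachable
    rwa [W.s_eq rfl, W.t_eq rfl, add_zero, add_zero] at this

end RealRAM

/-! ### The decision procedure -/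

namespace RealRAM

open PolygonalCurve

/-- Moves to the next cell with a nonempty left or lower side, and loads its lower side. -/
def fetch : Program :=
  Program.branch (Test.realLe (realVar 24) (realVar 25)) Program.skip
    (setNatVar 17 (NatExpr.load 20 (natVar 18)) ;;
      setNatVar 6 (NatExpr.load 21 (natVar 18)) ;;
      setNatVar 7 (NatExpr.load 22 (natVar 18))) ;;
  Program.branch (Test.and (Test.natLe (natVar 18 + NatExpr.const 1) (natVar 19))
      (Test.and (Test.natLe (NatExpr.load 20 (natVar 18)) (natVar 17))
        (Test.natLe (natVar 17) (NatExpr.load 20 (natVar 18)))))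
    (setRealVar 26 (RealExpr.load 30 (natVar 18)) ;;
      setRealVar 27 (RealExpr.load 31 (natVar 18)) ;;
      setNatVar 18 (natVar 18 + NatExpr.const 1))
    (setRealVar 26 (realConst 1) ;; setRealVar 27 (realConst 0))

/-- Determines the reachable parts of the right and the upper side of the current cell. -/
def crossCell : Program :=
  freeInterval 1 0 (NatExpr.load 12 (natVar 7)) (NatExpr.load 12 (natVar 7 + NatExpr.const 1))
    (NatExpr.load 10 (natVar 6 + NatExpr.const 1)) ;;
  setRealVar 28 (realVar 22) ;;
  setRealVar 29 (realVar 23) ;;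
  freeInterval 0 1 (NatExpr.load 10 (natVar 6)) (NatExpr.load 10 (natVar 6 + NatExpr.const 1))
    (NatExpr.load 12 (natVar 7 + NatExpr.const 1)) ;;
  Program.branch (Test.or (Test.realLe (realVar 26) (realVar 27))
    (Test.realLe (realVar 24) (realVar 28))) Program.skip (setRealVar 28 (realVar 24)) ;;
  Program.branch (Test.or (Test.realLe (realVar 24) (realVar 25))
    (Test.realLe (realVar 26) (realVar 22))) Program.skip (setRealVar 22 (realVar 26))

/-- Puts the cell above the current one into the queue, if its lower side is nonempty. -/
def enqueue : Program :=
  Program.branch (Test.and (Test.realLe (realVar 22) (realVar 23))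
      (Test.natLe (natVar 7 + NatExpr.const 2) (natVar 13)))
    (Program.storeNat 20 (natVar 19) (natVar 17 + natVar 11) ;;
      Program.storeNat 21 (natVar 19) (natVar 6) ;;
      Program.storeNat 22 (natVar 19) (natVar 7 + NatExpr.const 1) ;;
      Program.storeReal 30 (natVar 19) (realVar 22) ;;
      Program.storeReal 31 (natVar 19) (realVar 23) ;;
      setNatVar 19 (natVar 19 + NatExpr.const 1))
    Program.skip

/-- Moves to the cell to the right or to the first cell of the next row. -/
def moveOn : Program :=
  setNatVar 17 (natVar 17 + NatExpr.const 1) ;;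
  Program.branch (Test.natLe (natVar 6 + NatExpr.const 2) (natVar 11))
    (setRealVar 24 (realVar 28) ;;
      setRealVar 25 (realVar 29) ;;
      setNatVar 6 (natVar 6 + NatExpr.const 1))
    (Program.branch (Test.and (Test.natLe (natVar 13) (natVar 7 + NatExpr.const 1))
        (Test.and (Test.realLe (realVar 28) (realConst 1))
          (Test.realLe (realConst 1) (realVar 29))))
        (setNatVar 23 (NatExpr.const 1)) Program.skip ;;
      setRealVar 24 (realConst 1) ;;
      setRealVar 25 (realConst 0) ;;
      setNatVar 6 (NatExpr.const 0) ;;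
      setNatVar 7 (natVar 7 + NatExpr.const 1))

/-- Explores the reachable cells of the free space of the two simplified curves. -/
def explore : Program :=
  setNatVar 6 (NatExpr.const 0) ;;
  setNatVar 7 (NatExpr.const 0) ;;
  setNatVar 17 (NatExpr.const 0) ;;
  setNatVar 18 (NatExpr.const 0) ;;
  setNatVar 19 (NatExpr.const 0) ;;
  setNatVar 23 (NatExpr.const 0) ;;
  sqDist 0 1 (NatExpr.const 0) (NatExpr.const 0) ;;
  setRealVar 25 (realConst 0) ;;
  Program.branch (Test.realLe (realVar 4) (realVar 18 * realVar 18))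
    (setRealVar 24 (realConst 0)) (setRealVar 24 (realConst 1)) ;;
  Program.loop (Test.or (Test.realLe (realVar 24) (realVar 25))
      (Test.natLe (natVar 18 + NatExpr.const 1) (natVar 19)))
    (fetch ;; crossCell ;; enqueue ;; moveOn)

/-- The variables of natural numbers changed by `explore`. -/
abbrev exploreNatVars : List ℕ := [3, 4, 5, 6, 7, 17, 18, 19, 20, 21, 22, 23]

/-- The variables of real numbers changed by `explore`. -/
abbrev exploreRealVars : List ℕ :=
  [4, 19, 20, 21, 22, 23, 32, 33, 24, 25, 26, 27, 28, 29, 30, 31]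

/-- The memory contains the vertices of the simplified curves and the radius `r`. -/
structure ExploreInput {d : ℕ} (v w : ℕ → EuclideanSpace ℝ (Fin d)) (r : ℝ) (K M : ℕ)
    (σ : Store) : Prop where
  dim : σ.nat 0 0 = d
  len : σ.nat 11 0 = K
  len' : σ.nat 13 0 = M
  radius : σ.real 18 0 = r
  radius_nonneg : 0 ≤ r
  vertex : ∀ k ≤ K, PointAt (σ.real 0) (σ.nat 10 k) (v k)
  vertex' : ∀ k ≤ M, PointAt (σ.real 1) (σ.nat 12 k) (w k)

theorem ExploreInput.frame {d : ℕ} {v w : ℕ → EuclideanSpace ℝ (Fin d)} {r : ℝ} {K M : ℕ}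
    {σ σ' : Store} (h : ExploreInput v w r K M σ) (F : Frame exploreNatVars exploreRealVars σ σ') :
    ExploreInput v w r K M σ' where
  dim := by rw [F.nat 0 (by decide), h.dim]
  len := by rw [F.nat 11 (by decide), h.len]
  len' := by rw [F.nat 13 (by decide), h.len']
  radius := by rw [F.real 18 (by decide), h.radius]
  radius_nonneg := h.radius_nonneg
  vertex := by rw [F.nat 10 (by decide), F.real 0 (by decide)]; exact h.vertex
  vertex' := by rw [F.nat 12 (by decide), F.real 1 (by decide)]; exact h.vertex'

/-- The memory `σ` describes the state of an exploration; the head of the queue is `k`. -/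
def Exploring {d : ℕ} (v w : ℕ → EuclideanSpace ℝ (Fin d)) (r : ℝ) (K M k : ℕ) (σ : Store) : Prop :=
  Exploration v w r K M (σ.nat 17 0) (σ.nat 6 0) (σ.nat 7 0) k (σ.nat 19 0) (σ.real 24 0)
    (σ.real 25 0) (σ.nat 20) (σ.nat 21) (σ.nat 22) (σ.real 30) (σ.real 31) (σ.nat 23 0)

variable {d : ℕ} {v w : ℕ → EuclideanSpace ℝ (Fin d)} {r : ℝ} {K M : ℕ} {σ : Store}
  {Φ : Store → Prop}

/-- The invariant afterwards still refers to the old head `k`, although variable `18` may already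
have advanced; `Exploration.next` accounts for the consumed entry. -/
theorem fetch_ends {k : ℕ} (hk : σ.nat 18 0 = k) (H : Exploring v w r K M k σ)
    (hb : σ.real 24 0 ≤ σ.real 25 0 ∨ k < σ.nat 19 0)
    (hΦ : ∀ σ', Frame [6, 7, 17, 18] [26, 27] σ σ' → Exploring v w r K M k σ' →
      σ.nat 17 0 ≤ σ'.nat 17 0 → σ'.nat 7 0 < M →
      (k < σ'.nat 19 0 ∧ σ'.nat 20 k = σ'.nat 17 0 → σ'.nat 18 0 = k + 1) →
      (¬ (k < σ'.nat 19 0 ∧ σ'.nat 20 k = σ'.nat 17 0) → σ'.nat 18 0 = k) →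
      BottomRep v w r (σ'.nat 6 0) (σ'.nat 7 0) (σ'.real 26 0) (σ'.real 27 0) →
      (σ'.real 24 0 ≤ σ'.real 25 0 ∨ σ'.real 26 0 ≤ σ'.real 27 0) → Φ σ') :
    Ends fetch σ 400 Φ := by
  have load : ∀ σ₁, Frame [6, 7, 17, 18] [26, 27] σ σ₁ → Exploring v w r K M k σ₁ →
      σ₁.nat 18 0 = k → σ.nat 17 0 ≤ σ₁.nat 17 0 → σ₁.nat 7 0 < M →
      (σ₁.real 24 0 ≤ σ₁.real 25 0 ∨ k < σ₁.nat 19 0 ∧ σ₁.nat 20 k = σ₁.nat 17 0) → Ends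
      (Program.branch (Test.and (Test.natLe (natVar 18 + NatExpr.const 1) (natVar 19))
        (Test.and (Test.natLe (NatExpr.load 20 (natVar 18)) (natVar 17))
          (Test.natLe (natVar 17) (NatExpr.load 20 (natVar 18)))))
      (setRealVar 26 (RealExpr.load 30 (natVar 18)) ;;
        setRealVar 27 (RealExpr.load 31 (natVar 18)) ;;
        setNatVar 18 (natVar 18 + NatExpr.const 1))
      (setRealVar 26 (realConst 1) ;; setRealVar 27 (realConst 0))) σ₁ 200 Φ := by
    intro σ₁ F₁ H₁ hk₁ hc hj hl
    refine Ends.branch_le (fun h => ?_) (fun h => ?_)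
    · simp only [Test.holds_and, Test.holds_natLe, NatExpr.eval_add, eval_natVar,
        NatExpr.eval_const, NatExpr.eval_load, hk₁] at h
      have hm : k < σ₁.nat 19 0 ∧ σ₁.nat 20 k = σ₁.nat 17 0 := ⟨h.1, le_antisymm h.2.1 h.2.2⟩
      refine Ends.setRealVar_then (Ends.setRealVar_then (Ends.setNatVar_le ?_))
      refine hΦ _ (((F₁.setReal (by decide) _ _).setReal (by decide) _ _).setNat (by decide) _ _)
        (by simpa [Exploring] using H₁) (by simpa using hc) (by simpa using hj)
        (fun _ => by simp [hk₁]) (fun h' => absurd (by simpa using hm) h') ?_ (.inr ?_)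
      · have := H₁.bottomRep hj (blo := σ₁.real 30 k) (bhi := σ₁.real 31 k)
          (fun _ => ⟨rfl, rfl⟩) (fun h' => absurd hm h')
        simpa [hk₁] using this
      · simpa [hk₁] using H₁.item_ne k hm.1
    · simp only [Test.holds_and, Test.holds_natLe, NatExpr.eval_add, eval_natVar,
        NatExpr.eval_const, NatExpr.eval_load, hk₁] at h
      have hm : ¬ (k < σ₁.nat 19 0 ∧ σ₁.nat 20 k = σ₁.nat 17 0) := fun h' =>
        h ⟨h'.1, h'.2.le, h'.2.ge⟩
      refine Ends.setRealVar_then (Ends.setRealVar_le ?_)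
      refine hΦ _ ((F₁.setReal (by decide) _ _).setReal (by decide) _ _)
        (by simpa [Exploring] using H₁) (by simpa using hc) (by simpa using hj)
        (fun h' => absurd (by simpa using h') hm) (fun _ => by simp [hk₁]) ?_
        (.inl (by simpa using hl.resolve_right hm))
      have := H₁.bottomRep hj (blo := 1) (bhi := 0) (fun h' => absurd h' hm)
          (fun _ => zero_lt_one)
      simpa using this
  refine Ends.branch_then (fun h => Ends.skip_then ((load σ (Frame.refl _ _ σ) H hk le_rfl ?_
    (.inl h)).mono_time (by omega))) (fun h => ?_)
  · simp only [Test.holds_realLe, eval_realVar] at h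
    -- A nonempty left side excludes the row `M` behind the last one.
    exact lt_of_le_of_ne H.j_le fun h' => H.left_end h' h
  · simp only [Test.holds_realLe, eval_realVar] at h
    have hkT := hb.resolve_left h
    refine Ends.assoc (Ends.setNatVar_then (Ends.assoc (Ends.setNatVar_then (Ends.setNatVar_then
      ((load _ ((((Frame.refl _ _ σ).setNat (by decide) _ _).setNat (by decide) _ _).setNat
        (by decide) _ _) ?_ (by simpa using hk) ?_ ?_ (.inr ?_)).mono_time (by omega))))))
    · simpa [Exploring, hk] using H.jump h hkT
    · simpa [hk] using H.le_head k le_rfl hkT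
    · simpa [hk] using (H.item_j k hkT).2
    · simpa [hk] using hkT

theorem stableEval_load (σ : Store) {a b : ℕ} (ha : a ∉ [3, 4, 5]) (hb : b ∉ [3, 4, 5]) (c : ℕ) :
    StableEval σ (NatExpr.load a (natVar b + NatExpr.const c)) (σ.nat a (σ.nat b 0 + c)) := by
  intro σ' F
  simp [F.nat a ha, F.nat b hb]

theorem stableEval_load_zero (σ : Store) {a b : ℕ} (ha : a ∉ [3, 4, 5]) (hb : b ∉ [3, 4, 5]) :
    StableEval σ (NatExpr.load a (natVar b)) (σ.nat a (σ.nat b 0)) := by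
  intro σ' F
  simp [F.nat a ha, F.nat b hb]

/-- The free interval of an exit side is its reachable part, except that its lower end is raised if
the cell can be entered only from the opposite side. -/
theorem crossCell_ends {i j : ℕ} {llo lhi blo bhi : ℝ} (S : ExploreInput v w r K M σ)
    (hi : σ.nat 6 0 = i) (hj : σ.nat 7 0 = j) (hiK : i < K) (hjM : j < M)
    (h24 : σ.real 24 0 = llo) (h25 : σ.real 25 0 = lhi) (h26 : σ.real 26 0 = blo)
    (h27 : σ.real 27 0 = bhi) (A : Adequate v w r i j llo lhi blo bhi)
    (hne : llo ≤ lhi ∨ blo ≤ bhi)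
    (hΦ : ∀ σ', Frame [3, 4, 5] [4, 19, 20, 21, 22, 23, 32, 33, 28, 29] σ σ' →
      LeftRep v w r (i + 1) j (σ'.real 28 0) (σ'.real 29 0) →
      BottomRep v w r i (j + 1) (σ'.real 22 0) (σ'.real 23 0) → Φ σ') :
    Ends crossCell σ (2500 * (d + 1)) Φ := by
  have hsub : freeIntervalVars ⊆ [4, 19, 20, 21, 22, 23, 32, 33, 28, 29] := by decide
  refine Ends.then_le (1000 * (d + 1)) (freeInterval_ends (by omega) (by omega) S.dim
    (stableEval_load_zero σ (by decide) (by decide)) (stableEval_load σ (by decide) (by decide) 1)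
    (stableEval_load σ (by decide) (by decide) 1) (Nat.le_of_ble_eq_true rfl)
    (Nat.le_of_ble_eq_true rfl) (Nat.le_of_ble_eq_true rfl)
    (by rw [hj]; exact S.vertex' j hjM.le) (by rw [hj]; exact S.vertex' (j + 1) hjM)
    (by rw [hi]; exact S.vertex (i + 1) hiK) S.radius S.radius_nonneg ?_)
  intro σ₁ F₁ free₁
  refine Ends.setRealVar_then (Ends.setRealVar_then ?_)
  have F₁' := ((F₁.mono (fun _ h => h) hsub).setReal (a := 28) (by decide) 0
    ((realVar 22).eval σ₁)).setReal (a := 29) (by decide) 0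
      ((realVar 23).eval (σ₁.setReal 28 0 ((realVar 22).eval σ₁)))
  generalize hσ₂ : Store.setReal _ 29 0 _ = σ₂ at F₁' ⊢
  have g28 : σ₂.real 28 0 = σ₁.real 22 0 := by rw [← hσ₂]; simp
  have g29 : σ₂.real 29 0 = σ₁.real 23 0 := by rw [← hσ₂]; simp
  have S₂ := S.frame (F₁'.mono (by decide) (by decide))
  have hi₂ : σ₂.nat 6 0 = i := by rw [F₁'.nat 6 (by decide), hi]
  have hj₂ : σ₂.nat 7 0 = j := by rw [F₁'.nat 7 (by decide), hj]
  refine Ends.then_le (1000 * (d + 1)) (freeInterval_ends (by omega) (by omega) S₂.dim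
    (stableEval_load_zero σ₂ (by decide) (by decide)) (stableEval_load σ₂ (by decide) (by decide) 1)
    (stableEval_load σ₂ (by decide) (by decide) 1) (Nat.le_of_ble_eq_true rfl)
    (Nat.le_of_ble_eq_true rfl) (Nat.le_of_ble_eq_true rfl)
    (by rw [hi₂]; exact S₂.vertex i hiK.le) (by rw [hi₂]; exact S₂.vertex (i + 1) hiK)
    (by rw [hj₂]; exact S₂.vertex' (j + 1) hjM) S₂.radius S.radius_nonneg ?_)
  intro σ₃ F₃ free₃
  have F₃' := F₁'.trans (F₃.mono (fun _ h => h) hsub)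
  have k28 : σ₃.real 28 0 = σ₁.real 22 0 := by rw [F₃.real 28 (by decide), g28]
  have k29 : σ₃.real 29 0 = σ₁.real 23 0 := by rw [F₃.real 29 (by decide), g29]
  have k24 : σ₃.real 24 0 = llo := by rw [F₃'.real 24 (by decide), h24]
  have k25 : σ₃.real 25 0 = lhi := by rw [F₃'.real 25 (by decide), h25]
  have k26 : σ₃.real 26 0 = blo := by rw [F₃'.real 26 (by decide), h26]
  have k27 : σ₃.real 27 0 = bhi := by rw [F₃'.real 27 (by decide), h27]
  have top : ∀ σ₄, Frame [3, 4, 5] [4, 19, 20, 21, 22, 23, 32, 33, 28, 29] σ σ₄ →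
      Frame [] [28] σ₃ σ₄ → LeftRep v w r (i + 1) j (σ₄.real 28 0) (σ₄.real 29 0) →
      Ends (Program.branch (Test.or (Test.realLe (realVar 24) (realVar 25))
        (Test.realLe (realVar 26) (realVar 22))) Program.skip (setRealVar 22 (realVar 26)))
        σ₄ 100 Φ := by
    intro σ₄ F₄ G₄ L
    have l22 : σ₄.real 22 0 = σ₃.real 22 0 := by rw [G₄.real 22 (by decide)]
    have l23 : σ₄.real 23 0 = σ₃.real 23 0 := by rw [G₄.real 23 (by decide)]
    have l24 : σ₄.real 24 0 = llo := by rw [G₄.real 24 (by decide), k24]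
    have l25 : σ₄.real 25 0 = lhi := by rw [G₄.real 25 (by decide), k25]
    have l26 : σ₄.real 26 0 = blo := by rw [G₄.real 26 (by decide), k26]
    rw [← l22, ← l23] at free₃
    refine Ends.branch_le (fun h => Ends.skip_le ?_) (fun h => Ends.setRealVar_le ?_)
    · simp only [Test.holds_or, Test.holds_realLe, eval_realVar, l24, l25, l26] at h
      exact hΦ σ₄ F₄ L (A.bottomRep_succ hne free₃ (fun _ => rfl)
        (fun h' => (max_eq_left (h.resolve_left h')).symm))
    · simp only [Test.holds_or, Test.holds_realLe, eval_realVar, l24, l25, l26, not_or] at h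
      refine hΦ _ (F₄.setReal (by decide) _ _) (by simpa using L) ?_
      simp only [Store.real_setReal_self, Function.update_self, eval_realVar, l26, ne_eq,
        Nat.reduceEqDiff, not_false_eq_true, Store.real_setReal_of_ne]
      exact A.bottomRep_succ hne free₃ (fun h' => absurd h' h.1)
        (fun _ => (max_eq_right (not_le.1 h.2).le).symm)
  rw [← k28, ← k29] at free₁
  refine Ends.branch_then (fun h => Ends.skip_then ((top σ₃ F₃' (Frame.refl _ _ _) ?_).mono_time
    (by omega))) (fun h => Ends.setRealVar_then ((top _ (F₃'.setReal (by decide) _ _)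
      ((Frame.refl _ _ _).setReal (by decide) _ _) ?_).mono_time (by omega)))
  · simp only [Test.holds_or, Test.holds_realLe, eval_realVar, k24, k26, k27] at h
    exact A.leftRep_succ hne free₁ (fun _ => rfl)
      (fun h' => (max_eq_left (h.resolve_left h')).symm)
  · simp only [Test.holds_or, Test.holds_realLe, eval_realVar, k24, k26, k27, not_or] at h
    simp only [Store.real_setReal_self, Function.update_self, eval_realVar, k24, ne_eq,
        Nat.reduceEqDiff, not_false_eq_true, Store.real_setReal_of_ne]
    exact A.leftRep_succ hne free₁ (fun h' => absurd h' h.1)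
        (fun _ => (max_eq_right (not_le.1 h.2).le).symm)

theorem enqueue_ends {T c i j : ℕ} {tlo thi : ℝ} (hK : σ.nat 11 0 = K) (hM : σ.nat 13 0 = M)
    (hT : σ.nat 19 0 = T) (hc : σ.nat 17 0 = c) (hi : σ.nat 6 0 = i) (hj : σ.nat 7 0 = j)
    (h22 : σ.real 22 0 = tlo) (h23 : σ.real 23 0 = thi)
    (hΦ : ∀ σ', Frame [19, 20, 21, 22] [30, 31] σ σ' →
      (tlo ≤ thi ∧ j + 2 ≤ M → σ'.nat 19 0 = T + 1 ∧
        σ'.nat 20 = Function.update (σ.nat 20) T (c + K) ∧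
        σ'.nat 21 = Function.update (σ.nat 21) T i ∧
        σ'.nat 22 = Function.update (σ.nat 22) T (j + 1) ∧
        σ'.real 30 = Function.update (σ.real 30) T tlo ∧
        σ'.real 31 = Function.update (σ.real 31) T thi) →
      (¬ (tlo ≤ thi ∧ j + 2 ≤ M) → σ'.nat 19 0 = T ∧ σ'.nat 20 = σ.nat 20 ∧
        σ'.nat 21 = σ.nat 21 ∧ σ'.nat 22 = σ.nat 22 ∧ σ'.real 30 = σ.real 30 ∧
        σ'.real 31 = σ.real 31) → Φ σ') :
    Ends enqueue σ 400 Φ := by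
  refine Ends.branch_le (fun h => ?_) (fun h => Ends.skip_le ?_)
  · simp only [Test.holds_and, Test.holds_natLe, Test.holds_realLe, NatExpr.eval_add, eval_natVar,
      NatExpr.eval_const, eval_realVar, h22, h23, hj, hM] at h
    refine Ends.storeNat_then (Ends.storeNat_then (Ends.storeNat_then (Ends.storeReal_then
      (Ends.storeReal_then (Ends.setNatVar_le (hΦ _ ((((((Frame.refl _ _ σ).setNat (by decide)
        _ _).setNat (by decide) _ _).setNat (by decide) _ _).setReal (by decide) _ _).setReal
          (by decide) _ _ |>.setNat (by decide) _ _) (fun _ => ?_) (fun h' => absurd h h')))))))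
    simp [hT, hc, hi, hj, hK, h22, h23]
  · simp only [Test.holds_and, Test.holds_natLe, Test.holds_realLe, NatExpr.eval_add, eval_natVar,
      NatExpr.eval_const, eval_realVar, h22, h23, hj, hM] at h
    exact hΦ σ (Frame.refl _ _ σ) (fun h' => absurd h' h)
      (fun _ => ⟨hT, rfl, rfl, rfl, rfl, rfl⟩)

theorem moveOn_ends {i j : ℕ} {rlo rhi : ℝ} (hK : σ.nat 11 0 = K) (hM : σ.nat 13 0 = M)
    (hi : σ.nat 6 0 = i) (hj : σ.nat 7 0 = j) (h28 : σ.real 28 0 = rlo) (h29 : σ.real 29 0 = rhi)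
    (hΦ : ∀ σ', Frame [6, 7, 17, 23] [24, 25] σ σ' → σ'.nat 17 0 = σ.nat 17 0 + 1 →
      (i + 2 ≤ K → σ'.nat 6 0 = i + 1 ∧ σ'.nat 7 0 = j ∧ σ'.real 24 0 = rlo ∧ σ'.real 25 0 = rhi ∧
        σ'.nat 23 0 = σ.nat 23 0) →
      (¬ i + 2 ≤ K → σ'.nat 6 0 = 0 ∧ σ'.nat 7 0 = j + 1 ∧ σ'.real 25 0 < σ'.real 24 0 ∧
        (M ≤ j + 1 ∧ rlo ≤ 1 ∧ 1 ≤ rhi → σ'.nat 23 0 = 1) ∧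
        (¬ (M ≤ j + 1 ∧ rlo ≤ 1 ∧ 1 ≤ rhi) → σ'.nat 23 0 = σ.nat 23 0)) → Φ σ') :
    Ends moveOn σ 400 Φ := by
  refine Ends.setNatVar_then (Ends.branch_le (fun h => ?_) (fun h => ?_))
  · have h' : i + 2 ≤ K := by simpa [hi, hK] using h
    refine Ends.setRealVar_then (Ends.setRealVar_then (Ends.setNatVar_le (hΦ _
      (((((Frame.refl _ _ σ).setNat (by decide) _ _).setReal (by decide) _ _).setReal
        (by decide) _ _).setNat (by decide) _ _) (by simp) (fun _ => ?_)
        (fun h'' => absurd h' h''))))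
    simp [hi, hj, h28, h29]
  · have h' : ¬ i + 2 ≤ K := by simpa [hi, hK] using h
    refine Ends.branch_then (fun hc => ?_) (fun hc => ?_)
    · have hc' : M ≤ j + 1 ∧ rlo ≤ 1 ∧ 1 ≤ rhi := by simpa [hj, hM, h28, h29] using hc
      refine Ends.setNatVar_then (Ends.setRealVar_then (Ends.setRealVar_then (Ends.setNatVar_then
        (Ends.setNatVar_le (hΦ _ ((((((Frame.refl _ _ σ).setNat (by decide) _ _).setNat (by decide)
          _ _).setReal (by decide) _ _).setReal (by decide) _ _).setNat (by decide) _ _ |>.setNat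
            (by decide) _ _) (by simp) (fun h'' => absurd h'' h') (fun _ => ?_))))))
      simp [hj, hc']
    · have hc' : ¬ (M ≤ j + 1 ∧ rlo ≤ 1 ∧ 1 ≤ rhi) := by
        simpa only [Test.holds_and, Test.holds_natLe, Test.holds_realLe, NatExpr.eval_add,
          eval_natVar, NatExpr.eval_const, eval_realVar, eval_realConst, Nat.cast_one,
          Store.real_setNat, h28, h29, ne_eq, Nat.reduceEqDiff, not_false_eq_true,
          Store.nat_setNat_of_ne, hj, hM] using hc
      refine Ends.skip_then (Ends.setRealVar_then (Ends.setRealVar_then (Ends.setNatVar_then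
        (Ends.setNatVar_le (hΦ _ (((((Frame.refl _ _ σ).setNat (by decide) _ _).setReal (by decide)
          _ _).setReal (by decide) _ _).setNat (by decide) _ _ |>.setNat
            (by decide) _ _) (by simp) (fun h'' => absurd h'' h') (fun _ => ?_))))))
      exact ⟨by simp, by simp [hj], by simp, fun h'' => absurd h'' hc', fun _ => by simp⟩

theorem exploreStep_ends (S : ExploreInput v w r K M σ)
    (H : Exploring v w r K M (σ.nat 18 0) σ)
    (hb : σ.real 24 0 ≤ σ.real 25 0 ∨ σ.nat 18 0 < σ.nat 19 0)
    (hΦ : ∀ σ', Frame exploreNatVars exploreRealVars σ σ' → Exploring v w r K M (σ'.nat 18 0) σ' →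
      Exploration.remaining v w r K M (σ'.nat 17 0) <
        Exploration.remaining v w r K M (σ.nat 17 0) → Φ σ') :
    Ends (fetch ;; crossCell ;; enqueue ;; moveOn) σ (4000 * (d + 1)) Φ := by
  refine Ends.then_le 400 (fetch_ends rfl H hb ?_)
  intro σ₁ F₁ H₁ hc hjM hk hk' hB hne
  have G₁ : Frame exploreNatVars exploreRealVars σ σ₁ := F₁.mono (by decide) (by decide)
  have A : Adequate v w r _ _ _ _ _ _ := LeftRep.adequate H₁.left hB
  refine Ends.then_le (2500 * (d + 1)) (crossCell_ends (S.frame G₁) rfl rfl H₁.i_lt hjM rfl rfl rfl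
    rfl A hne ?_)
  intro σ₂ F₂ hL hB'
  have G₂ : Frame exploreNatVars exploreRealVars σ σ₂ := G₁.trans (F₂.mono (by decide) (by decide))
  have S₂ := S.frame G₂
  refine Ends.then_le 400 (enqueue_ends S₂.len S₂.len' rfl rfl rfl rfl rfl rfl ?_)
  intro σ₃ F₃ hpush hpush'
  have G₃ : Frame exploreNatVars exploreRealVars σ σ₃ := G₂.trans (F₃.mono (by decide) (by decide))
  have S₃ := S.frame G₃
  refine (moveOn_ends S₃.len S₃.len' rfl rfl rfl rfl ?_).mono_time (by omega)
  intro σ₄ F₄ hc₄ hin hend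
  rw [F₂.nat 7 (by decide), F₂.nat 6 (by decide), F₂.nat 17 (by decide), F₂.nat 19 (by decide),
    F₂.nat 20 (by decide), F₂.nat 21 (by decide), F₂.nat 22 (by decide), F₂.real 30 (by decide),
    F₂.real 31 (by decide), ← F₄.nat 19 (by decide), ← F₄.nat 20 (by decide),
    ← F₄.nat 21 (by decide), ← F₄.nat 22 (by decide), ← F₄.real 30 (by decide),
    ← F₄.real 31 (by decide)] at hpush
  rw [F₂.nat 7 (by decide), F₂.nat 19 (by decide),
    F₂.nat 20 (by decide), F₂.nat 21 (by decide), F₂.nat 22 (by decide), F₂.real 30 (by decide),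
    F₂.real 31 (by decide), ← F₄.nat 19 (by decide), ← F₄.nat 20 (by decide),
    ← F₄.nat 21 (by decide), ← F₄.nat 22 (by decide), ← F₄.real 30 (by decide),
    ← F₄.real 31 (by decide)] at hpush'
  rw [F₃.nat 6 (by decide), F₃.nat 7 (by decide), F₃.nat 23 (by decide), F₂.nat 6 (by decide),
    F₂.nat 7 (by decide), F₂.nat 23 (by decide), F₃.real 28 (by decide), F₃.real 29 (by decide)]
    at hin hend
  rw [F₃.nat 17 (by decide), F₂.nat 17 (by decide)] at hc₄
  have e18 : σ₄.nat 18 0 = σ₁.nat 18 0 := by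
    rw [F₄.nat 18 (by decide), F₃.nat 18 (by decide), F₂.nat 18 (by decide)]
  refine hΦ σ₄ (G₃.trans (F₄.mono (by decide) (by decide))) ?_ ?_
  · rw [e18]
    exact H₁.next hjM hL hB' hc₄ hk hk' hpush hpush' hin hend
  · rw [hc₄]
    exact Exploration.remaining_lt H₁.i_lt hjM H₁.key hc (A.cellReachable_iff.2 hne)

/-- The bound `B` serves only the time estimate: there are at most as many iterations as reachable
cells, each with time linear in `d`. -/
theorem explore_ends (S : ExploreInput v w r K M σ) (hK : 1 ≤ K) (hM : 1 ≤ M)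
    (h0 : PointAt (σ.real 0) 0 (v 0)) (h0' : PointAt (σ.real 1) 0 (w 0)) {B : ℕ}
    (hB : (reachableCells v w r K M).card ≤ B)
    (hΦ : ∀ σ', Frame exploreNatVars exploreRealVars σ σ' →
      (σ'.nat 23 0 = 1 ↔ Reachable v w r K M) → Φ σ') :
    Ends explore σ (5000 * (B + 1) * (d + 1)) Φ := by
  have hbudget : 600 * (d + 1) + (B + 1) * (4000 * (d + 1) + 40) ≤ 5000 * (B + 1) * (d + 1) := by
    have e₁ : (B + 1) * (4000 * (d + 1) + 40) = 4000 * (B * d) + 4040 * B + 4000 * d + 4040 := by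
      ring
    have e₂ : 5000 * (B + 1) * (d + 1) = 5000 * (B * d) + 5000 * B + 5000 * d + 5000 := by ring
    omega
  suffices key : ∀ U, 600 * (d + 1) + (B + 1) * (4000 * (d + 1) + 40) ≤ U → Ends explore σ U Φ from
    key _ hbudget
  clear hbudget
  intro U hbudget
  refine Ends.setNatVar_then (Ends.setNatVar_then (Ends.setNatVar_then (Ends.setNatVar_then
    (Ends.setNatVar_then (Ends.setNatVar_then ?_)))))
  refine sqDist_then (d := d) (o := 0) (o' := 0) (by omega) (by omega) (by simp [S.dim]) (by simp)
    (by simp) (Nat.le_of_ble_eq_true rfl) (Nat.le_of_ble_eq_true rfl) ?_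
  intro σ₁ F₁ v₁
  simp only [NatExpr.eval_const, Store.real_setNat] at F₁ v₁
  rw [sqDistAt_eq h0 h0'] at v₁
  have F₁' : Frame exploreNatVars exploreRealVars σ σ₁ := by
    refine Frame.trans ?_ (F₁.mono (by decide) (by decide))
    exact ((((((Frame.refl _ _ σ).setNat (by decide) _ _).setNat (by decide) _ _).setNat (by decide)
      _ _).setNat (by decide) _ _).setNat (by decide) _ _).setNat (by decide) _ _
  have e6 : σ₁.nat 6 0 = 0 := by simp [F₁.nat 6 (by decide)]
  have e7 : σ₁.nat 7 0 = 0 := by simp [F₁.nat 7 (by decide)]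
  have e17 : σ₁.nat 17 0 = 0 := by simp [F₁.nat 17 (by decide)]
  have e18 : σ₁.nat 18 0 = 0 := by simp [F₁.nat 18 (by decide)]
  have e19 : σ₁.nat 19 0 = 0 := by simp [F₁.nat 19 (by decide)]
  have e23 : σ₁.nat 23 0 = 0 := by simp [F₁.nat 23 (by decide)]
  have hrad : σ₁.real 18 0 = r := (S.frame F₁').radius
  have run : ∀ σ₂, Frame exploreNatVars exploreRealVars σ σ₂ → σ₂.nat = σ₁.nat →
      (dist (v 0) (w 0) ≤ r → σ₂.real 24 0 = 0 ∧ σ₂.real 25 0 = 0) →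
      (¬ dist (v 0) (w 0) ≤ r → σ₂.real 25 0 < σ₂.real 24 0) → Ends
      (Program.loop (Test.or (Test.realLe (realVar 24) (realVar 25))
        (Test.natLe (natVar 18 + NatExpr.const 1) (natVar 19)))
        (fetch ;; crossCell ;; enqueue ;; moveOn)) σ₂ (U - 500 * (d + 1)) Φ := by
    intro σ₂ F₂ hnat hyes hno
    let I : ℕ → Store → Prop := fun u σ' => Frame exploreNatVars exploreRealVars σ σ' ∧
      Exploring v w r K M (σ'.nat 18 0) σ' ∧
      Exploration.remaining v w r K M (σ'.nat 17 0) ≤ u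
    refine Ends.loop_le (4000 * (d + 1)) I (v := B) ?_ ?_ ?_ (by omega)
    · refine ⟨F₂, ?_, (Exploration.remaining_le _ _ _ _ _ _).trans hB⟩
      rw [Exploring, hnat, e6, e7, e17, e18, e19, e23]
      exact Exploration.init hK hM _ _ _ _ _ hyes hno
    · rintro u σ₃ ⟨F₃, H, hu⟩ hb
      simp only [Test.holds_or, Test.holds_natLe, Test.holds_realLe, NatExpr.eval_add, eval_natVar,
        NatExpr.eval_const, eval_realVar] at hb
      exact exploreStep_ends (S.frame F₃) H hb fun σ₄ F₄ H₄ hlt =>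
        ⟨_, hlt.trans_le hu, F₃.trans F₄, H₄, le_rfl⟩
    · rintro u σ₃ ⟨F₃, H, hu⟩ hb
      simp only [Test.holds_or, Test.holds_natLe, Test.holds_realLe, NatExpr.eval_add, eval_natVar,
        NatExpr.eval_const, eval_realVar, not_or] at hb
      exact hΦ σ₃ F₃ (H.finish hM hb.1 (by omega))
  refine Ends.setRealVar_then (Ends.branch_then (fun h => ?_) (fun h => ?_))
  · have h' : dist (v 0) (w 0) ≤ r := by
      simp only [Test.holds_realLe, eval_realVar, RealExpr.eval_mul, ne_eq, Nat.reduceEqDiff,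
        not_false_eq_true, Store.real_setReal_of_ne, v₁, hrad] at h
      rwa [← pow_two, sq_le_sq₀ dist_nonneg S.radius_nonneg] at h
    refine Ends.setRealVar_then ((run _ ((F₁'.setReal (by decide) _ _).setReal (by decide) _ _) rfl
      (fun _ => by simp) (fun h'' => absurd h' h'')).mono_time (by omega))
  · have h' : ¬ dist (v 0) (w 0) ≤ r := by
      simp only [Test.holds_realLe, eval_realVar, RealExpr.eval_mul, ne_eq, Nat.reduceEqDiff,
        not_false_eq_true, Store.real_setReal_of_ne, v₁, hrad] at h
      rwa [← pow_two, sq_le_sq₀ dist_nonneg S.radius_nonneg] at h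
    refine Ends.setRealVar_then ((run _ ((F₁'.setReal (by decide) _ _).setReal (by decide) _ _) rfl
      (fun h'' => absurd h'' h') (fun _ => by simp)).mono_time (by omega))

end RealRAM

/-! ### The approximation algorithm -/

namespace RealRAM

open PolygonalCurve

/-- Compares the Fréchet distance with the distance in the variable `16`; the result is put into
the variable `23`. -/
def testDistance : Program :=
  setRealVar 17 (realVar 2 * realVar 16 / realConst 12) ;;
  setRealVar 18 (realVar 16 + realConst 2 * realVar 17) ;;
  simplify 0 1 10 11 ;;
  simplify 1 2 12 13 ;;
  explore

/-- The algorithm: bisection, started with the distance from the traversal by arc length. -/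
def approximateFrechet : Program :=
  repeatLast 0 1 ;;
  repeatLast 1 2 ;;
  walk ;;
  setRealVar 15 (realVar 7) ;;
  setRealVar 14 (realVar 7 /
    (realConst 2 * RealExpr.ofNat (natVar 1 + natVar 2) + realConst 1)) ;;
  Program.loop (Test.not (Test.realLe (realVar 15)
      ((realConst 1 + realVar 2 / realConst 3) * realVar 14)))
    (setRealVar 16 ((realVar 14 + realVar 15) / realConst 2) ;;
      testDistance ;;
      Program.branch (Test.and (Test.natLe (NatExpr.const 1) (natVar 23))
          (Test.natLe (natVar 23) (NatExpr.const 1)))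
        (setRealVar 15 (realVar 16)) (setRealVar 14 (realVar 16))) ;;
  setRealVar 3 ((realConst 1 + realVar 2 / realConst 3) * realVar 15)

/-- Simplified at any scale, the free space of the two curves has at most `B` reachable cells. -/
def CellBound {d n m : ℕ} (p : Fin n → EuclideanSpace ℝ (Fin d))
    (q : Fin m → EuclideanSpace ℝ (Fin d)) (ε : ℝ) (B : ℕ) : Prop :=
  ∀ (δ : ℝ) (K M : ℕ) (a b : ℕ → ℕ), 0 < δ → IsSimplification (ext p) n K a (ε * δ / 12) →
    IsSimplification (ext q) m M b (ε * δ / 12) →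
    (reachableCells (fun k => ext p (a k)) (fun k => ext q (b k)) (δ + 2 * (ε * δ / 12)) K
      M).card ≤ B

variable {d n m : ℕ} {p : Fin n → EuclideanSpace ℝ (Fin d)} {q : Fin m → EuclideanSpace ℝ (Fin d)}
  {ε : ℝ}

/-- The trivial bound ensures that a least cell bound exists, whatever is known about packedness. -/
theorem cellBound_mul (p : Fin n → EuclideanSpace ℝ (Fin d)) (q : Fin m → EuclideanSpace ℝ (Fin d))
    (ε : ℝ) : CellBound p q ε (n * m) := by
  intro δ K M a b _ hv hw
  refine (Finset.card_le_card (t := Finset.range n ×ˢ Finset.range m) ?_).trans (by simp)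
  rintro ⟨i, j⟩ h
  have h' := (mem_reachableCells.1 h).1
  have h1 := hv.le_length
  have h2 := hw.le_length
  simp only [Finset.mem_product, Finset.mem_range]
  omega

theorem CellBound.symm {B : ℕ} (h : CellBound p q ε B) : CellBound q p ε B := by
  intro δ K M a b hδ hv hw
  rw [card_reachableCells_symm]
  exact h δ M K b a hδ hw hv

theorem cellBound_of_isPacked (q : Fin m → EuclideanSpace ℝ (Fin d)) {c : ℝ} (hn : 1 ≤ n)
    (hε : 0 < ε) (hε1 : ε ≤ 1) (hc : 1 ≤ c) (hp : IsPacked c p) :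
    CellBound p q ε ⌊278 * (c * ((n + m) / ε))⌋₊ := by
  intro δ K M a b hδ hv hw
  refine Nat.le_floor ?_
  have hμ : 0 < ε * δ / 12 := by positivity
  have hr : 0 ≤ δ + 2 * (ε * δ / 12) := by positivity
  -- With `μ = εδ/12` the left side is `δ + 3μ ≤ 5/4 δ = (15/ε) μ`, so `κ = 15/ε` and `18κ + 8 ≤
  -- 278/ε`.
  have hκ : δ + 2 * (ε * δ / 12) + ε * δ / 12 ≤ 15 / ε * (ε * δ / 12) := by
    have e : 15 / ε * (ε * δ / 12) = 5 / 4 * δ := by field_simp; norm_num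
    rw [e]
    nlinarith
  refine (card_reachableCells_le hp hn hc hμ hr hv hw hκ).trans ?_
  have h1 : (K : ℝ) + M ≤ n + m := by
    have := hv.le_length
    have := hw.le_length
    exact_mod_cast (by omega : K + M ≤ n + m)
  have h2 : 18 * (15 / ε) + 8 ≤ 278 / ε := by
    rw [le_div_iff₀ hε, add_mul, mul_assoc, div_mul_cancel₀ _ hε.ne']
    linarith
  calc c * (18 * (15 / ε) + 8) * (K + M) ≤ c * (278 / ε) * (n + m) := by gcongr
    _ = 278 * (c * ((n + m) / ε)) := by ring

/-- The variables of natural numbers changed by `testDistance`. -/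
abbrev testNatVars : List ℕ :=
  [3, 4, 5, 14, 15, 16, 10, 11, 12, 13, 6, 7, 17, 18, 19, 20, 21, 22, 23]

/-- The variables of real numbers changed by `testDistance`. -/
abbrev testRealVars : List ℕ :=
  [17, 18, 4, 19, 20, 21, 22, 23, 32, 33, 24, 25, 26, 27, 28, 29, 30, 31]

/-- The memory contains the input, with the last vertices of the curves repeated. -/
structure HoldsInput (p : Fin n → EuclideanSpace ℝ (Fin d)) (q : Fin m → EuclideanSpace ℝ (Fin d))
    (ε : ℝ) (σ : Store) : Prop where
  dim : σ.nat 0 0 = d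
  len : σ.nat 1 0 = n
  len' : σ.nat 2 0 = m
  curve : CurveAt (σ.real 0) p
  curve' : CurveAt (σ.real 1) q
  eps : σ.real 2 0 = ε

theorem HoldsInput.frame {σ σ' : Store} {Ns Rs : List ℕ} (h : HoldsInput p q ε σ)
    (F : Frame Ns Rs σ σ') (h0 : 0 ∉ Ns) (h1 : 1 ∉ Ns) (h2 : 2 ∉ Ns) (h0' : 0 ∉ Rs) (h1' : 1 ∉ Rs)
    (h2' : 2 ∉ Rs) : HoldsInput p q ε σ' where
  dim := by rw [F.nat 0 h0, h.dim]
  len := by rw [F.nat 1 h1, h.len]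
  len' := by rw [F.nat 2 h2, h.len']
  curve := by rw [F.real 0 h0']; exact h.curve
  curve' := by rw [F.real 1 h1']; exact h.curve'
  eps := by rw [F.real 2 h2', h.eps]

/-- A chain for some radius below `δ` survives simplification at radius `δ + 2μ`, so a negative
answer gives `δ ≤ d_F`. A positive answer is carried back at the cost of another `2μ`, and `4μ =
εδ/3`. -/
theorem testDistance_ends {σ : Store} {δ r₀ : ℝ} {B : ℕ} {Φ : Store → Prop} (hn : 1 ≤ n)
    (hm : 1 ≤ m) (hε : 0 < ε) (S : HoldsInput p q ε σ) (hδ : σ.real 16 0 = δ) (hδ0 : 0 < δ)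
    (hB : CellBound p q ε B) (h₀ : Reachable (ext p) (ext q) r₀ n m)
    (hΦ : ∀ σ', Frame testNatVars testRealVars σ σ' →
      (σ'.nat 23 0 = 1 → frechetDist p q ≤ (1 + ε / 3) * δ) →
      (σ'.nat 23 0 ≠ 1 → δ ≤ frechetDist p q) → Φ σ') :
    Ends testDistance σ (5000 * (n + m + B + 2) * (d + 1)) Φ := by
  have hbudget : 80 + (1000 * (n + 1) * (d + 1) + (1000 * (m + 1) * (d + 1) +
      5000 * (B + 1) * (d + 1))) ≤ 5000 * (n + m + B + 2) * (d + 1) := by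
    have e : 5000 * (n + m + B + 2) * (d + 1) = 1000 * (n + 1) * (d + 1) + (1000 * (m + 1) * (d + 1) +
      5000 * (B + 1) * (d + 1)) + (4000 * (n + m) * (d + 1) + 3000 * (d + 1)) := by ring
    refine le_trans ?_ e.ge
    omega
  refine Ends.mono_time ?_ hbudget
  clear hbudget
  refine Ends.setRealVar_then (Ends.setRealVar_then ?_)
  have F₁ := ((Frame.refl testNatVars testRealVars σ).setReal (a := 17) (by decide) 0
    ((realVar 2 * realVar 16 / realConst 12).eval σ)).setReal (a := 18) (by decide) 0
    ((realVar 16 + realConst 2 * realVar 17).eval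
      (σ.setReal 17 0 ((realVar 2 * realVar 16 / realConst 12).eval σ)))
  generalize hσ₁ : Store.setReal _ 18 0 _ = σ₁ at F₁ ⊢
  have h17 : σ₁.real 17 0 = ε * δ / 12 := by rw [← hσ₁]; simp [S.eps, hδ]
  have h18 : σ₁.real 18 0 = δ + 2 * (ε * δ / 12) := by rw [← hσ₁]; simp [S.eps, hδ]
  have hμ : 0 < ε * δ / 12 := by positivity
  have S₁ := S.frame F₁ (by decide) (by decide) (by decide) (by decide) (by decide) (by decide)
  refine Ends.mono_time (Ends.seq (T := 1000 * (n + 1) * (d + 1)) (Ends.mono_time ?_ le_rfl))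
    (T := 1000 * (n + 1) * (d + 1) + (1000 * (m + 1) * (d + 1) + 5000 * (B + 1) * (d + 1)))
    (by omega)
  refine simplify_ends (by omega) (by omega) (.inl rfl) (.inl rfl) hn S₁.dim S₁.len S₁.curve h17
    hμ.le ?_
  intro σ₂ K a F₂ hv hK hSP
  have F₂' := F₁.trans (F₂.mono (Ns' := testNatVars) (Rs' := testRealVars) (by decide) (by decide))
  have S₂ := S.frame F₂' (by decide) (by decide) (by decide) (by decide) (by decide) (by decide)
  refine Ends.seq ?_
  refine simplify_ends (by omega) (by omega) (.inr rfl) (.inr rfl) hm S₂.dim S₂.len' S₂.curve'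
    (by rw [F₂.real 17 (by decide), h17]) hμ.le ?_
  intro σ₃ M b F₃ hw hM hSQ
  have F₃' := F₂'.trans (F₃.mono (Ns' := testNatVars) (Rs' := testRealVars) (by decide) (by decide))
  have S₃ := S.frame F₃' (by decide) (by decide) (by decide) (by decide) (by decide) (by decide)
  have a_le : ∀ k ≤ K, a k ≤ n := fun k hk => hv.last ▸ hv.le_of_le hk le_rfl
  have b_le : ∀ k ≤ M, b k ≤ m := fun k hk => hw.last ▸ hw.le_of_le hk le_rfl
  have E : ExploreInput (fun k => ext p (a k)) (fun k => ext q (b k)) (δ + 2 * (ε * δ / 12)) K M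
      σ₃ := by
    refine ⟨S₃.dim, by rw [F₃.nat 11 (by decide), hK], hM,
      by rw [F₃.real 18 (by decide), F₂.real 18 (by decide), h18], by positivity,
      fun k hk => ?_, fun k hk => ?_⟩
    · rw [F₃.nat 10 (by decide), hSP k hk]
      exact S₃.curve _ (a_le k hk)
    · rw [hSQ k hk]
      exact S₃.curve' _ (b_le k hk)
  refine explore_ends E (hv.pos hn) (hw.pos hm) ?_ ?_ (hB δ K M a b hδ0 hv hw) ?_
  · simpa [hv.zero] using S₃.curve 0 (by omega)
  · simpa [hw.zero] using S₃.curve' 0 (by omega)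
  · intro σ₄ F₄ hans
    refine hΦ σ₄ (F₃'.trans (F₄.mono (by decide) (by decide))) (fun h => ?_) (fun h => ?_)
    · refine ((reachable_of_simplification hn hm hv hw (hans.1 h)).frechetDist_le hn hm).trans_eq
        ?_
      ring
    · by_contra hlt
      obtain ⟨k, -, hr⟩ := exists_reach_of_frechetDist_lt hn hm h₀ (not_le.1 hlt)
      exact h (hans.2 (reachable_simplification hn hm hv hw ⟨k, hr⟩))

theorem curveArray_frame {σ σ' : Store} {Ns Rs : List ℕ} (F : Frame Ns Rs σ σ') {X : ℕ}
    (hX : X ∉ Rs) (h : σ.real X = curveArray p) : σ'.real X = curveArray p := by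
  rw [F.real X hX, h]

theorem approximateFrechet_ends {B u : ℕ} (hn : 1 ≤ n) (hm : 1 ≤ m) (hε : 0 < ε) (hε1 : ε ≤ 1)
    (hB : CellBound p q ε B) (hu : 6 * ((n + m : ℝ) / ε) ≤ 2 ^ u) :
    Ends approximateFrechet (inputStore p q ε) (6000 * (u + 2) * (n + m + B + 2) * (d + 1))
      fun σ => frechetDist p q ≤ output σ ∧ output σ ≤ (1 + ε) * frechetDist p q := by
  set N := (n + m + B + 2) * (d + 1) with hN
  have hN1 : (n + m + 1) * (d + 1) + (d + 1) ≤ N := by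
    have : N = (n + m + 1) * (d + 1) + (d + 1) + B * (d + 1) := by rw [hN]; ring
    omega
  have hN2 : n + m + 1 ≤ (n + m + 1) * (d + 1) := Nat.le_mul_of_pos_right _ (by omega)
  have hN3 : 3000 * (n + m + 1) * (d + 1) = 3000 * ((n + m + 1) * (d + 1)) := Nat.mul_assoc _ _ _
  have hbudget : 5000 * N + (u + 1) * (5000 * N + 160 + 40) ≤
      6000 * (u + 2) * (n + m + B + 2) * (d + 1) := by
    have e : 6000 * (u + 2) * (n + m + B + 2) * (d + 1) =
      6000 * N + (u + 1) * (5000 * N) + (u + 1) * (1000 * N) := by rw [hN]; ring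
    have e' : (u + 1) * (5000 * N + 160 + 40) = (u + 1) * (5000 * N) + (u + 1) * 200 := by ring
    have : (u + 1) * 200 ≤ (u + 1) * (1000 * N) := Nat.mul_le_mul_left _ (by omega)
    omega
  refine Ends.mono_time ?_ hbudget
  clear hbudget
  generalize hU : (u + 1) * (5000 * N + 160 + 40) = U
  have S₀ : (inputStore p q ε).real 0 = curveArray p := by funext i; simp [inputStore]
  have S₁ : (inputStore p q ε).real 1 = curveArray q := by funext i; simp [inputStore]
  refine Ends.then_le (400 * (n + d + 1)) (repeatLast_ends (by omega) hn (by simp [inputStore])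
    (by simp [inputStore]) S₀ ?_)
  intro σ₁ F₁ hx
  refine Ends.then_le (400 * (m + d + 1)) (repeatLast_ends (by omega) hm
    (by rw [F₁.nat 0 (by decide)]; simp [inputStore])
    (by rw [F₁.nat 2 (by decide)]; simp [inputStore]) (curveArray_frame F₁ (by decide) S₁) ?_)
  intro σ₂ F₂ hy
  have S : HoldsInput p q ε σ₂ := by
    refine ⟨?_, ?_, ?_, ?_, hy, ?_⟩
    · rw [F₂.nat 0 (by decide), F₁.nat 0 (by decide)]; simp [inputStore]
    · rw [F₂.nat 1 (by decide), F₁.nat 1 (by decide)]; simp [inputStore]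
    · rw [F₂.nat 2 (by decide), F₁.nat 2 (by decide)]; simp [inputStore]
    · rw [F₂.real 0 (by decide)]; exact hx
    · rw [F₂.real 2 (by decide), F₁.real 2 (by decide)]; simp [inputStore]
  refine Ends.then_le (3000 * (n + m + 1) * (d + 1)) (walk_ends S.dim S.len S.len' S.curve S.curve'
    ?_)
  intro σ₃ D F₃ hD hreach hle
  have S₃ := S.frame F₃ (by decide) (by decide) (by decide) (by decide) (by decide) (by decide)
  have hD0 : 0 ≤ D := dist_nonneg.trans hreach.dist_le
  have hup : frechetDist p q ≤ D := hreach.frechetDist_le hn hm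
  have hden : (0 : ℝ) < 2 * (n + m) + 1 := by positivity
  -- Every `r` above the Fréchet distance admits a chain of at most `n + m` steps, which bounds `D`.
  have hlow : D / (2 * (n + m) + 1) ≤ frechetDist p q := by
    refine le_of_forall_gt_imp_ge_of_dense fun r hr => ?_
    obtain ⟨k, hk, hr'⟩ := exists_reach_of_frechetDist_lt hn hm hreach hr
    rw [div_le_iff₀ hden, mul_comm]
    refine (hle r k hr').trans ?_
    have hk' : (k : ℝ) ≤ n + m := by exact_mod_cast hk
    have : 0 ≤ r := frechetDist_nonneg.trans hr.le
    gcongr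
  refine Ends.setRealVar_then (Ends.setRealVar_then ?_)
  have F₄ : Frame [] [14, 15] σ₃ _ := ((Frame.refl [] [14, 15] σ₃).setReal (a := 15) (by decide) 0
    ((realVar 7).eval σ₃)).setReal (a := 14) (by decide) 0 ((realVar 7 /
      (realConst 2 * RealExpr.ofNat (natVar 1 + natVar 2) + realConst 1)).eval
      (σ₃.setReal 15 0 ((realVar 7).eval σ₃)))
  generalize hσ₄ : Store.setReal _ 14 0 _ = σ₄ at F₄ ⊢
  have h15 : σ₄.real 15 0 = D := by rw [← hσ₄]; simp [hD]
  have h14 : σ₄.real 14 0 = D / (2 * (n + m) + 1) := by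
    rw [← hσ₄]; simp [hD, S₃.len, S₃.len']
  have S₄ := S₃.frame F₄ (by decide) (by decide) (by decide) (by decide) (by decide) (by decide)
  set lo₀ := D / (2 * (n + m) + 1) with hlo₀
  have hlo₀0 : 0 ≤ lo₀ := by positivity
  -- The upper end is certified only up to the factor `1 + ε/3` of the test. The gap is measured
  -- against the fixed lower bound `lo₀`, and `z` bounds the halvings left.
  let I : ℕ → Store → Prop := fun z σ' => HoldsInput p q ε σ' ∧ lo₀ ≤ σ'.real 14 0 ∧
    σ'.real 14 0 ≤ frechetDist p q ∧ frechetDist p q ≤ (1 + ε / 3) * σ'.real 15 0 ∧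
    σ'.real 15 0 - σ'.real 14 0 ≤ 2 ^ z * (ε / 3 * lo₀)
  refine Ends.then_le U (Ends.loop_le (5000 * N + 160) I (v := u) ?_ ?_ ?_ hU.le)
  · refine ⟨S₄, h14.ge, h14.trans_le hlow, ?_, ?_⟩
    · rw [h15]
      exact hup.trans (le_mul_of_one_le_left hD0 (le_add_of_nonneg_right (by positivity)))
    · rw [h15, h14]
      have hDlo : D = (2 * (n + m) + 1) * lo₀ := by rw [hlo₀]; field_simp
      have h1 : 2 * (n + m : ℝ) ≤ 2 ^ u * (ε / 3) := by
        have : 6 * ((n + m : ℝ) / ε) * (ε / 3) ≤ 2 ^ u * (ε / 3) := by gcongr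
        refine le_trans (le_of_eq ?_) this
        field_simp
        norm_num
      calc D - lo₀ = 2 * (n + m : ℝ) * lo₀ := by rw [hDlo]; ring
        _ ≤ 2 ^ u * (ε / 3) * lo₀ := by gcongr
        _ = _ := by ring
  · rintro z σ₅ ⟨S₅, hlo, hlo', hhi, hgap⟩ hb
    simp only [Test.holds_not, Test.holds_realLe, eval_realVar, RealExpr.eval_mul, RealExpr.eval_add,
      RealExpr.eval_div, eval_realConst, Nat.cast_one, Nat.cast_ofNat, S₅.eps, not_le] at hb
    -- For `z = 0` the gap is at most `ε/3` times the lower end, and the loop would have stopped.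
    have hz : z ≠ 0 := by
      rintro rfl
      have : ε / 3 * lo₀ ≤ ε / 3 * σ₅.real 14 0 := by gcongr
      rw [pow_zero, one_mul] at hgap
      rw [add_mul, one_mul] at hb
      linarith
    obtain ⟨z, rfl⟩ := Nat.exists_eq_succ_of_ne_zero hz
    have hpow : (2 : ℝ) ^ (z + 1) * (ε / 3 * lo₀) = 2 * (2 ^ z * (ε / 3 * lo₀)) := by ring
    rw [Nat.succ_eq_add_one, hpow] at hgap
    -- The loop test makes the upper end positive. If the Fréchet distance is 0, then `D = 0` and
    -- the loop is never entered.
    have hmid : 0 < (σ₅.real 14 0 + σ₅.real 15 0) / 2 := by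
      have : 0 ≤ (1 + ε / 3) * σ₅.real 14 0 := by
        have : 0 ≤ σ₅.real 14 0 := hlo₀0.trans hlo
        positivity
      linarith
    refine Ends.setRealVar_then ?_
    have F₆ : Frame [] [16] σ₅ _ := (Frame.refl [] [16] σ₅).setReal (a := 16) (by decide) 0
      (((realVar 14 + realVar 15) / realConst 2).eval σ₅)
    generalize hσ₆ : Store.setReal _ 16 0 _ = σ₆ at F₆ ⊢
    have g16 : σ₆.real 16 0 = (σ₅.real 14 0 + σ₅.real 15 0) / 2 := by rw [← hσ₆]; simp
    have S₆ := S₅.frame F₆ (by decide) (by decide) (by decide) (by decide) (by decide) (by decide)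
    refine Ends.then_le (5000 * N) ((testDistance_ends hn hm hε S₆ g16 hmid hB hreach ?_).mono_time
      (by rw [hN, Nat.mul_assoc]))
    intro σ₇ F₇ hyes hno
    have S₇ := S₆.frame F₇ (by decide) (by decide) (by decide) (by decide) (by decide) (by decide)
    have k14 : σ₇.real 14 0 = σ₅.real 14 0 := by
      rw [F₇.real 14 (by decide), F₆.real 14 (by decide)]
    have k15 : σ₇.real 15 0 = σ₅.real 15 0 := by
      rw [F₇.real 15 (by decide), F₆.real 15 (by decide)]
    have k16 : σ₇.real 16 0 = (σ₅.real 14 0 + σ₅.real 15 0) / 2 := by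
      rw [F₇.real 16 (by decide), g16]
    refine Ends.branch_le (fun h => Ends.setRealVar_le ?_) (fun h => Ends.setRealVar_le ?_)
    · have h' : σ₇.nat 23 0 = 1 := le_antisymm h.2 h.1
      refine ⟨z, by omega, S₇.frame (Ns := []) ((Frame.refl [] [15] σ₇).setReal (by decide) _ _)
        (by decide) (by decide) (by decide) (by decide) (by decide) (by decide), ?_, ?_, ?_, ?_⟩
      · simpa [k14] using hlo
      · simpa [k14] using hlo'
      · simpa [k16] using hyes h'
      · simp only [ne_eq, Nat.reduceEqDiff, not_false_eq_true, Store.real_setReal_of_ne,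
          Store.real_setReal_self, Function.update_self, eval_realVar, k14, k16]
        linarith
    · have h' : σ₇.nat 23 0 ≠ 1 := fun h' => h ⟨h'.ge, h'.le⟩
      have hδ := hno h'
      refine ⟨z, by omega, S₇.frame (Ns := []) ((Frame.refl [] [14] σ₇).setReal (by decide) _ _)
        (by decide) (by decide) (by decide) (by decide) (by decide) (by decide), ?_, ?_, ?_, ?_⟩
      · simp only [Store.real_setReal_self, Function.update_self, eval_realVar, k16]
        have : σ₅.real 14 0 ≤ (1 + ε / 3) * σ₅.real 14 0 :=
          le_mul_of_one_le_left (hlo₀0.trans hlo) (le_add_of_nonneg_right (by positivity))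
        linarith
      · simpa [k16] using hδ
      · simpa [k15] using hhi
      · simp only [ne_eq, Nat.reduceEqDiff, not_false_eq_true, Store.real_setReal_of_ne,
          Store.real_setReal_self, Function.update_self, eval_realVar, k15, k16]
        linarith
  · rintro z σ₅ ⟨S₅, hlo, hlo', hhi, hgap⟩ hb
    simp only [Test.holds_not, Test.holds_realLe, eval_realVar, RealExpr.eval_mul, RealExpr.eval_add,
      RealExpr.eval_div, eval_realConst, Nat.cast_one, Nat.cast_ofNat, S₅.eps, not_not] at hb
    refine Ends.setRealVar_le ?_
    · have e : output (σ₅.setReal 3 0 (((realConst 1 + realVar 2 / realConst 3) *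
          realVar 15).eval σ₅)) = (1 + ε / 3) * σ₅.real 15 0 := by
        simp [output, S₅.eps]
      rw [e]
      refine ⟨hhi, ?_⟩
      have hlo0 := hlo₀0.trans hlo
      -- One factor comes from the test and one from the final ratio of the bracket; for `ε ≤ 1`
      -- their product is at most `1 + ε`.
      calc (1 + ε / 3) * σ₅.real 15 0 ≤ (1 + ε / 3) * ((1 + ε / 3) * σ₅.real 14 0) := by gcongr
        _ = (1 + 2 * ε / 3 + ε * ε / 9) * σ₅.real 14 0 := by ring
        _ ≤ (1 + ε) * σ₅.real 14 0 := by
          have : ε * ε ≤ ε * 1 := by gcongr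
          gcongr ?_ * _
          linarith
        _ ≤ (1 + ε) * frechetDist p q := by gcongr

end RealRAM

/-! ### Number of bisection rounds and conclusion -/

/-- From `6 ≤ 2 ^ 3`, `x ≥ 2` and `log 2 > 1/2` follows `log₂ (6x) ≤ 8 log x`; rounding up and the
additive constant are absorbed since `3 ≤ 6 log 2`. -/
theorem exists_bisection_count {x : ℝ} (hx : 2 ≤ x) :
    ∃ u : ℕ, 6 * x ≤ 2 ^ u ∧ (u : ℝ) + 2 ≤ 14 * Real.log x := by
  have hl2 := Real.log_two_gt_d9
  have hlx : Real.log 2 ≤ Real.log x := Real.log_le_log (by norm_num) hx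
  refine ⟨⌈Real.logb 2 (6 * x)⌉₊, ?_, ?_⟩
  · rw [← Real.rpow_natCast, ← Real.logb_le_iff_le_rpow (by norm_num) (by positivity)]
    exact Nat.le_ceil _
  · have h6 : Real.log 6 ≤ 3 * Real.log 2 := by
      rw [show (3 : ℝ) * Real.log 2 = Real.log (2 ^ 3) by rw [Real.log_pow]; norm_num]
      exact Real.log_le_log (by norm_num) (by norm_num)
    have h1 : Real.logb 2 (6 * x) ≤ 8 * Real.log x := by
      rw [Real.logb, div_le_iff₀ (by linarith), Real.log_mul (by norm_num) (by linarith)]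
      nlinarith
    have h0 : 0 ≤ Real.logb 2 (6 * x) := Real.logb_nonneg (by norm_num) (by linarith)
    have := Nat.ceil_lt_add_one h0
    linarith

theorem theorem1 :
    ∃ (A : RealRAM.Program) (C : ℝ), 0 < C ∧
      ∀ (d n m : ℕ), 1 ≤ d → 1 ≤ n → 1 ≤ m →
      ∀ (P : Fin n → EuclideanSpace ℝ (Fin d)) (Q : Fin m → EuclideanSpace ℝ (Fin d)) (ε : ℝ),
        0 < ε → ε ≤ 1 →
        ∃ (t : ℕ) (σ : RealRAM.Store),
          RealRAM.Runs A (RealRAM.inputStore P Q ε) t σ ∧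
          PolygonalCurve.frechetDist P Q ≤ RealRAM.output σ ∧
          RealRAM.output σ ≤ (1 + ε) * PolygonalCurve.frechetDist P Q ∧
          ∀ c : ℝ, 1 ≤ c → PolygonalCurve.IsPacked c P ∨ PolygonalCurve.IsPacked c Q →
            (t : ℝ) ≤ C * (d * c * ((n + m) / ε) * Real.log ((n + m) / ε)) := by
  classical
  refine ⟨RealRAM.approximateFrechet, 6000 * 14 * 281 * 2, by norm_num, ?_⟩
  intro d n m hd hn hm P Q ε hε hε1
  have hn1 : (1 : ℝ) ≤ n := by exact_mod_cast hn
  have hm1 : (1 : ℝ) ≤ m := by exact_mod_cast hm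
  have hd1 : (1 : ℝ) ≤ d := by exact_mod_cast hd
  have hNx : (n : ℝ) + m ≤ (n + m) / ε := by
    rw [le_div_iff₀ hε]
    nlinarith
  have hx : 2 ≤ ((n : ℝ) + m) / ε := by linarith
  obtain ⟨u, hu, hu'⟩ := exists_bisection_count hx
  -- The run and its time are fixed before `c` is given. Estimating the time with the least cell
  -- bound makes a single estimate serve all `c`.
  have hex : ∃ B, RealRAM.CellBound P Q ε B := ⟨_, RealRAM.cellBound_mul P Q ε⟩
  obtain ⟨t, σ, hrun, ht, hout⟩ :=
    RealRAM.approximateFrechet_ends hn hm hε hε1 (Nat.find_spec hex) hu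
  refine ⟨t, σ, hrun, hout.1, hout.2, fun c hc hpacked => ?_⟩
  have hB : Nat.find hex ≤ ⌊278 * (c * (((n : ℝ) + m) / ε))⌋₊ := by
    refine Nat.find_min' hex ?_
    rcases hpacked with hP | hQ
    · exact RealRAM.cellBound_of_isPacked Q hn hε hε1 hc hP
    · have := (RealRAM.cellBound_of_isPacked P hm hε hε1 hc hQ).symm
      rwa [add_comm] at this
  set x := ((n : ℝ) + m) / ε with hxdef
  have hB' : (Nat.find hex : ℝ) ≤ 278 * (c * x) :=
    (Nat.cast_le.2 hB).trans (Nat.floor_le (by positivity))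
  have hcx : x ≤ c * x := le_mul_of_one_le_left (by linarith) hc
  have hlog : 0 ≤ Real.log x := Real.log_nonneg (by linarith)
  have hB0 : (0 : ℝ) ≤ Nat.find hex := Nat.cast_nonneg _
  calc (t : ℝ) ≤ ((6000 * (u + 2) * (n + m + Nat.find hex + 2) * (d + 1) : ℕ) : ℝ) :=
        Nat.cast_le.2 ht
    _ = 6000 * ((u : ℝ) + 2) * ((n : ℝ) + m + Nat.find hex + 2) * (d + 1) := by push_cast; ring
    -- Both `n + m` and 2 are at most `x ≤ c x`, which together with the 278 of the cell bound stays
    -- below 281.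
    _ ≤ 6000 * (14 * Real.log x) * (281 * (c * x)) * (2 * d) := by
      gcongr
      · linarith
      · linarith
    _ = 6000 * 14 * 281 * 2 * (d * c * x * Real.log x) := by ring
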